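/- Setting. A rational space is a finite-dimensional real vector space $V$ with a lattice $\Lambda$ (a discrete subgroup spanning $V$). A point $x$ is rational if $qx\in\Lambda$ for some integer $q\neq 0$; a subspace $L\subset V$ is rational if $L\cap\Lambda$ spans $L$, and then $W=V/L$, with the image of $\Lambda$ as its lattice $\Lambda_W$, is a rational quotient space of $V$. The dual $W^*$ is identified with $L^\perp\subset V^*$ and carries the dual lattice. A cone in $W$ is a set $\sum_{i=1}^k\mathbb R_+v_i$ with $k\ge 0$ and $v_i$ rational; an affine cone is a translate of a cone by a rational point; $\mathcal C(W)$ is the set of affine cones in $W$. Faces are non-empty, and $\mathfrak a$ is a face of itself. For a set $S\subset W$, $\operatorname{lin}(S)$ is the vector space parallel to its affine span. For a face $\mathfrak f$ of $\mathfrak a\in\mathcal C(W)$, the transverse cone $\mathfrak t(\mathfrak a,\mathfrak f)$ is the image of $\mathfrak a$ in $W/\operatorname{lin}(\mathfrak f)$, which is again a rational quotient space of $V$. Let $\mathcal H(W^*)$ be the ring of germs at $0$ of real-analytic functions on $W^*$ whose Taylor coefficients at $0$ with respect to an integral basis are rational. For $\mathfrak a\in\mathcal C(W)$ let $I(\mathfrak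 a)$ and $S(\mathfrak a)$ be the following meromorphic functions with rational coefficients on $W^*$ (quotients of two holomorphic functions on the complexification of $W^*$ with rational Taylor coefficients at $0$). If $\mathfrak a$ contains a straight line, both are $0$. Otherwise they are the meromorphic functions with $$I(\mathfrak a)(\xi)=\int_{\mathfrak a}e^{\langle\xi,x\rangle}\,dm(x),\qquad S(\mathfrak a)(\xi)=\sum_{x\in\mathfrak a\cap\Lambda_W}e^{\langle\xi,x\rangle}$$ for all $\xi\in W^*$ for which the integral, respectively the sum, converges absolutely; here $dm$ is Lebesgue measure on the affine span of $\mathfrak a$, normalized so that $\operatorname{lin}(\mathfrak a)\cap\Lambda_W$ has covolume $1$. (These functions exist and their germs at $0$ are uniquely determined.) Theorem. Let $V$ be a rational space and $Q$ a rational scalar product on $V^*$ (a scalar product with rational values on the dual lattice). Then $I(\mathfrak a)$ and $S(\mathfrak a)$ are well defined for all affine cones $\mathfrak a$ in all rational quotient spaces of $V$, and there exists a unique family of maps $\mu_W$, indexed by the rational quotient spaces $W$ of $V$, such that (a) $\mu_W$ maps $\mathcal C(W)$ to $\mathcal H(W^*)$; (b) if $W=\{0\}$, then $\mu_W(\{0\})=1$;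 (c) if $\mathfrak a\in\mathcal C(W)$ contains a straight line, then $\mu_W(\mathfrak a)=0$; (d) for every $W$ and every $\mathfrak a\in\mathcal C(W)$, the set of faces of $\mathfrak a$ is finite and, as germs at $0$ of meromorphic functions on $W^*$, $$S(\mathfrak a)=\sum_{\mathfrak f}\mu_{W/\operatorname{lin}(\mathfrak f)}(\mathfrak t(\mathfrak a,\mathfrak f))\,I(\mathfrak f),$$ the sum being over all faces $\mathfrak f$ of $\mathfrak a$, where $\mu_{W/\operatorname{lin}(\mathfrak f)}(\mathfrak t(\mathfrak a,\mathfrak f))$ is extended to $W^*$ by composition with the orthogonal projection, with respect to $Q$, of $W^*\subset V^*$ onto $(W/\operatorname{lin}(\mathfrak f))^*=\operatorname{lin}(\mathfrak f)^\perp$. -/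

import Mathlib

open Filter Topology MeasureTheory

namespace RatCone

/-! ### Analytic and meromorphic germs at the origin -/

section Germs

variable (E : Type*) [NormedAddCommGroup E] [NormedSpace ℝ E]

/-- The ring of germs at `0` of real-analytic functions on `E`. -/
def AnalyticGerm : Subring (Germ (𝓝 (0 : E)) ℝ) where
  carrier := {γ | ∃ f : E → ℝ, AnalyticAt ℝ f 0 ∧ γ = (f : Germ (𝓝 (0 : E)) ℝ)}
  mul_mem' := by
    rintro _ _ ⟨f, hf, rfl⟩ ⟨g, hg, rfl⟩
    exact ⟨f * g, hf.mul hg, rfl⟩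
  one_mem' := ⟨fun _ => 1, analyticAt_const, rfl⟩
  add_mem' := by
    rintro _ _ ⟨f, hf, rfl⟩ ⟨g, hg, rfl⟩
    exact ⟨f + g, hf.add hg, rfl⟩
  zero_mem' := ⟨fun _ => 0, analyticAt_const, rfl⟩
  neg_mem' := by
    rintro _ ⟨f, hf, rfl⟩
    exact ⟨-f, hf.neg, rfl⟩

/-- Germs at `0` of meromorphic functions on `E`: quotients of germs of analytic functions. -/
abbrev MeromorphicGerm : Type _ := FractionRing (AnalyticGerm E)

variable {E} {F : Type*} [NormedAddCommGroup F] [NormedSpace ℝ F]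

/-- The germ at `0` of `ξ ↦ φ (P ξ)`, for a germ `φ` at `0` and a linear map `P`. -/
def AnalyticGerm.pullback (P : E →L[ℝ] F) (φ : AnalyticGerm F) : AnalyticGerm E :=
  ⟨φ.1.compTendsto P (by simpa using P.continuous.tendsto 0), by
    obtain ⟨_, f, hf, rfl⟩ := φ
    refine ⟨f ∘ P, ?_, rfl⟩
    have h : AnalyticAt ℝ f (P 0) := by simpa using hf
    exact h.comp (P.analyticAt 0)⟩

end Germs

/-! ### Rational spaces, rational points, cones and faces -/

section Space

variable {W : Type*} [NormedAddCommGroup W] [NormedSpace ℝ W]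

/-- `x` is a rational point with respect to the lattice `Λ`. -/
def IsRationalPoint (Λ : Submodule ℤ W) (x : W) : Prop :=
  ∃ q : ℤ, q ≠ 0 ∧ q • x ∈ Λ

/-- `L ∩ Λ` generates `L`, i.e. `L ∩ Λ` is a lattice in `L`. -/
def IsRationalSubspace (Λ : Submodule ℤ W) (L : Submodule ℝ W) : Prop :=
  Submodule.span ℝ {x : W | x ∈ Λ ∧ x ∈ L} = L

/-- The cone `∑ ℝ₊ v i`. -/
def coneHull {k : ℕ} (v : Fin k → W) : Set W :=
  {x | ∃ t : Fin k → ℝ, (∀ i, 0 ≤ t i) ∧ x = ∑ i, t i • v i}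

/-- (Rational convex polyhedral) cones. -/
def IsCone (Λ : Submodule ℤ W) (c : Set W) : Prop :=
  ∃ (k : ℕ) (v : Fin k → W), (∀ i, IsRationalPoint Λ (v i)) ∧ c = coneHull v

/-- Affine (rational) cones `s + c`. -/
def IsAffineCone (Λ : Submodule ℤ W) (a : Set W) : Prop :=
  ∃ (s : W) (c : Set W), IsRationalPoint Λ s ∧ IsCone Λ c ∧ a = (fun x => s + x) '' c

/-- The set of affine cones of the rational space `(W, Λ)`. -/
abbrev AffineCone (Λ : Submodule ℤ W) : Type _ := {a : Set W // IsAffineCone Λ a}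

/-- `p` contains a straight line. -/
def ContainsLine (p : Set W) : Prop :=
  ∃ x v : W, v ≠ 0 ∧ ∀ t : ℝ, x + t • v ∈ p

/-- The (nonempty) faces of a polyhedron `p`: the nonempty sets of all points of `p` at which some
linear form attains its maximum on `p`. The form `0` gives `p` itself. -/
abbrev Face (p : Set W) : Type _ := {f : Set W // f.Nonempty ∧ IsExposed ℝ p f}

/-- The dual lattice, in the dual space of `W`. -/
def IsDualIntegral (Λ : Submodule ℤ W) (η : StrongDual ℝ W) : Prop :=
  ∀ x ∈ Λ, ∃ n : ℤ, η x = n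

/-- The Taylor coefficients of `f` at `0` with respect to an integral basis of the dual space are
rational: equivalently, all iterated derivatives at `0` along dual lattice vectors are rational. -/
def HasRationalTaylor (Λ : Submodule ℤ W) (f : StrongDual ℝ W → ℝ) : Prop :=
  ∀ (n : ℕ) (η : Fin n → StrongDual ℝ W), (∀ i, IsDualIntegral Λ (η i)) →
    ∃ q : ℚ, iteratedFDeriv ℝ n f 0 η = q

/-- Germs at `0` of analytic functions on the dual of `W` with rational Taylor coefficients. -/
abbrev RationalAnalyticGerm (Λ : Submodule ℤ W) : Type _ :=
  {φ : AnalyticGerm (StrongDual ℝ W) //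
    ∃ f : StrongDual ℝ W → ℝ, AnalyticAt ℝ f 0 ∧ HasRationalTaylor Λ f ∧
      φ.1 = (f : Germ (𝓝 (0 : StrongDual ℝ W)) ℝ)}

/-- `g` is the restriction to the dual of `W` of a holomorphic function on its whole
complexification `Hom(W, ℂ)`. -/
def IsEntire (g : StrongDual ℝ W → ℝ) : Prop :=
  ∃ G : (W →L[ℝ] ℂ) → ℂ, Differentiable ℂ G ∧
    ∀ ξ : StrongDual ℝ W, G (Complex.ofRealCLM.comp ξ) = g ξ

/-- `m` is the germ at `0` of the meromorphic function `g / h`, where `g` and `h ≠ 0` are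
holomorphic on the complexification, with rational Taylor coefficients. -/
def IsRationalQuotient (Λ : Submodule ℤ W) (m : MeromorphicGerm (StrongDual ℝ W))
    (g h : StrongDual ℝ W → ℝ) : Prop :=
  (IsEntire g ∧ HasRationalTaylor Λ g) ∧ (IsEntire h ∧ HasRationalTaylor Λ h) ∧
  ∃ γ δ : AnalyticGerm (StrongDual ℝ W),
    γ.1 = (g : Germ (𝓝 (0 : StrongDual ℝ W)) ℝ) ∧
    δ.1 = (h : Germ (𝓝 (0 : StrongDual ℝ W)) ℝ) ∧ δ ≠ 0 ∧
    m * algebraMap _ _ δ = algebraMap _ _ γ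

/-- `m` is the meromorphic function `S(p)`: it is `0` if `p` contains a straight line, and otherwise
it is the meromorphic function `g / h` with rational coefficients such that
`S(p)(ξ) = ∑_{x ∈ p ∩ Λ} e^⟨ξ,x⟩` whenever the series converges. -/
def IsExpSum (Λ : Submodule ℤ W) (p : Set W) (m : MeromorphicGerm (StrongDual ℝ W)) : Prop :=
  (ContainsLine p → m = 0) ∧
  (¬ ContainsLine p → ∃ g h : StrongDual ℝ W → ℝ, IsRationalQuotient Λ m g h ∧
    ∀ ξ : StrongDual ℝ W,
      Summable (fun x : {x : W // x ∈ p ∧ x ∈ Λ} => Real.exp (ξ x)) →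
        g ξ = h ξ * ∑' x : {x : W // x ∈ p ∧ x ∈ Λ}, Real.exp (ξ x))

open Classical in
/-- The meromorphic function `S(p)`. -/
noncomputable def expSum (Λ : Submodule ℤ W) (p : Set W) : MeromorphicGerm (StrongDual ℝ W) :=
  if h : ∃ m, IsExpSum Λ p m then h.choose else 0

variable [FiniteDimensional ℝ W]

/-- The lattice `U ∩ Λ` of a subspace `U`. -/
def subLattice (Λ : Submodule ℤ W) (U : Submodule ℝ W) : Submodule ℤ U :=
  Λ.comap (U.subtype.restrictScalars ℤ)

/-- The canonical Lebesgue measure of a rational subspace `U`: the Haar measure on `U` for which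
`U ∩ Λ` has covolume `1`. -/
noncomputable def subMeasure (Λ : Submodule ℤ W) (U : Submodule ℝ W) :
    @Measure U (borel U) :=
  letI : MeasurableSpace U := borel U
  haveI : BorelSpace U := ⟨rfl⟩
  (ENNReal.ofReal (ZLattice.covolume (subLattice Λ U) (Measure.addHaar : Measure U)))⁻¹ •
    (Measure.addHaar : Measure U)

open Classical in
/-- The relative Lebesgue measure on the affine span of `p`, regarded as a measure on `W`. The affine
span is parametrized by `u ↦ x₀ + u`, where `x₀ ∈ p` and `u` runs through the direction `lin p`; the
result does not depend on `x₀`. -/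
noncomputable def relMeasure (Λ : Submodule ℤ W) (p : Set W) : @Measure W (borel W) :=
  letI : MeasurableSpace W := borel W
  letI : MeasurableSpace (vectorSpan ℝ p) := borel (vectorSpan ℝ p)
  if hp : p.Nonempty then
    (subMeasure Λ (vectorSpan ℝ p)).map (fun u : vectorSpan ℝ p => hp.some + (u : W))
  else 0

/-- `m` is the meromorphic function `I(p)`: it is `0` if `p` contains a straight line, and otherwise
it is the meromorphic function `g / h` with rational coefficients such that
`I(p)(ξ) = ∫_p e^⟨ξ,x⟩` (relative Lebesgue measure) whenever the integral converges. -/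
def IsExpIntegral (Λ : Submodule ℤ W) (p : Set W) (m : MeromorphicGerm (StrongDual ℝ W)) : Prop :=
  letI : MeasurableSpace W := borel W
  (ContainsLine p → m = 0) ∧
  (¬ ContainsLine p → ∃ g h : StrongDual ℝ W → ℝ, IsRationalQuotient Λ m g h ∧
    ∀ ξ : StrongDual ℝ W,
      IntegrableOn (fun x : W => Real.exp (ξ x)) p (relMeasure Λ p) →
        g ξ = h ξ * ∫ x in p, Real.exp (ξ x) ∂(relMeasure Λ p))

open Classical in
/-- The meromorphic function `I(p)`. -/
noncomputable def expIntegral (Λ : Submodule ℤ W) (p : Set W) :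
    MeromorphicGerm (StrongDual ℝ W) :=
  if h : ∃ m, IsExpIntegral Λ p m then h.choose else 0

end Space

/-! ### Rational quotient spaces -/

section Quotient

variable {V : Type*} [NormedAddCommGroup V] [NormedSpace ℝ V] [FiniteDimensional ℝ V]

instance instIsClosedSubmodule (L : Submodule ℝ V) : IsClosed (L : Set V) :=
  L.closed_of_finiteDimensional

/-- The rational quotient spaces `V ⧸ L` of `V` are indexed by the rational subspaces `L`. -/
abbrev RationalSubspace (Λ : Submodule ℤ V) : Type _ :=
  {L : Submodule ℝ V // IsRationalSubspace Λ L}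

/-- The lattice of `V ⧸ L`: the image of `Λ`. -/
def quotLattice (Λ : Submodule ℤ V) (L : Submodule ℝ V) : Submodule ℤ (V ⧸ L) :=
  Λ.map (L.mkQ.restrictScalars ℤ)

/-- A rational scalar product on the dual of the rational space `(V, Λ)`. -/
structure RationalScalarProduct (Λ : Submodule ℤ V) where
  /-- the underlying bilinear form -/
  form : LinearMap.BilinForm ℝ (StrongDual ℝ V)
  symm : ∀ ξ η, form ξ η = form η ξ
  pos : ∀ ξ, ξ ≠ 0 → 0 < form ξ ξ
  rational : ∀ ξ η, IsDualIntegral Λ ξ → IsDualIntegral Λ η → ∃ q : ℚ, form ξ η = q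

/-- The inclusion `(V ⧸ L)* = L^⊥ ⊆ V*`. -/
noncomputable def dualIncl (L : Submodule ℝ V) : StrongDual ℝ (V ⧸ L) →ₗ[ℝ] StrongDual ℝ V where
  toFun ξ := ξ.comp (L.mkQ).toContinuousLinearMap
  map_add' _ _ := rfl
  map_smul' _ _ := rfl

theorem dualIncl_injective (L : Submodule ℝ V) : Function.Injective (dualIncl L) := by
  intro ξ η h
  ext x
  obtain ⟨y, rfl⟩ := L.mkQ_surjective x
  exact congrArg (fun ζ : StrongDual ℝ V => ζ y) h

/-- The scalar product which `(V ⧸ L)*` inherits from `V*`. -/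
noncomputable def quotForm {Λ : Submodule ℤ V} (Q : RationalScalarProduct Λ) (L : Submodule ℝ V) :
    LinearMap.BilinForm ℝ (StrongDual ℝ (V ⧸ L)) :=
  Q.form.compl₁₂ (dualIncl L) (dualIncl L)

theorem quotForm_nondegenerate {Λ : Submodule ℤ V} (Q : RationalScalarProduct Λ)
    (L : Submodule ℝ V) : (quotForm Q L).Nondegenerate := by
  have key : ∀ ξ : StrongDual ℝ (V ⧸ L), quotForm Q L ξ ξ = 0 → ξ = 0 := by
    intro ξ h
    by_contra hne
    have h1 : dualIncl L ξ ≠ 0 := fun h0 => hne (dualIncl_injective L (by simpa using h0))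
    exact (Q.pos _ h1).ne' h
  exact ⟨fun ξ h => key ξ (h ξ), fun ξ h => key ξ (h ξ)⟩

/-- The orthogonal projection `(V ⧸ L)* → (V ⧸ L')*` for `L ≤ L'`, where `(V ⧸ L')*` and `(V ⧸ L)*`
are the subspaces `L'^⊥ ⊆ L^⊥` of `V*`. -/
noncomputable def dualProj {Λ : Submodule ℤ V} (Q : RationalScalarProduct Λ)
    (L L' : Submodule ℝ V) : StrongDual ℝ (V ⧸ L) →L[ℝ] StrongDual ℝ (V ⧸ L') :=
  LinearMap.toContinuousLinearMap
    (((quotForm Q L').toDual (quotForm_nondegenerate Q L')).symm.toLinearMap ∘ₗ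
      Q.form.compl₁₂ (dualIncl L) (dualIncl L'))

/-- The defining property of the orthogonal projection: `ξ - dualProj ξ` is orthogonal to
`(V ⧸ L')*`. -/
theorem dualProj_spec {Λ : Submodule ℤ V} (Q : RationalScalarProduct Λ) (L L' : Submodule ℝ V)
    (ξ : StrongDual ℝ (V ⧸ L)) (ζ : StrongDual ℝ (V ⧸ L')) :
    Q.form (dualIncl L ξ - dualIncl L' (dualProj Q L L' ξ)) (dualIncl L' ζ) = 0 := by
  have h : quotForm Q L' (dualProj Q L L' ξ) ζ = Q.form (dualIncl L ξ) (dualIncl L' ζ) := by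
    simp [dualProj, LinearMap.BilinForm.apply_toDual_symm_apply]
  rw [map_sub, LinearMap.sub_apply, ← h]
  simp [quotForm]

/-- A germ `φ` at `0` of an analytic function on `(V ⧸ L')*`, extended to `(V ⧸ L)*` by means of the
orthogonal projection. -/
noncomputable def extendGerm {Λ : Submodule ℤ V} (Q : RationalScalarProduct Λ)
    (L L' : Submodule ℝ V) (φ : AnalyticGerm (StrongDual ℝ (V ⧸ L'))) :
    AnalyticGerm (StrongDual ℝ (V ⧸ L)) :=
  AnalyticGerm.pullback (E := StrongDual ℝ (V ⧸ L)) (F := StrongDual ℝ (V ⧸ L'))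
    (dualProj Q L L') φ

/-- The linear space parallel to a face of an affine cone is spanned by rational vectors. -/
theorem vectorSpan_face {W : Type*} [NormedAddCommGroup W] [NormedSpace ℝ W] {Λ : Submodule ℤ W}
    (a : AffineCone Λ) (f : Face a.1) :
    ∃ T : Set W, (∀ v ∈ T, IsRationalPoint Λ v) ∧ vectorSpan ℝ f.1 = Submodule.span ℝ T := by
  obtain ⟨a, s, _, hs, ⟨k, v, hv, rfl⟩, rfl⟩ := a
  obtain ⟨f, hne, hf⟩ := f
  obtain ⟨l, hl⟩ := hf hne
  have hmem : ∀ t : Fin k → ℝ, (∀ i, 0 ≤ t i) →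
      s + ∑ i, t i • v i ∈ (fun x => s + x) '' coneHull v := fun t ht => ⟨_, ⟨t, ht, rfl⟩, rfl⟩
  have hle : ∀ i, l (v i) ≤ 0 := by
    intro i
    obtain ⟨x, hx⟩ := hne
    rw [hl] at hx
    obtain ⟨⟨_, ⟨t, ht, rfl⟩, rfl⟩, hmax⟩ := hx
    have h1 := hmax _ (hmem (t + Pi.single i 1) (fun j => by
      have : (0 : ℝ) ≤ (Pi.single i 1 : Fin k → ℝ) j := by
        rw [Pi.single_apply]; split_ifs <;> norm_num
      simpa using add_nonneg (ht j) this))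
    simp only [Pi.add_apply, add_smul, Finset.sum_add_distrib, Pi.single_apply, ite_smul, one_smul,
      zero_smul, Finset.sum_ite_eq', Finset.mem_univ, if_true, map_add] at h1
    linarith
  have hzero : ∀ t : Fin k → ℝ, (∀ i, 0 ≤ t i) → s + ∑ i, t i • v i ∈ f →
      ∀ i, t i * l (v i) = 0 := by
    intro t ht hx
    rw [hl] at hx
    have h1 := hx.2 _ (hmem 0 (fun _ => le_rfl))
    simp only [Pi.zero_apply, zero_smul, Finset.sum_const_zero, map_add, map_zero, map_sum,
      map_smul, smul_eq_mul] at h1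
    have h2 : ∑ i, t i * l (v i) = 0 :=
      le_antisymm (Finset.sum_nonpos fun i _ => mul_nonpos_of_nonneg_of_nonpos (ht i) (hle i))
        (by linarith)
    intro i
    exact (Finset.sum_eq_zero_iff_of_nonpos
      (fun i _ => mul_nonpos_of_nonneg_of_nonpos (ht i) (hle i))).1 h2 i (Finset.mem_univ i)
  refine ⟨{w | ∃ i, l (v i) = 0 ∧ w = v i}, ?_, le_antisymm ?_ ?_⟩
  · rintro _ ⟨i, _, rfl⟩
    exact hv i
  · rw [vectorSpan_def, Submodule.span_le]
    rintro _ ⟨x, hx, y, hy, rfl⟩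
    have hx' : x ∈ f := hx
    have hy' : y ∈ f := hy
    rw [hl] at hx' hy'
    obtain ⟨_, ⟨t, ht, rfl⟩, rfl⟩ := hx'.1
    obtain ⟨_, ⟨u, hu, rfl⟩, rfl⟩ := hy'.1
    have e : (s + ∑ i, t i • v i) -ᵥ (s + ∑ i, u i • v i) = ∑ i, (t i - u i) • v i := by
      simp [sub_smul, Finset.sum_sub_distrib]
    simp only [SetLike.mem_coe]
    rw [e]
    refine Submodule.sum_mem _ fun i _ => ?_
    by_cases h0 : l (v i) = 0
    · exact Submodule.smul_mem _ _ (Submodule.subset_span ⟨i, h0, rfl⟩)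
    · have h1 : t i = 0 := (mul_eq_zero.1 (hzero t ht hx i)).resolve_right h0
      have h2 : u i = 0 := (mul_eq_zero.1 (hzero u hu hy i)).resolve_right h0
      simp [h1, h2]
  · rw [Submodule.span_le]
    rintro _ ⟨i, h0, rfl⟩
    obtain ⟨x, hx⟩ := hne
    have hx' := hx
    rw [hl] at hx'
    obtain ⟨⟨_, ⟨t, ht, rfl⟩, rfl⟩, hmax⟩ := hx'
    have h1 : s + ∑ j, (t + Pi.single i 1 : Fin k → ℝ) j • v j = (s + ∑ j, t j • v j) + v i := by
      simp [add_smul, Finset.sum_add_distrib, Pi.single_apply, ite_smul, add_assoc]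
    have h2 : (s + ∑ j, t j • v j) + v i ∈ f := by
      rw [hl]
      refine ⟨h1 ▸ hmem _ (fun j => ?_), fun y hy => ?_⟩
      · have : (0 : ℝ) ≤ (Pi.single i 1 : Fin k → ℝ) j := by
          rw [Pi.single_apply]; split_ifs <;> norm_num
        simpa using add_nonneg (ht j) this
      · rw [map_add l _ (v i), h0, add_zero]
        exact hmax y hy
    have h3 := vsub_mem_vectorSpan ℝ h2 hx
    simpa using h3

/-- If `f` is a face of an affine cone in `V ⧸ L`, then `(V ⧸ L) ⧸ lin f = V ⧸ L'`, where `L'` is the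
preimage of `lin f` in `V`. This is `L'`, with the proof that it is rational. -/
noncomputable def faceSubspace {Λ : Submodule ℤ V} (L : RationalSubspace Λ) (a : AffineCone (quotLattice Λ L.1))
    (f : Face a.1) : RationalSubspace Λ :=
  ⟨(vectorSpan ℝ f.1).comap L.1.mkQ, by
    obtain ⟨T, hT, hspan⟩ := vectorSpan_face a f
    obtain ⟨L, hL⟩ := L
    refine le_antisymm (Submodule.span_le.2 fun x hx => hx.2) fun x hx => ?_
    set M := Submodule.span ℝ {x : V | x ∈ Λ ∧ x ∈ (vectorSpan ℝ f.1).comap L.mkQ} with hM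
    have hLM : L ≤ M := by
      rw [← hL]
      refine Submodule.span_mono fun y hy => ⟨hy.1, ?_⟩
      have : L.mkQ y = 0 := by simpa using hy.2
      simp only [Submodule.mem_comap, this, zero_mem]
    have hTM : Submodule.span ℝ T ≤ M.map L.mkQ := by
      refine Submodule.span_le.2 fun w hw => ?_
      obtain ⟨q, hq, y, hy, hyw⟩ := hT w hw
      have hyw' : L.mkQ y = (q : ℝ) • w := by
        rw [Int.cast_smul_eq_zsmul]; exact hyw
      have hyM : y ∈ M := by
        refine Submodule.subset_span ⟨hy, ?_⟩
        rw [Submodule.mem_comap, hyw', hspan]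
        exact Submodule.smul_mem _ _ (Submodule.subset_span hw)
      refine ⟨(q : ℝ)⁻¹ • y, M.smul_mem _ hyM, ?_⟩
      rw [map_smul, hyw', smul_smul, inv_mul_cancel₀ (by exact_mod_cast hq), one_smul]
    have hx' : L.mkQ x ∈ M.map L.mkQ := hTM (hspan ▸ hx)
    obtain ⟨y, hy, hxy⟩ := hx'
    have hd : x - y ∈ L := by
      rw [← Submodule.Quotient.mk_eq_zero, Submodule.Quotient.mk_sub, sub_eq_zero]
      exact hxy.symm
    have := M.add_mem (hLM hd) hy
    simpa using this⟩

theorem le_faceSubspace {Λ : Submodule ℤ V} (L : RationalSubspace Λ)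
    (a : AffineCone (quotLattice Λ L.1)) (f : Face a.1) : L.1 ≤ (faceSubspace L a f).1 := by
  intro x hx
  have : L.1.mkQ x = 0 := by simpa using hx
  simp only [faceSubspace, Submodule.mem_comap, this, zero_mem]

/-- The transverse cone of the affine cone `a` along its face `f`: the image of `a` in
`(V ⧸ L) ⧸ lin f = V ⧸ L'`. -/
noncomputable def transverseCone {Λ : Submodule ℤ V} (L : RationalSubspace Λ)
    (a : AffineCone (quotLattice Λ L.1)) (f : Face a.1) :
    AffineCone (quotLattice Λ (faceSubspace L a f).1) :=
  ⟨Submodule.factor (le_faceSubspace L a f) '' a.1, by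
    have hrat : ∀ x, IsRationalPoint (quotLattice Λ L.1) x →
        IsRationalPoint (quotLattice Λ (faceSubspace L a f).1)
          (Submodule.factor (le_faceSubspace L a f) x) := by
      rintro x ⟨q, hq, y, hy, hyx⟩
      refine ⟨q, hq, y, hy, ?_⟩
      rw [← map_zsmul, ← hyx]
      rfl
    generalize Submodule.factor (le_faceSubspace L a f) = F at hrat
    obtain ⟨s, _, hs, ⟨k, v, hv, rfl⟩, ha⟩ := a.2
    refine ⟨F s, _, hrat s hs, ⟨k, fun i => F (v i), fun i => hrat _ (hv i), rfl⟩, ?_⟩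
    rw [ha]
    ext z
    constructor
    · rintro ⟨_, ⟨_, ⟨t, ht, rfl⟩, rfl⟩, rfl⟩
      exact ⟨_, ⟨t, ht, rfl⟩, by simp⟩
    · rintro ⟨_, ⟨t, ht, rfl⟩, rfl⟩
      exact ⟨_, ⟨_, ⟨t, ht, rfl⟩, rfl⟩, by simp⟩⟩

end Quotient

end RatCone

/-!
The proof follows the residue argument for local Euler–Maclaurin formulas. Write `D v` for the germ
of `1 - e^⟨ξ,v⟩`.

*Explicit fractions for `S` and `I`.* A pointed affine cone `s + ∑ ℝ₊ v i`, with lattice vectors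
`v i`, is triangulated without adding rays: the simplices are the supports of the lexicographically
minimal representations of its points (`LexAdm`, `indicator_eq_sum`). On an open simplicial cone,
multiplication by `∏ (1 - e^⟨ξ,v i⟩)` telescopes the sum, respectively the integral, to one over a
half-open box, whenever it converges at `ξ` (`telescope`). Hence `S` and `I` are sums of fractions
with denominators `∏ D (v i)` and entire rational numerators (`isExpSum_cone`,
`isExpIntegral_cone`). They are unique because the domain of convergence contains a nonempty open
set and the functions in question are entire.

*Residues.* Along the hyperplane `v i ^⊥`, for an edge `v i` of a pointed cone, all poles are simple.
If the order of the generators puts `v i` last, then the simplices of the triangulation which contain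
`v i` are those of the triangulation of the image of the cone modulo `ℝ v i` (`lexAdm_link`). So the
restriction of `D (v i) S(a)` to `v i ^⊥` is `S` of the transverse cone along this edge, and the
restriction of `D (v i) I(f)` is `I` of the image of the face `f`, or `0` if the edge is not a direction
of `f` (`specializes_expSum`, `IsEdgeSystem.specializes_expIntegral_face`). The choice of primitive
edge vectors makes the lattice normalizations agree.

*Existence.* The germs are constructed by recursion from smaller to larger quotients of `V`. Given
the germs in all proper quotients of `V ⧸ L`, the faces of positive dimension of a pointed cone `a`
determine all terms of the formula but one. By the formula for the transverse cones along the edges,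
by transitivity of transverse cones and of the orthogonal projections, the residues of `S(a)` and of
the sum of these terms agree along each edge, so their difference is an analytic germ
(`exists_regular_part_expSum`). Since `I({s}) = e^⟨ξ,s⟩` is a unit, the difference can be absorbed
into the term of the vertex `s` (`exists_vertex_germ`). If `a` contains a line, then so do all its
faces, and the formula reads `0 = 0`.

*Rationality.* An analytic germ has rational Taylor coefficients as soon as its restrictions to
sufficiently many rational lines have (`hasRationalTaylor_of_lines`, by polarization); on a line, a
simple zero at the origin can be cancelled. So division by factors `D v` preserves rationality
(`RatAnalytic.of_one_sub_exp_mul`), and the orthogonal projections preserve it because `Q` is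
rational (`dualProj_rational`).

*Uniqueness.* By the same recursion the formula determines the coefficient of `I({s})`, which is not
a zero divisor (`EulerMaclaurin.eq_of_pointed`).
-/

namespace RatCone

/-! ### Analytic germs: domain, pullback, division by a linear form -/

section Division

variable {E : Type*} [NormedAddCommGroup E] [NormedSpace ℝ E]

/-- The power series of the divided difference of `∑ pₙ` between `P ξ` and `ξ = P ξ + ℓ ξ • w`:
its degree `m` term is `∑ⱼ p_{m+1} (ξ, …, ξ, w, P ξ, …, P ξ)`, with `w` in position `j`. -/
noncomputable def dividedSeries (p : FormalMultilinearSeries ℝ E ℝ) (P : E →L[ℝ] E) (w : E) :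
    FormalMultilinearSeries ℝ E ℝ := fun m =>
  ∑ j : Fin (m + 1), ((p (m + 1)).curryMid j w).compContinuousLinearMap
    (fun i : Fin m => if i.castSucc < j then ContinuousLinearMap.id ℝ E else P)

theorem dividedSeries_apply_diag (p : FormalMultilinearSeries ℝ E ℝ) (P : E →L[ℝ] E)
    (w : E) (c : ℝ) (m : ℕ) (ξ : E) (h : ξ = P ξ + c • w) :
    c * dividedSeries p P w m (fun _ => ξ) = p (m + 1) (fun _ => ξ) - p (m + 1) (fun _ => P ξ) := by
  set a : ℕ → ℝ := fun j => p (m + 1) (fun k => if k.val < j then ξ else P ξ) with ha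
  have hterm : ∀ j : Fin (m + 1), c * ((p (m + 1)).curryMid j w).compContinuousLinearMap
      (fun i : Fin m => if i.castSucc < j then ContinuousLinearMap.id ℝ E else P) (fun _ => ξ) =
      a (j + 1) - a j := by
    intro j
    set base : Fin (m + 1) → E := fun k => if k < j then ξ else P ξ with hbase
    have h1 : (fun k : Fin (m + 1) => if k.val < j.val + 1 then ξ else P ξ) =
        Function.update base j ξ := by
      funext k
      rcases lt_trichotomy k j with hk | hk | hk
      · have : k.val < j.val + 1 := by have := Fin.lt_def.1 hk; omega
        simp [hbase, hk, hk.ne, this]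
      · subst hk; simp
      · have : ¬ k.val < j.val + 1 := by have := Fin.lt_def.1 hk; omega
        simp [hbase, hk.ne', hk.not_gt, this]
    have h2 : (fun k : Fin (m + 1) => if k.val < j.val then ξ else P ξ) =
        Function.update base j (P ξ) := by
      funext k
      rcases eq_or_ne k j with hk | hk
      · subst hk; simp
      · simp [hbase, hk]
    have h3 : (j.insertNth w fun i : Fin m =>
        (if i.castSucc < j then ContinuousLinearMap.id ℝ E else P) ξ) =
        Function.update base j w := by
      funext k
      refine Fin.succAboveCases j ?_ (fun i => ?_) k
      · simp
      · rw [Fin.insertNth_apply_succAbove, Function.update_of_ne (Fin.succAbove_ne j i)]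
        by_cases hi : i.castSucc < j
        · simp [hbase, Fin.succAbove_of_castSucc_lt _ _ hi, hi]
        · have h4 : ¬ i.succ < j := by
            simp only [Fin.lt_def, Fin.val_castSucc, Fin.val_succ, not_lt] at hi ⊢; omega
          simp [hbase, Fin.succAbove_of_le_castSucc _ _ (not_lt.1 hi), hi, h4]
    have h5 : ξ - P ξ = c • w := by rw [sub_eq_iff_eq_add']; exact h
    rw [ContinuousMultilinearMap.compContinuousLinearMap_apply,
      ContinuousMultilinearMap.curryMid_apply]
    simp only [ha]
    rw [h1, h2, ← ContinuousMultilinearMap.map_update_sub, h5,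
      ContinuousMultilinearMap.map_update_smul, smul_eq_mul]
    exact congrArg _ (congrArg _ h3)
  rw [dividedSeries, _root_.sum_apply, Finset.mul_sum, Finset.sum_congr rfl fun j _ => hterm j,
    Fin.sum_univ_eq_sum_range (fun j => a (j + 1) - a j), Finset.sum_range_sub]
  simp only [ha]
  congr 2; funext k; simp [k.is_lt]

theorem dividedSeries_radius_pos (p : FormalMultilinearSeries ℝ E ℝ) (P : E →L[ℝ] E) (w : E)
    (hp : 0 < p.radius) : 0 < (dividedSeries p P w).radius := by
  obtain ⟨C, r, hC, hr, hb⟩ := p.le_mul_pow_of_radius_pos hp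
  set K : ℝ := 1 + ‖P‖ with hK
  have hK0 : 0 < K := by positivity
  have hbound : ∀ m, ‖dividedSeries p P w m‖ ≤ C * r * ‖w‖ * (2 * r * K) ^ m := by
    intro m
    have h1 : ∀ j : Fin (m + 1), ‖((p (m + 1)).curryMid j w).compContinuousLinearMap
      (fun i : Fin m => if i.castSucc < j then ContinuousLinearMap.id ℝ E else P)‖ ≤
        C * r ^ (m + 1) * ‖w‖ * K ^ m := by
      intro j
      refine (ContinuousMultilinearMap.norm_compContinuousLinearMap_le _ _).trans ?_
      refine mul_le_mul ?_ ?_ (Finset.prod_nonneg fun _ _ => norm_nonneg _) (by positivity)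
      · refine (((p (m + 1)).curryMid j).le_opNorm w).trans ?_
        rw [ContinuousMultilinearMap.norm_curryMid]
        exact mul_le_mul_of_nonneg_right (hb _) (norm_nonneg _)
      · refine (Finset.prod_le_prod (g := fun _ => K) (fun _ _ => norm_nonneg _)
          fun i _ => ?_).trans (by simp)
        split_ifs
        · exact ContinuousLinearMap.norm_id_le.trans (by simp [hK])
        · simp [hK]
    refine (norm_sum_le _ _).trans ((Finset.sum_le_card_nsmul _ _ _ fun j _ => h1 j).trans ?_)
    rw [Finset.card_univ, Fintype.card_fin, nsmul_eq_mul]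
    have h2 : ((m + 1 : ℕ) : ℝ) ≤ 2 ^ m := by exact_mod_cast Nat.lt_two_pow_self
    calc ((m + 1 : ℕ) : ℝ) * (C * r ^ (m + 1) * ‖w‖ * K ^ m)
        ≤ 2 ^ m * (C * r ^ (m + 1) * ‖w‖ * K ^ m) := by gcongr
      _ = C * r * ‖w‖ * (2 * r * K) ^ m := by rw [mul_pow, mul_pow, pow_succ]; ring
  have hpos : 0 < 2 * r * K := by positivity
  have hle := (dividedSeries p P w).le_radius_of_bound (C * r * ‖w‖)
    (r := Real.toNNReal (2 * r * K)⁻¹) (fun n => by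
      rw [Real.coe_toNNReal _ (inv_pos.2 hpos).le]
      calc _ ≤ C * r * ‖w‖ * (2 * r * K) ^ n * ((2 * r * K)⁻¹) ^ n :=
            mul_le_mul_of_nonneg_right (hbound n) (pow_nonneg (inv_pos.2 hpos).le _)
        _ = C * r * ‖w‖ := by
            rw [mul_assoc, ← mul_pow, mul_inv_cancel₀ hpos.ne', one_pow, mul_one])
  refine lt_of_lt_of_le ?_ hle
  rw [ENNReal.coe_pos, Real.toNNReal_pos]
  exact inv_pos.2 hpos

/-- An analytic function which vanishes near `0` on the hyperplane `P E = ker ℓ` is the product of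
`ℓ` and an analytic function. -/
theorem AnalyticAt.exists_eq_mul_of_comp_eq_zero {φ : E → ℝ} (hφ : AnalyticAt ℝ φ 0)
    (P : E →L[ℝ] E) (l : E →L[ℝ] ℝ) (w : E) (h : ∀ ξ, ξ = P ξ + l ξ • w)
    (h0 : ∀ᶠ ξ in 𝓝 (0 : E), φ (P ξ) = 0) :
    ∃ ψ : E → ℝ, AnalyticAt ℝ ψ 0 ∧ ∀ᶠ ξ in 𝓝 (0 : E), φ ξ = l ξ * ψ ξ := by
  obtain ⟨p, r, hp⟩ := hφ
  have hrad := dividedSeries_radius_pos p P w hp.radius_pos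
  have hq := (dividedSeries p P w).hasFPowerSeriesOnBall hrad
  refine ⟨(dividedSeries p P w).sum, hq.analyticAt, ?_⟩
  have e1 : ∀ᶠ ξ in 𝓝 (0 : E), ξ ∈ Metric.eball (0 : E) r := Metric.eball_mem_nhds _ hp.r_pos
  have e2 : ∀ᶠ ξ in 𝓝 (0 : E), P ξ ∈ Metric.eball (0 : E) r := by
    have : Tendsto P (𝓝 0) (𝓝 0) := by simpa using P.continuous.tendsto 0
    exact this e1
  have e3 : ∀ᶠ ξ in 𝓝 (0 : E), ξ ∈ Metric.eball (0 : E) (dividedSeries p P w).radius :=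
    Metric.eball_mem_nhds _ hrad
  filter_upwards [e1, e2, e3, h0] with ξ h1 h2 h3 h4
  have s1 := (hp.hasSum h1).sub (hp.hasSum h2)
  have s2 := (hq.hasSum h3).mul_left (l ξ)
  simp only [zero_add, h4, sub_zero] at s1 s2
  have s3 : HasSum (fun m => p (m + 1) (fun _ => ξ) - p (m + 1) (fun _ => P ξ)) (φ ξ) := by
    have hz : p 0 (fun _ => ξ) - p 0 (fun _ => P ξ) = 0 := by
      rw [sub_eq_zero]; congr 1; funext i; exact i.elim0
    rw [← hasSum_nat_add_iff' 1] at s1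
    simpa [hz] using s1
  simp only [dividedSeries_apply_diag p P w (l ξ) _ ξ (h ξ)] at s2
  exact s3.unique s2

end Division

section GermRing

variable {E F : Type*} [NormedAddCommGroup E] [NormedSpace ℝ E]
  [NormedAddCommGroup F] [NormedSpace ℝ F]

/-- The germ at `0` of an analytic function. -/
def AnalyticGerm.mk (f : E → ℝ) (hf : AnalyticAt ℝ f 0) : AnalyticGerm E :=
  ⟨(f : Germ (𝓝 (0 : E)) ℝ), f, hf, rfl⟩

theorem AnalyticGerm.exists_mk (φ : AnalyticGerm E) : ∃ f hf, φ = AnalyticGerm.mk f hf := by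
  obtain ⟨_, f, hf, rfl⟩ := φ
  exact ⟨f, hf, rfl⟩

theorem AnalyticGerm.mk_eq_mk {f g : E → ℝ} {hf : AnalyticAt ℝ f 0} {hg : AnalyticAt ℝ g 0} :
    AnalyticGerm.mk f hf = AnalyticGerm.mk g hg ↔ f =ᶠ[𝓝 0] g := by
  rw [Subtype.ext_iff]
  exact Germ.coe_eq

theorem AnalyticGerm.mk_eq_zero {f : E → ℝ} {hf : AnalyticAt ℝ f 0} :
    AnalyticGerm.mk f hf = 0 ↔ f =ᶠ[𝓝 0] 0 := by
  rw [Subtype.ext_iff]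
  exact Germ.coe_eq (g := (0 : E → ℝ))

theorem AnalyticGerm.mk_mul {f g : E → ℝ} (hf : AnalyticAt ℝ f 0) (hg : AnalyticAt ℝ g 0) :
    AnalyticGerm.mk f hf * AnalyticGerm.mk g hg = AnalyticGerm.mk (f * g) (hf.mul hg) := rfl

theorem AnalyticGerm.mk_add {f g : E → ℝ} (hf : AnalyticAt ℝ f 0) (hg : AnalyticAt ℝ g 0) :
    AnalyticGerm.mk f hf + AnalyticGerm.mk g hg = AnalyticGerm.mk (f + g) (hf.add hg) := rfl

/-- If `f` does not vanish near `0`, it is nonzero on some nonempty open subset of each ball on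
which it is analytic; there the second factor vanishes, hence everywhere by the identity theorem. -/
instance : NoZeroDivisors (AnalyticGerm E) where
  eq_zero_or_eq_zero_of_mul_eq_zero {φ γ} h := by
    obtain ⟨f, hf, rfl⟩ := AnalyticGerm.exists_mk φ
    obtain ⟨g, hg, rfl⟩ := AnalyticGerm.exists_mk γ
    rw [AnalyticGerm.mk_mul, AnalyticGerm.mk_eq_zero] at h
    rw [AnalyticGerm.mk_eq_zero, AnalyticGerm.mk_eq_zero]
    by_contra! hcon
    obtain ⟨ε, hε, hball⟩ := Metric.eventually_nhds_iff_ball.1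
      ((hf.eventually_analyticAt.and hg.eventually_analyticAt).and h)
    have hpre : IsPreconnected (Metric.ball (0 : E) ε) := (convex_ball 0 ε).isPreconnected
    have hfan : AnalyticOnNhd ℝ f (Metric.ball 0 ε) := fun x hx => (hball x hx).1.1
    have hgan : AnalyticOnNhd ℝ g (Metric.ball 0 ε) := fun x hx => (hball x hx).1.2
    have hmem := Metric.mem_ball_self (x := (0 : E)) hε
    have : ∃ x ∈ Metric.ball (0 : E) ε, f x ≠ 0 := by
      by_contra! h0
      exact hcon.1 (Filter.eventually_of_mem (Metric.ball_mem_nhds _ hε) h0)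
    obtain ⟨x, hx, hfx⟩ := this
    have hgx : g =ᶠ[𝓝 x] 0 := by
      filter_upwards [(hfan x hx).continuousAt.eventually_ne hfx,
        Metric.isOpen_ball.mem_nhds hx] with y hy hyb
      exact (mul_eq_zero.1 (hball y hyb).2).resolve_left hy
    have := hgan.eqOn_zero_of_preconnected_of_eventuallyEq_zero hpre hx hgx
    exact hcon.2 (Filter.eventually_of_mem (Metric.ball_mem_nhds _ hε) this)

instance : Nontrivial (AnalyticGerm E) := by
  refine ⟨0, 1, fun h => ?_⟩
  have h1 : AnalyticGerm.mk (1 : E → ℝ) analyticAt_const = 0 := h.symm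
  rw [AnalyticGerm.mk_eq_zero] at h1
  exact one_ne_zero h1.self_of_nhds

instance : IsDomain (AnalyticGerm E) := NoZeroDivisors.to_isDomain _

/-- Pulling back germs along a linear map, as a ring homomorphism. -/
def pullbackHom (P : E →L[ℝ] F) : AnalyticGerm F →+* AnalyticGerm E where
  toFun := AnalyticGerm.pullback P
  map_one' := rfl
  map_zero' := rfl
  map_mul' φ γ := by
    obtain ⟨f, hf, rfl⟩ := AnalyticGerm.exists_mk φ
    obtain ⟨g, hg, rfl⟩ := AnalyticGerm.exists_mk γ
    rfl
  map_add' φ γ := by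
    obtain ⟨f, hf, rfl⟩ := AnalyticGerm.exists_mk φ
    obtain ⟨g, hg, rfl⟩ := AnalyticGerm.exists_mk γ
    rfl

theorem analyticAt_comp_clm {f : F → ℝ} (hf : AnalyticAt ℝ f 0) (P : E →L[ℝ] F) :
    AnalyticAt ℝ (fun ξ => f (P ξ)) 0 := by
  have h : AnalyticAt ℝ f (P 0) := by simpa using hf
  exact h.comp (P.analyticAt 0)

theorem pullbackHom_mk (P : E →L[ℝ] F) (f : F → ℝ) (hf : AnalyticAt ℝ f 0) :
    pullbackHom P (AnalyticGerm.mk f hf) =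
      AnalyticGerm.mk (fun ξ => f (P ξ)) (analyticAt_comp_clm hf P) := rfl

theorem pullbackHom_id : pullbackHom (ContinuousLinearMap.id ℝ E) = RingHom.id _ := by
  ext1 φ
  obtain ⟨f, hf, rfl⟩ := AnalyticGerm.exists_mk φ
  rfl

theorem pullbackHom_pullbackHom {G : Type*} [NormedAddCommGroup G] [NormedSpace ℝ G]
    (P : E →L[ℝ] F) (R : F →L[ℝ] G) (φ : AnalyticGerm G) :
    pullbackHom P (pullbackHom R φ) = pullbackHom (R.comp P) φ := by
  obtain ⟨f, hf, rfl⟩ := AnalyticGerm.exists_mk φ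
  rfl

/-- A nonzero linear form `l` divides each analytic germ which restricts to `0` on `ker l`. -/
theorem dvd_of_pullback_eq_zero (ι : F →L[ℝ] E) (l : E →L[ℝ] ℝ) (hl : l ≠ 0)
    (hker : ∀ ξ, l ξ = 0 → ∃ η, ι η = ξ) (hιinj : Topology.IsInducing ι) (φ : AnalyticGerm E)
    (h : pullbackHom ι φ = 0) : AnalyticGerm.mk l (l.analyticAt 0) ∣ φ := by
  obtain ⟨f, hf, rfl⟩ := AnalyticGerm.exists_mk φ
  rw [pullbackHom_mk, AnalyticGerm.mk_eq_zero] at h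
  obtain ⟨w', hw'⟩ : ∃ w', l w' ≠ 0 := by
    by_contra! h0; exact hl (ContinuousLinearMap.ext h0)
  obtain ⟨w, hw⟩ : ∃ w, l w = 1 := ⟨(l w')⁻¹ • w', by simp [hw']⟩
  set P : E →L[ℝ] E := ContinuousLinearMap.id ℝ E - l.smulRight w with hP
  have hlP : ∀ ξ, l (P ξ) = 0 := fun ξ => by simp [hP, hw]
  have h0 : ∀ᶠ ξ in 𝓝 (0 : E), f (P ξ) = 0 := by
    choose η hη using fun ξ => hker (P ξ) (hlP ξ)
    have ht : Tendsto η (𝓝 0) (𝓝 0) := by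
      rw [hιinj.nhds_eq_comap, tendsto_comap_iff]
      have : (ι ∘ η) = P := funext hη
      rw [this]
      simpa using P.continuous.tendsto 0
    filter_upwards [ht h] with ξ hξ
    simpa [hη] using hξ
  obtain ⟨ψ, hψ, he⟩ := AnalyticAt.exists_eq_mul_of_comp_eq_zero hf P l w
    (fun ξ => by simp [hP]) h0
  refine ⟨AnalyticGerm.mk ψ hψ, ?_⟩
  rw [AnalyticGerm.mk_mul, AnalyticGerm.mk_eq_mk]
  exact he

end GermRing

/-! ### Rationality of Taylor coefficients -/

section Polarization

/-- Polarization with a shift `u`: a symmetric multilinear map is determined by its values on the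
diagonal vectors `u + ∑_{i ∈ S} v i`. -/
theorem polarization {E : Type*} [AddCommGroup E] [Module ℝ E] {n : ℕ}
    (T : MultilinearMap ℝ (fun _ : Fin n => E) ℝ)
    (hsymm : ∀ (σ : Equiv.Perm (Fin n)) (v : Fin n → E), T (v ∘ σ) = T v) (u : E)
    (v : Fin n → E) :
    (n.factorial : ℝ) * T v = ∑ S ∈ (Finset.univ : Finset (Fin n)).powerset,
      (-1) ^ (Finset.univ \ S).card * T (fun _ => u + ∑ i ∈ S, v i) := by
  classical
  let w : Option (Fin n) → E := fun o => o.elim u v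
  let c : Finset (Fin n) → Option (Fin n) → ℝ := fun S o => o.elim 1 (fun i => if i ∈ S then 1 else 0)
  have h1 : ∀ S : Finset (Fin n), T (fun _ => u + ∑ i ∈ S, v i) =
      ∑ f : Fin n → Option (Fin n), (∏ k, c S (f k)) * T (w ∘ f) := by
    intro S
    have : (fun _ : Fin n => u + ∑ i ∈ S, v i) = fun _ => ∑ o, c S o • w o := by
      funext _
      simp [Fintype.sum_option, c, w, ite_smul, Finset.sum_ite_mem]
    rw [this, MultilinearMap.map_sum]
    refine Finset.sum_congr rfl fun f _ => ?_
    rw [MultilinearMap.map_smul_univ]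
    rfl
  have h2 : ∀ f : Fin n → Option (Fin n),
      ∑ S ∈ (Finset.univ : Finset (Fin n)).powerset, (-1) ^ (Finset.univ \ S).card *
        ∏ k, c S (f k) = if ∀ i, ∃ k, f k = some i then (1 : ℝ) else 0 := by
    intro f
    have h3 : ∀ S ∈ (Finset.univ : Finset (Fin n)).powerset,
        (-1) ^ (Finset.univ \ S).card * ∏ k, c S (f k) =
        (∏ i ∈ S, (1 : ℝ)) * ∏ i ∈ Finset.univ \ S, (if ∃ k, f k = some i then (0 : ℝ) else -1) := by
      intro S _
      by_cases hS : ∃ i, i ∉ S ∧ ∃ k, f k = some i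
      · obtain ⟨i, hi, k, hk⟩ := hS
        have e1 : ∏ k, c S (f k) = 0 :=
          Finset.prod_eq_zero (Finset.mem_univ k) (by simp [c, hk, hi])
        have e2 : ∏ i ∈ Finset.univ \ S, (if ∃ k, f k = some i then (0 : ℝ) else -1) = 0 :=
          Finset.prod_eq_zero (Finset.mem_sdiff.2 ⟨Finset.mem_univ i, hi⟩) (if_pos ⟨k, hk⟩)
        rw [e1, e2, mul_zero, mul_zero]
      · push Not at hS
        have e1 : ∏ k, c S (f k) = 1 := by
          refine Finset.prod_eq_one fun k _ => ?_
          rcases hfk : f k with _ | i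
          · rfl
          · have : i ∈ S := by
              by_contra hi
              exact hS i hi k hfk
            simp [c, this]
        rw [e1, Finset.prod_congr rfl (g := fun _ => (-1 : ℝ)) fun i hi => if_neg ?_]
        · simp
        · have := hS i (by simpa using hi)
          push Not
          exact this
    rw [Finset.sum_congr rfl h3, ← Finset.prod_add]
    split_ifs with h
    · exact Finset.prod_eq_one fun i _ => by simp [h i]
    · push Not at h
      obtain ⟨i, hi⟩ := h
      refine Finset.prod_eq_zero (Finset.mem_univ i) ?_
      have : ¬ ∃ k, f k = some i := by push Not; exact hi
      simp [this]
  simp only [h1, Finset.mul_sum]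
  rw [Finset.sum_comm]
  have h4 : ∀ f : Fin n → Option (Fin n), ∑ S ∈ (Finset.univ : Finset (Fin n)).powerset,
      (-1) ^ (Finset.univ \ S).card * ((∏ k, c S (f k)) * T (w ∘ f)) =
      if ∀ i, ∃ k, f k = some i then T (w ∘ f) else 0 := by
    intro f
    simp only [← mul_assoc]
    rw [← Finset.sum_mul, h2 f]
    split_ifs <;> simp
  rw [Finset.sum_congr rfl fun f _ => h4 f, ← Finset.sum_filter]
  have h5 : ∑ f ∈ Finset.univ.filter (fun f : Fin n → Option (Fin n) => ∀ i, ∃ k, f k = some i),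
      T (w ∘ f) = ∑ σ : Equiv.Perm (Fin n), T (v ∘ σ) := by
    symm
    refine Finset.sum_bij (fun σ _ => fun k => some (σ k)) ?_ ?_ ?_ ?_
    · intro σ _
      simp only [Finset.mem_filter, Finset.mem_univ, true_and]
      exact fun i => ⟨σ.symm i, by simp⟩
    · intro σ _ τ _ h
      ext k
      have := congrFun h k
      simp only [Option.some.injEq] at this
      rw [this]
    · intro f hf
      simp only [Finset.mem_filter, Finset.mem_univ, true_and] at hf
      choose g hg using hf
      have hginj : Function.Injective g := fun i j h => by
        have := hg i
        rw [h, hg j] at this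
        exact (Option.some.inj this).symm
      let σ : Equiv.Perm (Fin n) := Equiv.ofBijective g (Finite.injective_iff_bijective.1 hginj)
      refine ⟨σ.symm, Finset.mem_univ _, funext fun k => ?_⟩
      obtain ⟨i, rfl⟩ := σ.surjective k
      rw [Equiv.symm_apply_apply]
      exact (hg i).symm
    · intro σ _
      rfl
  rw [h5, Finset.sum_congr rfl fun σ _ => hsymm σ v]
  simp [Fintype.card_perm]

end Polarization

section OneVariable

/-- The derivatives of `F` at `0` are rational. -/
def RationalDerivs (F : ℝ → ℝ) : Prop := ∀ n : ℕ, ∃ q : ℚ, iteratedDeriv n F 0 = q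

theorem RationalDerivs.add {F G : ℝ → ℝ} (hF : RationalDerivs F) (hG : RationalDerivs G)
    (aF : AnalyticAt ℝ F 0) (aG : AnalyticAt ℝ G 0) : RationalDerivs (F + G) := by
  intro n
  obtain ⟨a, ha⟩ := hF n
  obtain ⟨b, hb⟩ := hG n
  exact ⟨a + b, by rw [iteratedDeriv_add aF.contDiffAt aG.contDiffAt, ha, hb]; push_cast; rfl⟩

theorem RationalDerivs.mul {F G : ℝ → ℝ} (hF : RationalDerivs F) (hG : RationalDerivs G)
    (aF : AnalyticAt ℝ F 0) (aG : AnalyticAt ℝ G 0) : RationalDerivs (F * G) := by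
  intro n
  choose a ha using hF
  choose b hb using hG
  refine ⟨∑ i ∈ Finset.range (n + 1), (n.choose i : ℚ) * a i * b (n - i), ?_⟩
  rw [iteratedDeriv_mul aF.contDiffAt aG.contDiffAt]
  push_cast
  exact Finset.sum_congr rfl fun i _ => by rw [ha, hb]

/-- A factor with a simple zero at the origin can be cancelled: the derivatives of `G` are determined
recursively by the Leibniz rule for `F * G`. -/
theorem RationalDerivs.of_mul {F G : ℝ → ℝ} (hF : RationalDerivs F)
    (hFG : RationalDerivs (F * G)) (aF : AnalyticAt ℝ F 0) (aG : AnalyticAt ℝ G 0)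
    (h0 : F 0 = 0) (h1 : iteratedDeriv 1 F 0 ≠ 0) : RationalDerivs G := by
  intro n
  choose a ha using hF
  choose c hc using hFG
  induction n using Nat.strong_induction_on with
  | _ n ih =>
    have hb : ∃ b : ℕ → ℚ, ∀ m < n, iteratedDeriv m G 0 = b m := by
      choose b hb using ih
      exact ⟨fun m => if h : m < n then b m h else 0, fun m hm => by simp [hm, ← hb]⟩
    obtain ⟨b, hb⟩ := hb
    have ha1 : a 1 ≠ 0 := by
      intro h; apply h1; rw [ha, h]; simp
    have key := hc (n + 1)
    rw [iteratedDeriv_mul aF.contDiffAt aG.contDiffAt, Finset.sum_range_succ',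
      Finset.sum_range_succ'] at key
    have hs : ∑ k ∈ Finset.range n, ((n + 1).choose (k + 1 + 1) : ℝ) *
        iteratedDeriv (k + 1 + 1) F 0 * iteratedDeriv (n + 1 - (k + 1 + 1)) G 0 =
        ((∑ k ∈ Finset.range n, ((n + 1).choose (k + 1 + 1) : ℚ) * a (k + 1 + 1) *
          b (n + 1 - (k + 1 + 1)) : ℚ) : ℝ) := by
      push_cast
      refine Finset.sum_congr rfl fun k hk => ?_
      rw [ha, hb _ (by have := Finset.mem_range.1 hk; omega)]
    rw [hs] at key
    simp only [zero_add, iteratedDeriv_zero, h0, mul_zero, zero_mul, add_zero, ha 1,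
      Nat.choose_one_right, Nat.add_sub_cancel] at key
    refine ⟨(c (n + 1) - ∑ k ∈ Finset.range n, ((n + 1).choose (k + 1 + 1) : ℚ) * a (k + 1 + 1) *
          b (n + 1 - (k + 1 + 1))) / ((n + 1) * a 1), ?_⟩
    have hne : ((n : ℝ) + 1) * (a 1 : ℝ) ≠ 0 :=
      mul_ne_zero (by positivity) (by exact_mod_cast ha1)
    rw [Rat.cast_div, Rat.cast_sub, ← key]
    push_cast
    field_simp
    ring

theorem RationalDerivs.exp (c : ℝ) (hc : ∃ q : ℚ, c = q) :
    RationalDerivs (fun t => Real.exp (t * c)) := by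
  obtain ⟨q, rfl⟩ := hc
  intro n
  have : (fun t : ℝ => Real.exp (t * (q : ℝ))) = fun t => Real.exp ((q : ℝ) * t) := by
    funext t; rw [mul_comm]
  rw [this, iteratedDeriv_exp_const_mul]
  exact ⟨q ^ n, by simp⟩

theorem RationalDerivs.const (c : ℝ) (hc : ∃ q : ℚ, c = q) : RationalDerivs (fun _ => c) := by
  obtain ⟨q, rfl⟩ := hc
  intro n
  rw [iteratedDeriv_const]
  split_ifs
  · exact ⟨q, rfl⟩
  · exact ⟨0, by simp⟩

theorem RationalDerivs.mul_const (c : ℝ) (hc : ∃ q : ℚ, c = q) :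
    RationalDerivs (fun t => t * c) := by
  obtain ⟨q, rfl⟩ := hc
  intro n
  rcases n with _ | _ | n
  · exact ⟨0, by simp⟩
  · exact ⟨q, by simp [iteratedDeriv_one]⟩
  · refine ⟨0, ?_⟩
    have : deriv (fun t : ℝ => t * (q : ℝ)) = fun _ => (q : ℝ) := by funext; simp
    rw [iteratedDeriv_succ', this, iteratedDeriv_const]
    simp

end OneVariable

section Line

variable {E : Type*} [NormedAddCommGroup E] [NormedSpace ℝ E]

theorem analyticAt_line {f : E → ℝ} (hf : AnalyticAt ℝ f 0) (η : E) :
    AnalyticAt ℝ (fun t : ℝ => f (t • η)) 0 :=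
  analyticAt_comp_clm hf (ContinuousLinearMap.toSpanSingleton ℝ η)

theorem iteratedDeriv_line {f : E → ℝ} (hf : AnalyticAt ℝ f 0) (η : E) (n : ℕ) :
    iteratedDeriv n (fun t : ℝ => f (t • η)) 0 = iteratedFDeriv ℝ n f 0 (fun _ => η) := by
  obtain ⟨p, r, hp⟩ := hf
  set u := ContinuousLinearMap.toSpanSingleton ℝ η with hu
  have hp' : HasFPowerSeriesOnBall f p (u 0) r := by simpa using hp
  have h := hp'.compContinuousLinearMap (u := u)
  have e := h.factorial_smul 1 n
  rw [iteratedDeriv_eq_iteratedFDeriv, ← hp.factorial_smul]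
  refine Eq.trans ?_ (e.symm.trans ?_)
  · rfl
  · simp [FormalMultilinearSeries.compContinuousLinearMap, hu]

end Line

section RationalGerms

variable {W : Type*} [NormedAddCommGroup W] [NormedSpace ℝ W] {Λ : Submodule ℤ W}

theorem IsDualIntegral.add {η ζ : StrongDual ℝ W} (h : IsDualIntegral Λ η)
    (h' : IsDualIntegral Λ ζ) : IsDualIntegral Λ (η + ζ) := fun x hx => by
  obtain ⟨a, ha⟩ := h x hx
  obtain ⟨b, hb⟩ := h' x hx
  exact ⟨a + b, by simp [ha, hb]⟩

theorem IsDualIntegral.sum {α : Type*} {η : α → StrongDual ℝ W} (s : Finset α)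
    (h : ∀ i ∈ s, IsDualIntegral Λ (η i)) : IsDualIntegral Λ (∑ i ∈ s, η i) := by
  classical
  induction s using Finset.induction_on with
  | empty => exact fun x _ => ⟨0, by simp⟩
  | insert i s hi ih =>
    rw [Finset.sum_insert hi]
    exact (h i (by simp)).add (ih fun j hj => h j (by simp [hj]))

theorem IsDualIntegral.zsmul {η : StrongDual ℝ W} (h : IsDualIntegral Λ η) (m : ℤ) :
    IsDualIntegral Λ (m • η) := fun x hx => by
  obtain ⟨a, ha⟩ := h x hx
  exact ⟨m * a, by simp [ha]⟩

theorem IsDualIntegral.rational {η : StrongDual ℝ W} (h : IsDualIntegral Λ η) {x : W}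
    (hx : IsRationalPoint Λ x) : ∃ q : ℚ, η x = q := by
  obtain ⟨m, hm, hmx⟩ := hx
  obtain ⟨a, ha⟩ := h _ hmx
  refine ⟨a / m, ?_⟩
  rw [map_zsmul, zsmul_eq_mul] at ha
  have : (m : ℝ) ≠ 0 := by exact_mod_cast hm
  push_cast
  field_simp
  linarith

/-- It suffices to consider the lines in directions `η ∈ G`, where `G` contains for all `η i` a shift
of their partial sums, as needed for polarization. -/
theorem hasRationalTaylor_of_lines {f : StrongDual ℝ W → ℝ} (hf : AnalyticAt ℝ f 0)
    (G : Set (StrongDual ℝ W))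
    (hG : ∀ (n : ℕ) (η : Fin n → StrongDual ℝ W), (∀ i, IsDualIntegral Λ (η i)) →
      ∃ u, IsDualIntegral Λ u ∧ ∀ S : Finset (Fin n), u + ∑ i ∈ S, η i ∈ G)
    (h : ∀ η ∈ G, IsDualIntegral Λ η → RationalDerivs (fun t => f (t • η))) :
    HasRationalTaylor Λ f := by
  intro n η hη
  obtain ⟨u, hu, hS⟩ := hG n η hη
  have key := polarization (iteratedFDeriv ℝ n f 0).toMultilinearMap
    (fun σ v => (hf.contDiffAt (n := (⊤ : WithTop ℕ∞))).iteratedFDeriv_comp_perm v σ) u η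
  have hr : ∀ S : Finset (Fin n), ∃ q : ℚ,
      iteratedFDeriv ℝ n f 0 (fun _ => u + ∑ i ∈ S, η i) = q := by
    intro S
    rw [← iteratedDeriv_line hf]
    exact h _ (hS S) (hu.add (IsDualIntegral.sum S fun i _ => hη i)) n
  choose q hq using hr
  refine ⟨(∑ S ∈ (Finset.univ : Finset (Fin n)).powerset, (-1) ^ (Finset.univ \ S).card * q S) /
    n.factorial, ?_⟩
  have hne : (n.factorial : ℝ) ≠ 0 := by exact_mod_cast n.factorial_ne_zero
  simp only [ContinuousMultilinearMap.coe_coe, hq] at key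
  push_cast
  rw [← key]
  field_simp

theorem hasRationalTaylor_iff {f : StrongDual ℝ W → ℝ} (hf : AnalyticAt ℝ f 0) :
    HasRationalTaylor Λ f ↔ ∀ η, IsDualIntegral Λ η → RationalDerivs (fun t => f (t • η)) := by
  constructor
  · intro h η hη n
    rw [iteratedDeriv_line hf]
    exact h n _ fun _ => hη
  · intro h
    exact hasRationalTaylor_of_lines hf Set.univ
      (fun n η _ => ⟨0, fun x _ => ⟨0, by simp⟩, fun _ => trivial⟩) fun η _ => h η

/-- Functions which are analytic at `0`, with rational Taylor coefficients. -/
def RatAnalytic (Λ : Submodule ℤ W) (f : StrongDual ℝ W → ℝ) : Prop :=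
  AnalyticAt ℝ f 0 ∧ HasRationalTaylor Λ f

theorem RatAnalytic.mul {f g : StrongDual ℝ W → ℝ} (hf : RatAnalytic Λ f)
    (hg : RatAnalytic Λ g) : RatAnalytic Λ (f * g) := by
  refine ⟨hf.1.mul hg.1, (hasRationalTaylor_iff (hf.1.mul hg.1)).2 fun η hη => ?_⟩
  exact ((hasRationalTaylor_iff hf.1).1 hf.2 η hη).mul ((hasRationalTaylor_iff hg.1).1 hg.2 η hη)
    (analyticAt_line hf.1 η) (analyticAt_line hg.1 η)

theorem RatAnalytic.add {f g : StrongDual ℝ W → ℝ} (hf : RatAnalytic Λ f)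
    (hg : RatAnalytic Λ g) : RatAnalytic Λ (f + g) := by
  refine ⟨hf.1.add hg.1, (hasRationalTaylor_iff (hf.1.add hg.1)).2 fun η hη => ?_⟩
  exact ((hasRationalTaylor_iff hf.1).1 hf.2 η hη).add ((hasRationalTaylor_iff hg.1).1 hg.2 η hη)
    (analyticAt_line hf.1 η) (analyticAt_line hg.1 η)

theorem RatAnalytic.const (c : ℚ) : RatAnalytic Λ (fun _ => (c : ℝ)) :=
  ⟨analyticAt_const, (hasRationalTaylor_iff analyticAt_const).2 fun _ _ =>
    RationalDerivs.const _ ⟨c, rfl⟩⟩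

theorem RatAnalytic.sub {f g : StrongDual ℝ W → ℝ} (hf : RatAnalytic Λ f)
    (hg : RatAnalytic Λ g) : RatAnalytic Λ (f - g) := by
  have : f - g = f + (fun _ => ((-1 : ℚ) : ℝ)) * g := by
    funext ξ; simp [sub_eq_add_neg]
  rw [this]
  exact hf.add ((RatAnalytic.const (-1)).mul hg)

theorem RatAnalytic.sum {α : Type*} (s : Finset α) {f : α → StrongDual ℝ W → ℝ}
    (h : ∀ i ∈ s, RatAnalytic Λ (f i)) : RatAnalytic Λ (∑ i ∈ s, f i) := by
  classical
  induction s using Finset.induction_on with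
  | empty =>
    have := RatAnalytic.const (Λ := Λ) 0
    simp only [Rat.cast_zero] at this
    exact this
  | insert i s hi ih =>
    rw [Finset.sum_insert hi]
    exact (h i (by simp)).add (ih fun j hj => h j (by simp [hj]))

theorem RatAnalytic.prod {α : Type*} (s : Finset α) {f : α → StrongDual ℝ W → ℝ}
    (h : ∀ i ∈ s, RatAnalytic Λ (f i)) : RatAnalytic Λ (∏ i ∈ s, f i) := by
  classical
  induction s using Finset.induction_on with
  | empty =>
    have := RatAnalytic.const (Λ := Λ) 1
    simp only [Rat.cast_one] at this
    exact this
  | insert i s hi ih =>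
    rw [Finset.prod_insert hi]
    exact (h i (by simp)).mul (ih fun j hj => h j (by simp [hj]))

theorem analyticAt_eval (x : W) (ξ₀ : StrongDual ℝ W) :
    AnalyticAt ℝ (fun ξ : StrongDual ℝ W => ξ x) ξ₀ :=
  (ContinuousLinearMap.apply ℝ ℝ x).analyticAt ξ₀

theorem analyticAt_exp_eval (x : W) (ξ₀ : StrongDual ℝ W) :
    AnalyticAt ℝ (fun ξ : StrongDual ℝ W => Real.exp (ξ x)) ξ₀ :=
  (analyticAt_eval x ξ₀).rexp

theorem RatAnalytic.exp {x : W} (hx : IsRationalPoint Λ x) :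
    RatAnalytic Λ (fun ξ => Real.exp (ξ x)) := by
  refine ⟨analyticAt_exp_eval x 0, (hasRationalTaylor_iff (analyticAt_exp_eval x 0)).2
    fun η hη => ?_⟩
  simpa using RationalDerivs.exp _ (hη.rational hx)

/-- The entire function `(eˣ - 1) / x`. -/
noncomputable def expQuot (x : ℝ) : ℝ := if x = 0 then 1 else (Real.exp x - 1) / x

theorem expQuot_zero : expQuot 0 = 1 := if_pos rfl

theorem mul_expQuot (x : ℝ) : x * expQuot x = Real.exp x - 1 := by
  unfold expQuot
  split_ifs with h
  · simp [h]
  · field_simp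

theorem expQuot_eq_dslope : expQuot = dslope Real.exp 0 := by
  funext x
  unfold expQuot
  split_ifs with h
  · simp [h]
  · rw [dslope_of_ne _ h, slope_def_field]; simp

theorem analyticAt_expQuot : AnalyticAt ℝ expQuot 0 := by
  rw [expQuot_eq_dslope]
  obtain ⟨p, hp⟩ := (analyticAt_rexp (x := (0 : ℝ)))
  exact hp.has_fpower_series_dslope_fslope.analyticAt

theorem analyticAt_expQuot_eval (x : W) :
    AnalyticAt ℝ (fun ξ : StrongDual ℝ W => expQuot (ξ x)) 0 :=
  analyticAt_comp_clm analyticAt_expQuot (ContinuousLinearMap.apply ℝ ℝ x)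

theorem RatAnalytic.expQuot {x : W} (hx : IsRationalPoint Λ x) :
    RatAnalytic Λ (fun ξ => expQuot (ξ x)) := by
  refine ⟨analyticAt_expQuot_eval x, (hasRationalTaylor_iff (analyticAt_expQuot_eval x)).2
    fun η hη => ?_⟩
  have hq := hη.rational hx
  simp only [_root_.smul_apply, smul_eq_mul]
  by_cases h0 : η x = 0
  · simp only [h0, mul_zero, expQuot_zero]
    exact RationalDerivs.const 1 ⟨1, by simp⟩
  · have e : (fun t : ℝ => t * η x) * (fun t => RatCone.expQuot (t * η x)) =
        (fun t => Real.exp (t * η x)) + fun _ => (-1 : ℝ) := by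
      funext t
      simp [mul_expQuot, sub_eq_add_neg]
    have a1 : AnalyticAt ℝ (fun t : ℝ => t * η x) 0 := by fun_prop
    refine RationalDerivs.of_mul (RationalDerivs.mul_const _ hq) ?_ a1
      ?_ (by simp) (by simpa [iteratedDeriv_one] using h0)
    · rw [e]
      exact (RationalDerivs.exp _ hq).add (RationalDerivs.const _ ⟨-1, by simp⟩)
        (by fun_prop) analyticAt_const
    · exact AnalyticAt.fun_comp (by simpa using analyticAt_expQuot) a1

/-- A factor `1 - e^⟨ξ,v⟩` can be cancelled without losing rationality: along a line on which it
does not vanish identically its zero at the origin is simple, and such lines suffice. -/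
theorem RatAnalytic.of_one_sub_exp_mul {v : W} (hv : IsRationalPoint Λ v)
    (hw : ∃ w : StrongDual ℝ W, IsDualIntegral Λ w ∧ w v ≠ 0)
    {g : StrongDual ℝ W → ℝ} (hg : AnalyticAt ℝ g 0)
    (h : RatAnalytic Λ ((fun ξ => 1 - Real.exp (ξ v)) * g)) : RatAnalytic Λ g := by
  obtain ⟨w, hw, hwv⟩ := hw
  refine ⟨hg, hasRationalTaylor_of_lines hg {η | η v ≠ 0} ?_ ?_⟩
  · intro n η _
    have hfin : Set.Finite {m : ℤ | ∃ S : Finset (Fin n), (m : ℝ) = -(∑ i ∈ S, η i) v / w v} := by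
      have : {m : ℤ | ∃ S : Finset (Fin n), (m : ℝ) = -(∑ i ∈ S, η i) v / w v} ⊆
          (fun m : ℤ => (m : ℝ)) ⁻¹' (Set.range fun S : Finset (Fin n) =>
            -(∑ i ∈ S, η i) v / w v) := by
        rintro m ⟨S, hS⟩
        exact ⟨S, hS.symm⟩
      exact ((Set.finite_range _).preimage Int.cast_injective.injOn).subset this
    obtain ⟨m, hm⟩ := hfin.exists_notMem
    refine ⟨m • w, hw.zsmul m, fun S => ?_⟩
    simp only [Set.mem_ofPred_eq, not_exists] at hm ⊢
    intro h0
    apply hm S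
    rw [eq_div_iff hwv]
    simp only [_root_.add_apply, _root_.smul_apply, zsmul_eq_mul] at h0
    linarith
  · intro η hη hηd
    have hq := hηd.rational hv
    have h1 := (hasRationalTaylor_iff h.1).1 h.2 η hηd
    have e : (fun t : ℝ => ((fun ξ : StrongDual ℝ W => 1 - Real.exp (ξ v)) * g) (t • η)) =
        (fun t : ℝ => 1 - Real.exp (t * η v)) * fun t => g (t • η) := by
      funext t; simp
    rw [e] at h1
    have hF : RationalDerivs (fun t : ℝ => 1 - Real.exp (t * η v)) := by
      have : (fun t : ℝ => 1 - Real.exp (t * η v)) =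
          (fun _ => (1 : ℝ)) + (fun _ => (-1 : ℝ)) * fun t => Real.exp (t * η v) := by
        funext t; simp [sub_eq_add_neg]
      rw [this]
      exact (RationalDerivs.const _ ⟨1, by simp⟩).add ((RationalDerivs.const _ ⟨-1, by simp⟩).mul
        (RationalDerivs.exp _ hq) analyticAt_const (by fun_prop)) analyticAt_const
        (analyticAt_const.mul (by fun_prop))
    refine hF.of_mul h1 (by fun_prop) (analyticAt_line hg η) (by simp) ?_
    have hd : HasDerivAt (fun t : ℝ => 1 - Real.exp (t * η v))
        (-(Real.exp (0 * η v) * (1 * η v))) 0 :=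
      (((hasDerivAt_id (0 : ℝ)).mul_const (η v)).exp).const_sub 1
    rw [iteratedDeriv_one, hd.deriv]
    simpa using hη

theorem RatAnalytic.comp_clm {W' : Type*} [NormedAddCommGroup W'] [NormedSpace ℝ W']
    {Λ' : Submodule ℤ W'} (P : StrongDual ℝ W →L[ℝ] StrongDual ℝ W')
    (hP : ∀ η, IsDualIntegral Λ η → ∃ m : ℤ, m ≠ 0 ∧ IsDualIntegral Λ' (m • P η))
    {f : StrongDual ℝ W' → ℝ} (hf : RatAnalytic Λ' f) : RatAnalytic Λ (fun ξ => f (P ξ)) := by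
  have ha := analyticAt_comp_clm hf.1 P
  refine ⟨ha, (hasRationalTaylor_iff ha).2 fun η hη n => ?_⟩
  obtain ⟨m, hm, hmP⟩ := hP η hη
  obtain ⟨q, hq⟩ := hf.2 n (fun _ => m • P η) fun _ => hmP
  have hm' : (m : ℝ) ≠ 0 := by exact_mod_cast hm
  refine ⟨q / m ^ n, ?_⟩
  have e : (fun t : ℝ => f (P (t • η))) = fun t => f (t • P η) := by funext t; simp
  rw [e, iteratedDeriv_line hf.1]
  have e2 : (fun _ : Fin n => m • P η) = fun i : Fin n => (m : ℝ) • (P η) := by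
    funext _; ext x; simp
  rw [e2, ContinuousMultilinearMap.map_smul_univ] at hq
  simp only [Finset.prod_const, Finset.card_univ, Fintype.card_fin, smul_eq_mul] at hq
  push_cast
  rw [← hq]
  field_simp

end RationalGerms

/-! ### Specialization of fractions along a ring homomorphism -/

section Specialization

variable {A B : Type*} [CommRing A] [CommRing B] [IsDomain B]

/-- The fraction `M` over `A` is regular at the prime ideal `ker c`, and `N` is its image under the
extension of `c` to the local ring. For germs of meromorphic functions and `c` the restriction to a
hyperplane, `N` is the restriction of `M`. -/
def Specializes (c : A →+* B) (M : FractionRing A) (N : FractionRing B) : Prop :=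
  ∃ α β : A, c β ≠ 0 ∧ algebraMap A (FractionRing A) β * M = algebraMap _ _ α ∧
    algebraMap B (FractionRing B) (c β) * N = algebraMap _ _ (c α)

variable {c : A →+* B}

theorem algebraMap_fraction_ne_zero {β : A} (h : β ≠ 0) : algebraMap A (FractionRing A) β ≠ 0 :=
  fun h0 => h ((FaithfulSMul.algebraMap_injective A (FractionRing A)) (by simpa using h0))

theorem Specializes.of_algebraMap (α : A) :
    Specializes c (algebraMap _ _ α) (algebraMap _ _ (c α)) :=
  ⟨α, 1, by simp, by simp, by simp⟩

theorem Specializes.zero : Specializes c 0 0 := by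
  simpa using Specializes.of_algebraMap (c := c) 0

theorem Specializes.add {M M' N N'} (h : Specializes c M N) (h' : Specializes c M' N') :
    Specializes c (M + M') (N + N') := by
  obtain ⟨α, β, hβ, h1, h2⟩ := h
  obtain ⟨α', β', hβ', h1', h2'⟩ := h'
  refine ⟨α * β' + α' * β, β * β', by simpa using ⟨hβ, hβ'⟩, ?_, ?_⟩
  · simp only [map_mul, map_add, ← h1, ← h1']; ring
  · simp only [map_mul, map_add, ← h2, ← h2']; ring

theorem Specializes.mul {M M' N N'} (h : Specializes c M N) (h' : Specializes c M' N') :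
    Specializes c (M * M') (N * N') := by
  obtain ⟨α, β, hβ, h1, h2⟩ := h
  obtain ⟨α', β', hβ', h1', h2'⟩ := h'
  refine ⟨α * α', β * β', by simpa using ⟨hβ, hβ'⟩, ?_, ?_⟩
  · simp only [map_mul, ← h1, ← h1']; ring
  · simp only [map_mul, ← h2, ← h2']; ring

theorem Specializes.neg {M N} (h : Specializes c M N) : Specializes c (-M) (-N) := by
  simpa using (Specializes.of_algebraMap (c := c) (-1)).mul h

theorem Specializes.sub {M M' N N'} (h : Specializes c M N) (h' : Specializes c M' N') :
    Specializes c (M - M') (N - N') := by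
  simpa [sub_eq_add_neg] using h.add h'.neg

theorem Specializes.div [IsDomain A] {M N} (h : Specializes c M N) {d : A} (hd : c d ≠ 0) :
    Specializes c (M / algebraMap _ _ d) (N / algebraMap _ _ (c d)) := by
  obtain ⟨α, β, hβ, h1, h2⟩ := h
  have hd' : d ≠ 0 := fun h0 => hd (by simp [h0])
  refine ⟨α, β * d, by simpa using ⟨hβ, hd⟩, ?_, ?_⟩
  · rw [map_mul, mul_assoc, mul_div_cancel₀ _ (algebraMap_fraction_ne_zero hd'), h1]
  · rw [map_mul, map_mul, mul_assoc, mul_div_cancel₀ _ (algebraMap_fraction_ne_zero hd), h2]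

theorem Specializes.sum {α : Type*} (s : Finset α) {M : α → FractionRing A}
    {N : α → FractionRing B} (h : ∀ i ∈ s, Specializes c (M i) (N i)) :
    Specializes c (∑ i ∈ s, M i) (∑ i ∈ s, N i) := by
  classical
  induction s using Finset.induction_on with
  | empty => simpa using Specializes.zero
  | insert i s hi ih =>
    rw [Finset.sum_insert hi, Finset.sum_insert hi]
    exact (h i (by simp)).add (ih fun j hj => h j (by simp [hj]))

theorem Specializes.unique [IsDomain A] {M N N'} (h : Specializes c M N) (h' : Specializes c M N') :
    N = N' := by
  have h0 := h.sub h'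
  rw [sub_self] at h0
  obtain ⟨α, β, hβ, h1, h2⟩ := h0
  rw [mul_zero] at h1
  have hα : α = 0 := (FaithfulSMul.algebraMap_injective A (FractionRing A)) (by simp [← h1])
  rw [hα, map_zero, map_zero] at h2
  exact sub_eq_zero.1 ((mul_eq_zero.1 h2).resolve_left (algebraMap_fraction_ne_zero hβ))

/-- A fraction whose poles are at most simple, along divisors `d i`, is regular if all its residues
vanish. -/
theorem exists_eq_algebraMap_of_residues [IsDomain A] {ι : Type*} (s : Finset ι)
    {B : ι → Type*} [∀ i, CommRing (B i)] [∀ i, IsDomain (B i)] (c : ∀ i, A →+* B i) (d : ι → A)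
    (hd : ∀ i ∈ s, d i ≠ 0) (hdvd : ∀ i ∈ s, ∀ φ, c i φ = 0 → d i ∣ φ)
    (M : FractionRing A) (hres : ∀ i ∈ s, Specializes (c i) (algebraMap _ _ (d i) * M) 0)
    (φ : A) (hM : algebraMap _ _ (∏ i ∈ s, d i) * M = algebraMap _ _ φ) :
    ∃ ψ : A, M = algebraMap _ _ ψ := by
  classical
  induction s using Finset.induction_on generalizing φ with
  | empty => exact ⟨φ, by simpa using hM⟩
  | insert i s hi ih =>
    have h1 := (Specializes.of_algebraMap (c := c i) (∏ j ∈ s, d j)).mul (hres i (by simp))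
    rw [mul_zero, mul_left_comm, ← mul_assoc, ← map_mul, ← Finset.prod_insert hi, hM] at h1
    have h2 := h1.unique (Specializes.of_algebraMap φ)
    have h3 : c i φ = 0 :=
      (FaithfulSMul.algebraMap_injective (B i) (FractionRing (B i))) (by rw [← h2, map_zero])
    obtain ⟨ψ, rfl⟩ := hdvd i (by simp) φ h3
    refine ih (fun j hj => hd j (by simp [hj])) (fun j hj => hdvd j (by simp [hj]))
      (fun j hj => hres j (by simp [hj])) ψ ?_
    refine mul_left_cancel₀ (algebraMap_fraction_ne_zero (hd i (by simp))) ?_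
    rw [← mul_assoc, ← map_mul, ← Finset.prod_insert hi, hM, map_mul]

end Specialization

/-! ### Germs of exponentials -/

section ExpGerms

variable {W W' : Type*} [NormedAddCommGroup W] [NormedSpace ℝ W]
  [NormedAddCommGroup W'] [NormedSpace ℝ W']

/-- The germ of `ξ ↦ e^⟨ξ,x⟩`. -/
noncomputable def expGerm (x : W) : AnalyticGerm (StrongDual ℝ W) :=
  AnalyticGerm.mk (fun ξ => Real.exp (ξ x)) (analyticAt_exp_eval x 0)

/-- The germ of `ξ ↦ (e^⟨ξ,x⟩ - 1) / ⟨ξ,x⟩`. -/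
noncomputable def expQuotGerm (x : W) : AnalyticGerm (StrongDual ℝ W) :=
  AnalyticGerm.mk (fun ξ => expQuot (ξ x)) (analyticAt_expQuot_eval x)

/-- The dual of a linear map. -/
noncomputable def dualMapCLM (π : W →L[ℝ] W') : StrongDual ℝ W' →L[ℝ] StrongDual ℝ W :=
  (ContinuousLinearMap.compL ℝ W W' ℝ).flip π

theorem expGerm_zero : expGerm (0 : W) = 1 := by
  refine AnalyticGerm.mk_eq_mk (hg := analyticAt_const).2 (Eventually.of_forall fun ξ => ?_)
  simp

theorem expGerm_add (x y : W) : expGerm (x + y) = expGerm x * expGerm y := by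
  rw [expGerm, expGerm, expGerm, AnalyticGerm.mk_mul, AnalyticGerm.mk_eq_mk]
  refine Eventually.of_forall fun ξ => ?_
  simp [Real.exp_add]

theorem isUnit_expGerm (x : W) : IsUnit (expGerm x) :=
  IsUnit.of_mul_eq_one (expGerm (-x)) (by rw [← expGerm_add, add_neg_cancel, expGerm_zero])

theorem expGerm_ne_zero (x : W) : expGerm x ≠ 0 := (isUnit_expGerm x).ne_zero

theorem isUnit_expQuotGerm (x : W) : IsUnit (expQuotGerm x) := by
  have h0 : (fun ξ : StrongDual ℝ W => expQuot (ξ x)) 0 ≠ 0 := by simp [expQuot_zero]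
  refine IsUnit.of_mul_eq_one (AnalyticGerm.mk _ ((analyticAt_expQuot_eval x).inv h0)) ?_
  rw [expQuotGerm, AnalyticGerm.mk_mul]
  refine AnalyticGerm.mk_eq_mk (hg := analyticAt_const).2 ?_
  filter_upwards [(analyticAt_expQuot_eval x).continuousAt.eventually_ne h0] with ξ hξ
  simp only [Pi.mul_apply, Pi.inv_apply]
  exact mul_inv_cancel₀ hξ

theorem expQuotGerm_zero : expQuotGerm (0 : W) = 1 := by
  refine AnalyticGerm.mk_eq_mk (hg := analyticAt_const).2 (Eventually.of_forall fun ξ => ?_)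
  simp [expQuot_zero]

/-- The germ of the linear form `ξ ↦ ⟨ξ,x⟩`. -/
noncomputable def evalGerm (x : W) : AnalyticGerm (StrongDual ℝ W) :=
  AnalyticGerm.mk (ContinuousLinearMap.apply ℝ ℝ x)
    ((ContinuousLinearMap.apply ℝ ℝ x).analyticAt 0)

theorem one_sub_expGerm (x : W) : 1 - expGerm x = - (evalGerm x * expQuotGerm x) := by
  have h : expGerm x - 1 = evalGerm x * expQuotGerm x := by
    refine AnalyticGerm.mk_eq_mk (hf := (analyticAt_exp_eval x 0).sub analyticAt_const)
      (hg := ((ContinuousLinearMap.apply ℝ ℝ x).analyticAt 0).mul (analyticAt_expQuot_eval x)).2 ?_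
    refine Eventually.of_forall fun ξ => ?_
    exact (mul_expQuot (ξ x)).symm
  rw [← h]; ring

theorem exists_dual_ne_zero {x : W} (hx : x ≠ 0) : ∃ ξ : StrongDual ℝ W, ξ x ≠ 0 := by
  obtain ⟨ξ, _, h⟩ := exists_dual_vector ℝ x (norm_ne_zero_iff.2 hx)
  exact ⟨ξ, by rw [h]; simpa using hx⟩

theorem evalGerm_ne_zero {x : W} (hx : x ≠ 0) : evalGerm x ≠ 0 := by
  intro h
  rw [evalGerm, AnalyticGerm.mk_eq_zero] at h
  obtain ⟨ξ, hξ⟩ := exists_dual_ne_zero hx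
  have ht : Tendsto (fun t : ℝ => t • ξ) (𝓝[≠] 0) (𝓝 0) :=
    ((continuous_id.smul continuous_const).tendsto' (0 : ℝ) (0 : StrongDual ℝ W)
      (by simp)).mono_left nhdsWithin_le_nhds
  obtain ⟨t, ht1, ht2⟩ := ((ht.eventually h).and self_mem_nhdsWithin).exists
  have : t * ξ x = 0 := ht1
  exact (mul_ne_zero ht2 hξ) this

theorem one_sub_expGerm_ne_zero {x : W} (hx : x ≠ 0) : 1 - expGerm x ≠ 0 := by
  rw [one_sub_expGerm]
  exact neg_ne_zero.2 (mul_ne_zero (evalGerm_ne_zero hx) (isUnit_expQuotGerm x).ne_zero)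

theorem pullbackHom_expGerm (π : W →L[ℝ] W') (x : W) :
    pullbackHom (dualMapCLM π) (expGerm x) = expGerm (π x) := rfl

theorem pullbackHom_expQuotGerm (π : W →L[ℝ] W') (x : W) :
    pullbackHom (dualMapCLM π) (expQuotGerm x) = expQuotGerm (π x) := rfl

/-- A linear form which vanishes on `v` descends to the quotient by `ℝ v`. -/
theorem exists_comp_eq_of_apply_eq_zero [FiniteDimensional ℝ W'] (π : W →L[ℝ] W')
    (hπ : Function.Surjective π) {v : W} (hker : ∀ x, π x = 0 ↔ ∃ r : ℝ, x = r • v)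
    {ξ : StrongDual ℝ W} (hξ : ξ v = 0) : ∃ ξ' : StrongDual ℝ W', ∀ x, ξ' (π x) = ξ x := by
  have hle : LinearMap.ker π.toLinearMap ≤ LinearMap.ker ξ.toLinearMap := by
    intro x hx
    obtain ⟨r, rfl⟩ := (hker x).1 (by simpa using hx)
    simp [hξ]
  choose g hg using hπ
  refine ⟨LinearMap.toContinuousLinearMap
    { toFun := fun y => ξ (g y), map_add' := fun y z => ?_, map_smul' := fun r y => ?_ },
    fun x => ?_⟩
  · have : g (y + z) - (g y + g z) ∈ LinearMap.ker ξ.toLinearMap := hle (by simp [hg])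
    simpa [sub_eq_zero] using this
  · have : g (r • y) - r • g y ∈ LinearMap.ker ξ.toLinearMap := hle (by simp [hg])
    simpa [sub_eq_zero] using this
  · have : g (π x) - x ∈ LinearMap.ker ξ.toLinearMap := hle (by simp [hg])
    simpa [sub_eq_zero] using this

/-- A germ which vanishes on `v^⊥`, the dual of the quotient by `ℝ v`, is divisible by
`1 - e^⟨ξ,v⟩`. -/
theorem one_sub_expGerm_dvd [FiniteDimensional ℝ W] [FiniteDimensional ℝ W'] (π : W →L[ℝ] W')
    (hπ : Function.Surjective π) {v : W} (hv : v ≠ 0) (hker : ∀ x, π x = 0 ↔ ∃ r : ℝ, x = r • v)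
    (φ : AnalyticGerm (StrongDual ℝ W)) (h : pullbackHom (dualMapCLM π) φ = 0) :
    1 - expGerm v ∣ φ := by
  have h1 : evalGerm v ∣ φ := by
    refine dvd_of_pullback_eq_zero (dualMapCLM π) (ContinuousLinearMap.apply ℝ ℝ v) ?_ ?_ ?_ φ h
    · obtain ⟨ξ, hξ⟩ := exists_dual_ne_zero hv
      exact fun h0 => hξ (congrArg (fun f : StrongDual ℝ W →L[ℝ] ℝ => f ξ) h0)
    · intro ξ hξ
      have hξ' : ξ v = 0 := hξ
      obtain ⟨ξ', h'⟩ := exists_comp_eq_of_apply_eq_zero π hπ hker hξ'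
      exact ⟨ξ', ContinuousLinearMap.ext h'⟩
    · have hinj : Function.Injective (dualMapCLM π) := by
        intro ξ η h
        ext y
        obtain ⟨x, rfl⟩ := hπ y
        exact congrArg (fun f : StrongDual ℝ W => f x) h
      exact (LinearMap.isClosedEmbedding_of_injective (f := (dualMapCLM π).toLinearMap)
        (LinearMap.ker_eq_bot.2 hinj)).isEmbedding.isInducing
  rw [one_sub_expGerm, neg_dvd]
  obtain ⟨u, hu⟩ := isUnit_expQuotGerm v
  rw [← hu]
  exact (Units.mul_right_dvd).2 h1

end ExpGerms

/-! ### Entire functions and uniqueness of the meromorphic functions -/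

section Entire

variable {W : Type*} [NormedAddCommGroup W] [NormedSpace ℝ W]

theorem IsEntire.add {f g : StrongDual ℝ W → ℝ} (hf : IsEntire f) (hg : IsEntire g) :
    IsEntire (f + g) := by
  obtain ⟨F, hF, hF'⟩ := hf
  obtain ⟨G, hG, hG'⟩ := hg
  exact ⟨F + G, hF.add hG, fun ξ => by simp [hF', hG']⟩

theorem IsEntire.mul {f g : StrongDual ℝ W → ℝ} (hf : IsEntire f) (hg : IsEntire g) :
    IsEntire (f * g) := by
  obtain ⟨F, hF, hF'⟩ := hf
  obtain ⟨G, hG, hG'⟩ := hg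
  exact ⟨F * G, hF.mul hG, fun ξ => by simp [hF', hG']⟩

theorem IsEntire.const (c : ℝ) : IsEntire (fun _ : StrongDual ℝ W => c) :=
  ⟨fun _ => c, differentiable_const _, fun _ => rfl⟩

theorem IsEntire.sub {f g : StrongDual ℝ W → ℝ} (hf : IsEntire f) (hg : IsEntire g) :
    IsEntire (f - g) := by
  obtain ⟨F, hF, hF'⟩ := hf
  obtain ⟨G, hG, hG'⟩ := hg
  exact ⟨F - G, hF.sub hG, fun ξ => by simp [hF', hG']⟩

theorem IsEntire.sum {α : Type*} (s : Finset α) {f : α → StrongDual ℝ W → ℝ}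
    (h : ∀ i ∈ s, IsEntire (f i)) : IsEntire (∑ i ∈ s, f i) := by
  classical
  induction s using Finset.induction_on with
  | empty => exact IsEntire.const 0
  | insert i s hi ih =>
    rw [Finset.sum_insert hi]
    exact (h i (by simp)).add (ih fun j hj => h j (by simp [hj]))

theorem IsEntire.prod {α : Type*} (s : Finset α) {f : α → StrongDual ℝ W → ℝ}
    (h : ∀ i ∈ s, IsEntire (f i)) : IsEntire (∏ i ∈ s, f i) := by
  classical
  induction s using Finset.induction_on with
  | empty => exact IsEntire.const 1
  | insert i s hi ih =>
    rw [Finset.prod_insert hi]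
    exact (h i (by simp)).mul (ih fun j hj => h j (by simp [hj]))

theorem differentiable_eval_complex (x : W) :
    Differentiable ℂ (fun H : W →L[ℝ] ℂ => H x) := by
  have : (fun H : W →L[ℝ] ℂ => H x) = ⇑(LinearMap.mkContinuous
      ({ toFun := fun H => H x, map_add' := fun _ _ => rfl, map_smul' := fun _ _ => rfl } :
        (W →L[ℝ] ℂ) →ₗ[ℂ] ℂ) ‖x‖ fun H => by
          simpa [mul_comm] using H.le_opNorm x) := rfl
  rw [this]
  exact ContinuousLinearMap.differentiable _

theorem IsEntire.exp (x : W) : IsEntire (fun ξ : StrongDual ℝ W => Real.exp (ξ x)) :=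
  ⟨fun H => Complex.exp (H x), (differentiable_eval_complex x).cexp, fun ξ => by simp⟩

theorem IsEntire.expQuot (x : W) : IsEntire (fun ξ : StrongDual ℝ W => expQuot (ξ x)) := by
  refine ⟨fun H => dslope Complex.exp 0 (H x), ?_, fun ξ => ?_⟩
  · have : Differentiable ℂ (dslope Complex.exp 0) := by
      rw [← differentiableOn_univ]
      exact (Complex.differentiableOn_dslope univ_mem).2 Complex.differentiable_exp.differentiableOn
    exact this.comp (differentiable_eval_complex x)
  · unfold RatCone.expQuot
    simp only [ContinuousLinearMap.comp_apply, Complex.ofRealCLM_apply]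
    split_ifs with h
    · simp [h]
    · rw [dslope_of_ne _ (by exact_mod_cast h), slope_def_field]
      simp

/-- An entire function which vanishes on a nonempty open set of real points vanishes at all real
points: restrict it to the complex line through two real points. -/
theorem IsEntire.eq_zero {f : StrongDual ℝ W → ℝ} (hf : IsEntire f) {Ω : Set (StrongDual ℝ W)}
    (hΩ : IsOpen Ω) (hne : Ω.Nonempty) (h : ∀ ξ ∈ Ω, f ξ = 0) (ξ : StrongDual ℝ W) : f ξ = 0 := by
  obtain ⟨F, hF, hF'⟩ := hf
  obtain ⟨ξ₀, hξ₀⟩ := hne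
  set c : StrongDual ℝ W → (W →L[ℝ] ℂ) := fun η => Complex.ofRealCLM.comp η with hc
  set g : ℂ → ℂ := fun z => F (c ξ₀ + z • c (ξ - ξ₀)) with hg
  have hgd : Differentiable ℂ g := hF.comp ((differentiable_id.smul_const _).const_add _)
  have hreal : ∀ t : ℝ, g t = f (ξ₀ + t • (ξ - ξ₀)) := by
    intro t
    rw [← hF', hg]
    refine congrArg F (ContinuousLinearMap.ext fun x => ?_)
    simp [hc]
  have hev : ∀ᶠ t : ℝ in 𝓝 0, g t = 0 := by
    have ht : Tendsto (fun t : ℝ => ξ₀ + t • (ξ - ξ₀)) (𝓝 0) (𝓝 ξ₀) := by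
      have : Continuous (fun t : ℝ => ξ₀ + t • (ξ - ξ₀)) := by fun_prop
      simpa using this.tendsto 0
    filter_upwards [ht (hΩ.mem_nhds hξ₀)] with t htΩ
    rw [hreal, h _ htΩ, Complex.ofReal_zero]
  have hfreq : ∃ᶠ z : ℂ in 𝓝[≠] 0, g z = 0 := by
    have ht : Tendsto (fun t : ℝ => (t : ℂ)) (𝓝[≠] 0) (𝓝[≠] 0) := by
      refine tendsto_nhdsWithin_iff.2 ⟨?_, ?_⟩
      · exact (Complex.continuous_ofReal.tendsto' 0 0 (by simp)).mono_left nhdsWithin_le_nhds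
      · filter_upwards [self_mem_nhdsWithin] with t ht0
        simpa using ht0
    exact ht.frequently (hev.filter_mono nhdsWithin_le_nhds).frequently
  have hgan : AnalyticOnNhd ℂ g Set.univ := fun z _ =>
    hgd.differentiableOn.analyticAt univ_mem
  have h0 := hgan.eqOn_zero_of_preconnected_of_frequently_eq_zero isPreconnected_univ
    (Set.mem_univ 0) hfreq (Set.mem_univ ((1 : ℝ) : ℂ))
  have h1 := hreal 1
  rw [h0] at h1
  simpa using h1.symm

/-- A meromorphic function with entire numerator and denominator is determined by its values on a
nonempty open set of real points, which need not be near the origin. -/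
theorem IsRationalQuotient.unique {Λ : Submodule ℤ W} {m m' : MeromorphicGerm (StrongDual ℝ W)}
    {g h g' h' T : StrongDual ℝ W → ℝ} (H : IsRationalQuotient Λ m g h)
    (H' : IsRationalQuotient Λ m' g' h') {Ω : Set (StrongDual ℝ W)} (hΩ : IsOpen Ω)
    (hne : Ω.Nonempty) (hT : ∀ ξ ∈ Ω, g ξ = h ξ * T ξ) (hT' : ∀ ξ ∈ Ω, g' ξ = h' ξ * T ξ) :
    m = m' := by
  obtain ⟨hg, hh, γ, δ, hγ, hδ, hδ0, hm⟩ := H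
  obtain ⟨hg', hh', γ', δ', hγ', hδ', hδ0', hm'⟩ := H'
  have key : g * h' - g' * h = 0 := by
    funext ξ
    refine ((hg.1.mul hh'.1).sub (hg'.1.mul hh.1)).eq_zero hΩ hne (fun η hη => ?_) ξ
    simp only [Pi.sub_apply, Pi.mul_apply, hT η hη, hT' η hη]
    ring
  have key2 : γ * δ' = γ' * δ := by
    refine Subtype.ext ?_
    change γ.1 * δ'.1 = γ'.1 * δ.1
    rw [hγ, hδ, hγ', hδ', ← Germ.coe_mul, ← Germ.coe_mul, sub_eq_zero.1 key]
  have h1 := algebraMap_fraction_ne_zero hδ0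
  have h2 := algebraMap_fraction_ne_zero hδ0'
  refine mul_right_cancel₀ (mul_ne_zero h1 h2) ?_
  rw [← mul_assoc, hm, mul_left_comm, hm', ← map_mul, ← map_mul, key2, mul_comm]

end Entire

/-! ### Triangulation of pointed cones by lexicographically minimal representations -/

section Triangulation

variable {W : Type*} [NormedAddCommGroup W] [NormedSpace ℝ W] {ι : Type*}

/-- The first nonzero entry of `d`, in the order given by `r`, is negative. -/
def LexNeg (r : ι → ℕ) (d : ι → ℝ) : Prop := ∃ j, d j < 0 ∧ ∀ k, r k < r j → d k = 0

theorem lexNeg_or_neg [Finite ι] (r : ι → ℕ) {d : ι → ℝ} (hd : d ≠ 0) :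
    LexNeg r d ∨ LexNeg r (-d) := by
  have hne : (r '' {j | d j ≠ 0}).Nonempty := by
    obtain ⟨j, hj⟩ := Function.ne_iff.1 hd
    exact ⟨r j, j, hj, rfl⟩
  obtain ⟨j, hj, hjr⟩ := Nat.sInf_mem hne
  have hmin : ∀ k, r k < r j → d k = 0 := by
    intro k hk
    by_contra h
    exact (Nat.sInf_le (⟨k, h, rfl⟩ : r k ∈ r '' {j | d j ≠ 0})).not_gt (hjr ▸ hk)
  rcases lt_or_gt_of_ne (show d j ≠ 0 from hj) with h | h
  · exact Or.inl ⟨j, h, hmin⟩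
  · exact Or.inr ⟨j, by simpa using h, fun k hk => by simp [hmin k hk]⟩

theorem LexNeg.not_neg {r : ι → ℕ} (hr : Function.Injective r) {d : ι → ℝ} (h : LexNeg r d) :
    ¬ LexNeg r (-d) := by
  rintro ⟨k, hk, hk'⟩
  obtain ⟨j, hj, hj'⟩ := h
  rcases lt_trichotomy (r j) (r k) with h1 | h1 | h1
  · have := hk' j h1
    simp only [Pi.neg_apply, neg_eq_zero] at this
    exact hj.ne this
  · have := hr h1
    subst this
    simp only [Pi.neg_apply, Left.neg_neg_iff] at hk
    exact hj.not_gt hk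
  · have := hj' k h1
    simp [this] at hk

/-- Each nonempty compact set of coordinate vectors has a lexicographically minimal element. -/
theorem exists_lexMin [Finite ι] {r : ι → ℕ} (hr : Function.Injective r) {K : Set (ι → ℝ)}
    (hK : IsCompact K) (hne : K.Nonempty) : ∃ t ∈ K, ∀ u ∈ K, ¬ LexNeg r (u - t) := by
  have key : ∀ n : ℕ, ∃ K' : Set (ι → ℝ), K' ⊆ K ∧ IsCompact K' ∧ K'.Nonempty ∧
      (∀ t ∈ K', ∀ u ∈ K', ∀ j, r j < n → u j = t j) ∧
      ∀ t ∈ K', ∀ u ∈ K, u ∉ K' → LexNeg r (t - u) := by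
    intro n
    induction n with
    | zero => exact ⟨K, le_rfl, hK, hne, fun _ _ _ _ j hj => absurd hj (Nat.not_lt_zero _),
        fun _ _ u hu hu' => absurd hu hu'⟩
    | succ n ih =>
      obtain ⟨K', hsub, hc, hne', heq, hmin⟩ := ih
      by_cases hj : ∃ j, r j = n
      · obtain ⟨j, rfl⟩ := hj
        obtain ⟨t₀, ht₀, ht₀'⟩ := hc.exists_isMinOn hne' (continuous_apply j).continuousOn
        have hmin' : ∀ u ∈ K', t₀ j ≤ u j := fun u hu => ht₀' hu
        refine ⟨K' ∩ {t | t j = t₀ j}, Set.inter_subset_left.trans hsub,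
          hc.inter_right (isClosed_eq (continuous_apply j) continuous_const), ⟨t₀, ht₀, rfl⟩,
          ?_, ?_⟩
        · rintro t ⟨ht, htj⟩ u ⟨hu, huj⟩ i hi
          rcases Nat.lt_succ_iff_lt_or_eq.1 hi with hi' | hi'
          · exact heq t ht u hu i hi'
          · obtain rfl := hr hi'
            exact Eq.trans huj (Eq.symm htj)
        · rintro t ⟨ht, htj⟩ u hu hu'
          by_cases huK : u ∈ K'
          · have htj' : t j = t₀ j := htj
            have hne : u j ≠ t₀ j := fun h => hu' ⟨huK, h⟩
            have hlt : t₀ j < u j := lt_of_le_of_ne (hmin' u huK) hne.symm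
            refine ⟨j, by simp only [Pi.sub_apply]; linarith, fun k hk => ?_⟩
            simp [heq t ht u huK k hk]
          · exact hmin t ht u hu huK
      · refine ⟨K', hsub, hc, hne', fun t ht u hu j hj' => heq t ht u hu j ?_, hmin⟩
        rcases Nat.lt_succ_iff_lt_or_eq.1 hj' with h | h
        · exact h
        · exact absurd ⟨j, h⟩ hj
  obtain ⟨N, hN⟩ : ∃ N, ∀ j, r j < N := by
    obtain ⟨N, hN⟩ := (Set.finite_range r).bddAbove
    exact ⟨N + 1, fun j => Nat.lt_succ_of_le (hN ⟨j, rfl⟩)⟩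
  obtain ⟨K', hsub, _, ⟨t, ht⟩, heq, hmin⟩ := key N
  refine ⟨t, hsub ht, fun u hu hneg => ?_⟩
  by_cases huK : u ∈ K'
  · have : u - t = 0 := by
      funext j
      simp [heq t ht u huK j (hN j)]
    rw [this] at hneg
    obtain ⟨j, hj, _⟩ := hneg
    exact lt_irrefl _ hj
  · have := hmin t ht u hu huK
    rw [← neg_sub] at this
    exact hneg.not_neg hr this

variable [Fintype ι]

/-- The cone generated by a finite family of vectors. -/
def cone (v : ι → W) : Set W := {x | ∃ t : ι → ℝ, (∀ i, 0 ≤ t i) ∧ x = ∑ i, t i • v i}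

/-- The relatively open cone `s + ∑_{i ∈ I} ℝ_{>0} v i`. -/
def openCone (s : W) (v : ι → W) (I : Finset ι) : Set W :=
  {x | ∃ t : ι → ℝ, (∀ i ∈ I, 0 < t i) ∧ (∀ i ∉ I, t i = 0) ∧ x = s + ∑ i, t i • v i}

/-- The half-open parallelepiped `s + ∑_{i ∈ I} (0,1] v i`. -/
def box (s : W) (v : ι → W) (I : Finset ι) : Set W :=
  {x | ∃ t : ι → ℝ, (∀ i ∈ I, 0 < t i ∧ t i ≤ 1) ∧ (∀ i ∉ I, t i = 0) ∧ x = s + ∑ i, t i • v i}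

/-- `I` is the support of lexicographically minimal representations `∑ t i • v i` with `0 ≤ t`:
one cannot pass to a smaller representation along a linear relation `d`. These sets `I` are the
simplices of a triangulation of the cone generated by `v`. -/
def LexAdm (r : ι → ℕ) (v : ι → W) (I : Finset ι) : Prop :=
  ∀ d : ι → ℝ, ∑ i, d i • v i = 0 → (∀ i ∉ I, 0 ≤ d i) → ¬ LexNeg r d

theorem LexAdm.eq_zero {r : ι → ℕ} {v : ι → W} {I : Finset ι}
    (h : LexAdm r v I) {d : ι → ℝ} (hd : ∑ i, d i • v i = 0) (h0 : ∀ i ∉ I, d i = 0) : d = 0 := by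
  by_contra hne
  rcases lexNeg_or_neg r hne with h1 | h1
  · exact h d hd (fun i hi => (h0 i hi).ge) h1
  · exact h (-d) (by simp [hd]) (fun i hi => by simp [h0 i hi]) h1

theorem LexAdm.linearIndependent {r : ι → ℕ} {v : ι → W}
    {I : Finset ι} (h : LexAdm r v I) : LinearIndependent ℝ (fun i : I => v i) := by
  classical
  rw [Fintype.linearIndependent_iff]
  intro g hg i
  have := h.eq_zero (d := fun j => if hj : j ∈ I then g ⟨j, hj⟩ else 0) ?_
    (fun j hj => by simp [hj])
  · simpa using congrFun this i
  · rw [← hg, ← Finset.sum_subset (Finset.subset_univ I) (fun j _ hj => by simp [hj]),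
      ← Finset.sum_coe_sort I]
    exact Finset.sum_congr rfl fun j _ => by simp

theorem disjoint_openCone {r : ι → ℕ} {s : W} {v : ι → W}
    {I I' : Finset ι} (h : LexAdm r v I) (h' : LexAdm r v I') {x : W} (hx : x ∈ openCone s v I)
    (hx' : x ∈ openCone s v I') : I = I' := by
  obtain ⟨t, ht, ht0, rfl⟩ := hx
  obtain ⟨u, hu, hu0, he⟩ := hx'
  have hker : ∑ i, (u - t) i • v i = 0 := by
    simp only [Pi.sub_apply, sub_smul, Finset.sum_sub_distrib]
    rw [sub_eq_zero]
    exact (add_left_cancel he).symm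
  have hpos : ∀ i, 0 ≤ t i := fun i => by
    by_cases hi : i ∈ I
    exacts [(ht i hi).le, (ht0 i hi).ge]
  have hpos' : ∀ i, 0 ≤ u i := fun i => by
    by_cases hi : i ∈ I'
    exacts [(hu i hi).le, (hu0 i hi).ge]
  have hzero : u - t = 0 := by
    by_contra hne
    rcases lexNeg_or_neg r hne with h1 | h1
    · exact h _ hker (fun i hi => by simp [ht0 i hi, hpos']) h1
    · refine h' _ ?_ (fun i hi => ?_) h1
      · rw [neg_sub]
        simp only [Pi.sub_apply, sub_smul, Finset.sum_sub_distrib] at hker ⊢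
        rw [← neg_sub, hker, neg_zero]
      · simp [hu0 i hi, hpos]
  have hut : u = t := sub_eq_zero.1 hzero
  subst hut
  ext i
  constructor
  · intro hi
    by_contra hi'
    exact (ht i hi).ne' (hu0 i hi')
  · intro hi
    by_contra hi'
    exact (hu i hi).ne' (ht0 i hi')

/-- A linear form which is negative on the generators bounds the coordinates of each
representation, so a lexicographically minimal representation exists. -/
theorem exists_mem_openCone {r : ι → ℕ} (hr : Function.Injective r) {s : W} {v : ι → W}
    {l : StrongDual ℝ W} (hl : ∀ i, l (v i) < 0) {x : W} (hx : x ∈ (fun y => s + y) '' cone v) :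
    ∃ I, LexAdm r v I ∧ x ∈ openCone s v I := by
  classical
  obtain ⟨y, ⟨t₀, ht₀, rfl⟩, rfl⟩ := hx
  set y := ∑ i, t₀ i • v i with hy
  set K : Set (ι → ℝ) := {t | (∀ i, 0 ≤ t i) ∧ y = ∑ i, t i • v i} with hKdef
  have hK : IsCompact K := by
    have hcl : IsClosed K := by
      refine IsClosed.inter (s₁ := {t : ι → ℝ | ∀ i, 0 ≤ t i}) ?_ ?_
      · have : {t : ι → ℝ | ∀ i, 0 ≤ t i} = Set.Ici 0 := by
          ext t; simp [Pi.le_def]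
        rw [this]; exact isClosed_Ici
      · exact isClosed_eq continuous_const (by fun_prop)
    refine IsCompact.of_isClosed_subset (isCompact_univ_pi
      (fun i => isCompact_Icc (a := (0 : ℝ)) (b := l y / l (v i)))) hcl ?_
    rintro t ⟨ht, hty⟩ i _
    refine ⟨ht i, (le_div_iff_of_neg (hl i)).2 ?_⟩
    rw [hty, map_sum, ← Finset.add_sum_erase _ _ (Finset.mem_univ i)]
    have : ∑ j ∈ Finset.univ.erase i, l (t j • v j) ≤ 0 :=
      Finset.sum_nonpos fun j _ => by
        simpa using mul_nonpos_of_nonneg_of_nonpos (ht j) (hl j).le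
    simp only [map_smul, smul_eq_mul] at this ⊢
    linarith
  obtain ⟨t, ⟨ht, hty⟩, hmin⟩ := exists_lexMin hr hK ⟨t₀, ht₀, hy⟩
  refine ⟨Finset.univ.filter fun i => 0 < t i, ?_, t, fun i hi => by simpa using hi,
    fun i hi => le_antisymm (by simpa using hi) (ht i), by simp [hty]⟩
  intro d hd hd0 hneg
  -- a small multiple of `d` can be added to `t` without leaving the positive orthant
  have hε : ∃ ε > 0, ∀ i, 0 ≤ t i + ε * d i := by
    have hev : ∀ i, ∀ᶠ ε in 𝓝[>] (0 : ℝ), 0 ≤ t i + ε * d i := by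
      intro i
      by_cases hi : 0 < t i
      · have : Tendsto (fun ε : ℝ => t i + ε * d i) (𝓝[>] 0) (𝓝 (t i)) := by
          have : Continuous fun ε : ℝ => t i + ε * d i := by fun_prop
          exact (this.tendsto' 0 _ (by simp)).mono_left nhdsWithin_le_nhds
        exact (this.eventually (lt_mem_nhds hi)).mono fun _ h => h.le
      · have hdi := hd0 i (by simpa using hi)
        filter_upwards [self_mem_nhdsWithin] with ε hε
        exact add_nonneg (ht i) (mul_nonneg (le_of_lt hε) hdi)
    obtain ⟨ε, h1, h2⟩ := ((eventually_all.2 hev).and self_mem_nhdsWithin).exists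
    exact ⟨ε, h2, h1⟩
  obtain ⟨ε, hε, hpos⟩ := hε
  refine hmin (t + ε • d) ⟨hpos, ?_⟩ ?_
  · simp only [Pi.add_apply, Pi.smul_apply, smul_eq_mul, add_smul, Finset.sum_add_distrib, mul_smul]
    rw [← Finset.smul_sum, hd, smul_zero, add_zero, hty]
  · obtain ⟨j, hj, hj'⟩ := hneg
    refine ⟨j, ?_, fun k hk => ?_⟩
    · simpa using mul_neg_of_pos_of_neg hε hj
    · simp [hj' k hk]

theorem openCone_subset (s : W) (v : ι → W) (I : Finset ι) :
    openCone s v I ⊆ (fun y => s + y) '' cone v := by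
  rintro x ⟨t, ht, ht0, rfl⟩
  refine ⟨_, ⟨t, fun i => ?_, rfl⟩, rfl⟩
  by_cases hi : i ∈ I
  exacts [(ht i hi).le, (ht0 i hi).ge]

open Classical in
/-- The simplices of the triangulation of the cone generated by `v`. -/
noncomputable def simplices (r : ι → ℕ) (v : ι → W) : Finset (Finset ι) :=
  Finset.univ.filter fun I => LexAdm r v I

theorem mem_simplices {r : ι → ℕ} {v : ι → W} {I : Finset ι} :
    I ∈ simplices r v ↔ LexAdm r v I := by
  classical
  simp [simplices]

/-- The affine cone `s + cone v` is the disjoint union of the relatively open cones over the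
simplices of the triangulation. -/
theorem indicator_eq_sum {r : ι → ℕ} (hr : Function.Injective r) (s : W) {v : ι → W}
    {l : StrongDual ℝ W} (hl : ∀ i, l (v i) < 0) (f : W → ℝ) (x : W) :
    Set.indicator ((fun y => s + y) '' cone v) f x =
      ∑ I ∈ simplices r v, Set.indicator (openCone s v I) f x := by
  classical
  by_cases hx : x ∈ (fun y => s + y) '' cone v
  · obtain ⟨I, hI, hxI⟩ := exists_mem_openCone hr hl hx
    rw [Set.indicator_of_mem hx, Finset.sum_eq_single_of_mem I (mem_simplices.2 hI),
      Set.indicator_of_mem hxI]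
    intro J hJ hne
    exact Set.indicator_of_notMem
      (fun h => hne (disjoint_openCone (mem_simplices.1 hJ) hI h hxI)) _
  · rw [Set.indicator_of_notMem hx]
    exact (Finset.sum_eq_zero fun I _ => Set.indicator_of_notMem
      (fun h => hx (openCone_subset s v I h)) _).symm

/-- The link of a ray `i` which comes last in the order: the simplices containing `i` correspond to
the simplices of the triangulation of the image of the cone modulo `ℝ v i`. -/
theorem lexAdm_link [DecidableEq ι] {W' : Type*} [NormedAddCommGroup W'] [NormedSpace ℝ W']
    {r : ι → ℕ}
    (π : W →L[ℝ] W') {v : ι → W} (i : ι) (hv : v i ≠ 0)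
    (hker : ∀ x, π x = 0 ↔ ∃ c : ℝ, x = c • v i) (hi : ∀ j, j ≠ i → r j < r i)
    (I' : Finset {j // j ≠ i}) :
    LexAdm (fun j : {j // j ≠ i} => r j) (fun j => π (v j)) I' ↔
      LexAdm r v (insert i (I'.map (Function.Embedding.subtype _))) := by
  have hsum : ∀ d : ι → ℝ, ∑ j, d j • v j = d i • v i + ∑ j : {j // j ≠ i}, d j • v j := by
    intro d
    rw [← Finset.add_sum_erase _ _ (Finset.mem_univ i)]
    congr 1
    refine Finset.sum_subtype _ (fun j => by simp) _
  have hmem : ∀ j : {j // j ≠ i},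
      (j : ι) ∉ insert i (I'.map (Function.Embedding.subtype _)) ↔ j ∉ I' := by
    intro j
    simp [j.2]
  constructor
  · intro h d hd hd0 hneg
    refine h (fun j => d j) ?_ (fun j hj => hd0 j ((hmem j).2 hj)) ?_
    · have h1 := congrArg π hd
      rw [hsum, map_add, map_smul, (hker (v i)).2 ⟨1, by simp⟩] at h1
      simpa using h1
    · obtain ⟨j, hj, hj'⟩ := hneg
      by_cases hji : j = i
      · subst hji
        have : d j • v j = 0 := by
          rw [hsum, Finset.sum_eq_zero, add_zero] at hd
          · exact hd
          · intro k _
            rw [hj' k (hi k k.2), zero_smul]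
        rcases smul_eq_zero.1 this with h0 | h0
        · exact absurd h0 hj.ne
        · exact absurd h0 hv
      · exact ⟨⟨j, hji⟩, hj, fun k hk => hj' k hk⟩
  · intro h d hd hd0 hneg
    have h1 : π (∑ j : {j // j ≠ i}, d j • v j) = 0 := by simpa using hd
    obtain ⟨c, hc⟩ := (hker _).1 h1
    refine h (fun j => if hj : j ≠ i then d ⟨j, hj⟩ else -c) ?_ (fun j hj => ?_) ?_
    · rw [hsum]
      have : ∑ j : {j // j ≠ i}, (if hj : (j : ι) ≠ i then d ⟨j, hj⟩ else -c) • v j =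
          ∑ j : {j // j ≠ i}, d j • v j := Finset.sum_congr rfl fun j _ => by simp [j.2]
      rw [this, hc]
      simp
    · have hji : j ≠ i := fun h0 => hj (by simp [h0])
      simp only [hji, ne_eq, not_false_eq_true, dite_true]
      exact hd0 _ ((hmem ⟨j, hji⟩).1 hj)
    · obtain ⟨j, hj, hj'⟩ := hneg
      refine ⟨j, by simpa [j.2] using hj, fun k hk => ?_⟩
      have hki : k ≠ i := fun h0 => by
        rw [h0] at hk
        exact (hi j j.2).not_gt hk
      simp only [hki, ne_eq, not_false_eq_true, dite_true]
      exact hj' ⟨k, hki⟩ hk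

end Triangulation

/-! ### Fractions attached to a triangulation -/

section Telescope

variable {W : Type*} [NormedAddCommGroup W] [NormedSpace ℝ W] {ι : Type*} [Fintype ι]

/-- The points `s + ∑_{i ∈ I} t i • v i` with `0 < t i` for `i ∈ I` and `t i ≤ 1` for `i ∈ J`. -/
def partBox (s : W) (v : ι → W) (I J : Finset ι) : Set W :=
  {x | ∃ t : ι → ℝ, (∀ i ∈ I, 0 < t i) ∧ (∀ i ∈ J, t i ≤ 1) ∧ (∀ i ∉ I, t i = 0) ∧
    x = s + ∑ i, t i • v i}

theorem partBox_empty (s : W) (v : ι → W) (I : Finset ι) : partBox s v I ∅ = openCone s v I := by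
  ext x; simp [partBox, openCone]

theorem partBox_self (s : W) (v : ι → W) (I : Finset ι) : partBox s v I I = box s v I := by
  ext x
  constructor
  · rintro ⟨t, h1, h2, h3, h4⟩
    exact ⟨t, fun i hi => ⟨h1 i hi, h2 i hi⟩, h3, h4⟩
  · rintro ⟨t, h1, h3, h4⟩
    exact ⟨t, fun i hi => (h1 i hi).1, fun i hi => (h1 i hi).2, h3, h4⟩

theorem coords_unique {v : ι → W} {I : Finset ι} (hI : LinearIndependent ℝ (fun i : I => v i))
    {t u : ι → ℝ} (ht : ∀ i ∉ I, t i = 0) (hu : ∀ i ∉ I, u i = 0)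
    (h : ∑ i, t i • v i = ∑ i, u i • v i) : t = u := by
  classical
  rw [Fintype.linearIndependent_iff] at hI
  have h0 : ∑ i : I, (t i - u i) • v i = 0 := by
    rw [Finset.sum_coe_sort I (fun i => (t i - u i) • v i),
      Finset.sum_subset (Finset.subset_univ I) (fun j _ hj => by simp [ht j hj, hu j hj])]
    simp [sub_smul, h]
  funext i
  by_cases hi : i ∈ I
  · exact sub_eq_zero.1 (hI _ h0 ⟨i, hi⟩)
  · rw [ht i hi, hu i hi]

theorem mem_partBox_insert [DecidableEq ι] {s : W} {v : ι → W} {I J : Finset ι}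
    (hI : LinearIndependent ℝ (fun i : I => v i)) {j : ι} (hj : j ∈ I) (hjJ : j ∉ J) (x : W) :
    x ∈ partBox s v I (insert j J) ↔ x ∈ partBox s v I J ∧ x - v j ∉ partBox s v I J := by
  constructor
  · rintro ⟨t, h1, h2, h3, rfl⟩
    refine ⟨⟨t, h1, fun i hi => h2 i (by simp [hi]), h3, rfl⟩, ?_⟩
    rintro ⟨u, k1, k2, k3, he⟩
    have hne : ∀ i, i ∉ I → i ≠ j := fun i hi h => hi (h ▸ hj)
    have : t = u + Pi.single j 1 := by
      refine coords_unique hI h3 (fun i hi => by simp [k3 i hi, hne i hi]) ?_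
      have : ∑ i, t i • v i = ∑ i, u i • v i + v j := by
        rw [add_sub_assoc] at he
        exact sub_eq_iff_eq_add.1 (add_left_cancel he)
      rw [this]
      simp [add_smul, Finset.sum_add_distrib, Pi.single_apply, ite_smul]
    have h4 := h2 j (by simp)
    have h5 := k1 j hj
    rw [this] at h4
    simp only [Pi.add_apply, Pi.single_eq_same] at h4
    linarith
  · rintro ⟨⟨t, h1, h2, h3, rfl⟩, hx⟩
    refine ⟨t, h1, fun i hi => ?_, h3, rfl⟩
    rcases Finset.mem_insert.1 hi with rfl | hi
    · by_contra hlt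
      push Not at hlt
      refine hx ⟨t - Pi.single i 1, fun k hk => ?_, fun k hk => ?_, fun k hk => ?_, ?_⟩
      · rcases eq_or_ne k i with rfl | hki
        · simpa using hlt
        · simpa [hki] using h1 k hk
      · have hki : k ≠ i := fun h => hjJ (h ▸ hk)
        simpa [hki] using h2 k hk
      · have hki : k ≠ i := fun h => hk (h ▸ hj)
        simpa [hki] using h3 k hk
      · simp [sub_smul, Finset.sum_sub_distrib, Pi.single_apply, ite_smul, add_sub_assoc]
    · exact h2 i hi

theorem mem_partBox_of_sub {s : W} {v : ι → W} {I J : Finset ι} {j : ι} (hj : j ∈ I) (hjJ : j ∉ J)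
    {x : W} (hx : x - v j ∈ partBox s v I J) : x ∈ partBox s v I J := by
  classical
  obtain ⟨t, h1, h2, h3, he⟩ := hx
  refine ⟨t + Pi.single j 1, fun k hk => ?_, fun k hk => ?_, fun k hk => ?_, ?_⟩
  · rcases eq_or_ne k j with rfl | hki
    · simpa using by linarith [h1 k hk]
    · simpa [hki] using h1 k hk
  · have hki : k ≠ j := fun h => hjJ (h ▸ hk)
    simpa [hki] using h2 k hk
  · have hki : k ≠ j := fun h => hk (h ▸ hj)
    simpa [hki] using h3 k hk
  · rw [sub_eq_iff_eq_add.1 he]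
    simp [add_smul, Finset.sum_add_distrib, Pi.single_apply, ite_smul, add_assoc]

/-- Cutting an open simplicial cone down to its half-open box, one direction at a time: for any
functional `Φ` which is linear on a class `C` of functions and invariant under translation by the
generators, `∏ (1 - e^⟨ξ,v i⟩) Φ(cone) = Φ(box)`. No sign of `⟨ξ,v i⟩` is needed. -/
theorem telescope (C : (W → ℝ) → Prop) (Φ : (W → ℝ) → ℝ)
    (hsub : ∀ f g, C f → C g → C (f - g) ∧ Φ (f - g) = Φ f - Φ g)
    (hsmul : ∀ (a : ℝ) f, C f → C (a • f) ∧ Φ (a • f) = a * Φ f)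
    (s : W) (v : ι → W) (I : Finset ι) (hI : LinearIndependent ℝ (fun i : I => v i))
    (htr : ∀ i ∈ I, ∀ f, C f → C (fun x => f (x - v i)) ∧ Φ (fun x => f (x - v i)) = Φ f)
    (ξ : StrongDual ℝ W)
    (h : C (Set.indicator (openCone s v I) fun x => Real.exp (ξ x))) :
    (∏ i ∈ I, (1 - Real.exp (ξ (v i)))) *
        Φ (Set.indicator (openCone s v I) fun x => Real.exp (ξ x)) =
      Φ (Set.indicator (box s v I) fun x => Real.exp (ξ x)) := by
  classical
  have key : ∀ J ⊆ I, C (Set.indicator (partBox s v I J) fun x => Real.exp (ξ x)) ∧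
      (∏ i ∈ J, (1 - Real.exp (ξ (v i)))) *
        Φ (Set.indicator (openCone s v I) fun x => Real.exp (ξ x)) =
      Φ (Set.indicator (partBox s v I J) fun x => Real.exp (ξ x)) := by
    intro J
    induction J using Finset.induction_on with
    | empty => exact fun _ => by simpa [partBox_empty] using h
    | insert j J hj ih =>
      intro hJI
      obtain ⟨hC, hΦ⟩ := ih fun i hi => hJI (by simp [hi])
      have hjI : j ∈ I := hJI (by simp)
      set F := Set.indicator (partBox s v I J) fun x => Real.exp (ξ x) with hF
      have hstep : (Set.indicator (partBox s v I (insert j J)) fun x => Real.exp (ξ x)) =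
          F - Real.exp (ξ (v j)) • fun x => F (x - v j) := by
        funext x
        have e1 := mem_partBox_insert (s := s) hI hjI hj x
        simp only [Pi.sub_apply, Pi.smul_apply, smul_eq_mul, hF, Set.indicator_apply]
        by_cases h1 : x ∈ partBox s v I J
        · by_cases h2 : x - v j ∈ partBox s v I J
          · have h3 : x ∉ partBox s v I (insert j J) := fun h => (e1.1 h).2 h2
            rw [if_neg h3, if_pos h1, if_pos h2, ← Real.exp_add, ← map_add]
            simp
          · rw [if_pos (e1.2 ⟨h1, h2⟩), if_pos h1, if_neg h2]
            simp
        · have h2 : x - v j ∉ partBox s v I J := fun h => h1 (mem_partBox_of_sub hjI hj h)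
          have h3 : x ∉ partBox s v I (insert j J) := fun h => h1 (e1.1 h).1
          rw [if_neg h3, if_neg h1, if_neg h2]
          simp
      obtain ⟨t1, t2⟩ := htr j hjI F hC
      obtain ⟨m1, m2⟩ := hsmul (Real.exp (ξ (v j))) _ t1
      obtain ⟨s1, s2⟩ := hsub _ _ hC m1
      rw [hstep]
      refine ⟨s1, ?_⟩
      rw [s2, m2, t2, Finset.prod_insert hj, mul_assoc, hΦ]
      ring
  have := (key I le_rfl).2
  rwa [partBox_self] at this

end Telescope

section AbstractFracSum

variable {A B : Type*} [CommRing A] [IsDomain A] [CommRing B] [IsDomain B] {ι : Type*}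

/-- The fraction `∑_{I ∈ T} N I / ∏_{i ∈ I} d i`. -/
noncomputable def fracSum (d : ι → A) (T : Finset (Finset ι)) (N : Finset ι → A) :
    FractionRing A :=
  ∑ I ∈ T, algebraMap A (FractionRing A) (N I) / algebraMap _ _ (∏ i ∈ I, d i)

/-- The product of all `d i` is a common denominator. -/
theorem denominator_mul_fracSum [Fintype ι] [DecidableEq ι] {d : ι → A} (hd : ∀ i, d i ≠ 0)
    (T : Finset (Finset ι)) (N : Finset ι → A) :
    algebraMap _ _ (∏ i, d i) * fracSum d T N =
      algebraMap _ _ (∑ I ∈ T, (∏ i ∈ Iᶜ, d i) * N I) := by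
  rw [fracSum, Finset.mul_sum, map_sum]
  refine Finset.sum_congr rfl fun I _ => ?_
  rw [← Finset.prod_mul_prod_compl I, map_mul, map_mul]
  have := algebraMap_fraction_ne_zero (Finset.prod_ne_zero_iff.2 fun i (_ : i ∈ I) => hd i)
  field_simp

/-- The residue of `fracSum` along a divisor `d i`: only the simplices containing `i`
contribute. -/
theorem specializes_fracSum [DecidableEq ι] (c : A →+* B) {d : ι → A} (hd : ∀ i, d i ≠ 0) (i : ι)
    (hci : c (d i) = 0) (hcj : ∀ j, j ≠ i → c (d j) ≠ 0) (T : Finset (Finset ι))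
    (T' : Finset (Finset {j // j ≠ i}))
    (hT : ∀ I', I' ∈ T' ↔ insert i (I'.map (Function.Embedding.subtype _)) ∈ T)
    (N : Finset ι → A) (N' : Finset {j // j ≠ i} → B)
    (hN : ∀ I' ∈ T', c (N (insert i (I'.map (Function.Embedding.subtype _)))) = N' I') :
    Specializes c (algebraMap _ _ (d i) * fracSum d T N)
      (fracSum (fun j : {j // j ≠ i} => c (d j)) T' N') := by
  have hprod : ∀ I : Finset ι, i ∉ I → c (∏ j ∈ I, d j) ≠ 0 := by
    intro I hI
    rw [map_prod, Finset.prod_ne_zero_iff]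
    exact fun j hj => hcj j fun h => hI (h ▸ hj)
  set e : Finset {j // j ≠ i} → Finset ι :=
    fun I' => insert i (I'.map (Function.Embedding.subtype _)) with he
  have hnot : ∀ I' : Finset {j // j ≠ i}, i ∉ I'.map (Function.Embedding.subtype _) := by
    intro I'; simp
  have hsplit : algebraMap _ _ (d i) * fracSum d T N =
      (∑ I ∈ T.filter (fun I => i ∉ I), algebraMap A (FractionRing A) (d i) *
        (algebraMap _ _ (N I) / algebraMap _ _ (∏ j ∈ I, d j))) +
      ∑ I' ∈ T', algebraMap _ _ (N (e I')) /
          algebraMap _ _ (∏ j ∈ I'.map (Function.Embedding.subtype _), d j) := by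
    rw [fracSum, Finset.mul_sum, ← Finset.sum_filter_add_sum_filter_not T (fun I => i ∉ I)]
    congr 1
    symm
    refine Finset.sum_bij (fun I' _ => e I') ?_ ?_ ?_ ?_
    · intro I' hI'
      simpa [he] using (hT I').1 hI'
    · intro I₁ _ I₂ _ h
      have h' := congrArg (fun I => Finset.erase I i) h
      simp only [he, Finset.erase_insert (hnot _)] at h'
      exact Finset.map_injective _ h'
    · intro I hI
      simp only [Finset.mem_filter, not_not] at hI
      have hIe : e (I.subtype (· ≠ i)) = I := by
        ext j
        simp only [he, Finset.mem_insert, Finset.mem_map, Finset.mem_subtype,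
          Function.Embedding.coe_subtype, Subtype.exists, exists_and_left, exists_prop]
        by_cases hj : j = i
        · simp [hj, hI.2]
        · simp [hj]
      exact ⟨I.subtype (· ≠ i), (hT _).2 (show e (I.subtype (· ≠ i)) ∈ T by rw [hIe]; exact hI.1),
        hIe⟩
    · intro I' _
      have h1 := algebraMap_fraction_ne_zero (hd i)
      have h2 := algebraMap_fraction_ne_zero (Finset.prod_ne_zero_iff.2
        fun j (_ : j ∈ I'.map (Function.Embedding.subtype _)) => hd j)
      simp only [he, Finset.prod_insert (hnot I'), map_mul]
      field_simp
  have hA : Specializes c (∑ I ∈ T.filter (fun I => i ∉ I), algebraMap A (FractionRing A) (d i) *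
        (algebraMap _ _ (N I) / algebraMap _ _ (∏ j ∈ I, d j))) (∑ I ∈ T.filter (fun I => i ∉ I), 0) := by
    refine Specializes.sum _ fun I hI => ?_
    have h0 := (Specializes.of_algebraMap (c := c) (d i)).mul
      ((Specializes.of_algebraMap (c := c) (N I)).div
        (hprod I (by simpa using (Finset.mem_filter.1 hI).2)))
    rw [hci, map_zero, zero_mul] at h0
    exact h0
  have hB : Specializes c (∑ I' ∈ T', algebraMap A (FractionRing A) (N (e I')) /
          algebraMap _ _ (∏ j ∈ I'.map (Function.Embedding.subtype _), d j))
      (fracSum (fun j : {j // j ≠ i} => c (d j)) T' N') := by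
    refine Specializes.sum _ fun I' hI' => ?_
    have h0 := (Specializes.of_algebraMap (c := c) (N (e I'))).div (hprod _ (hnot I'))
    have e1 : c (∏ j ∈ I'.map (Function.Embedding.subtype _), d j) = ∏ j ∈ I', c (d j) := by
      rw [map_prod, Finset.prod_map]
      rfl
    rw [hN I' hI', e1] at h0
    exact h0
  have := hA.add hB
  rwa [Finset.sum_const_zero, zero_add, ← hsplit] at this

end AbstractFracSum

theorem isRationalPoint_of_mem {W : Type*} [NormedAddCommGroup W] {Λ : Submodule ℤ W} {x : W}
    (h : x ∈ Λ) : IsRationalPoint Λ x :=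
  ⟨1, one_ne_zero, by simpa using h⟩

section FracSum

variable {W : Type*} [NormedAddCommGroup W] [NormedSpace ℝ W] {ι : Type*}

theorem prod_one_sub_ne_zero {v : ι → W} (hv : ∀ i, v i ≠ 0) (I : Finset ι) :
    ∏ i ∈ I, (1 - expGerm (v i)) ≠ 0 :=
  Finset.prod_ne_zero_iff.2 fun i _ => one_sub_expGerm_ne_zero (hv i)

theorem coe_prod_mk {α E : Type*} [NormedAddCommGroup E] [NormedSpace ℝ E] (s : Finset α)
    (f : α → E → ℝ) (hf : ∀ i, AnalyticAt ℝ (f i) 0) :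
    ∏ i ∈ s, AnalyticGerm.mk (f i) (hf i) =
      AnalyticGerm.mk (∏ i ∈ s, f i) (Finset.analyticAt_prod s fun i _ => hf i) := by
  classical
  induction s using Finset.induction_on with
  | empty => simp; rfl
  | insert i s hi ih =>
    rw [Finset.prod_insert hi, ih, AnalyticGerm.mk_mul, AnalyticGerm.mk_eq_mk,
      Finset.prod_insert hi]

theorem coe_sum_mk {α E : Type*} [NormedAddCommGroup E] [NormedSpace ℝ E] (s : Finset α)
    (f : α → E → ℝ) (hf : ∀ i, AnalyticAt ℝ (f i) 0) :
    ∑ i ∈ s, AnalyticGerm.mk (f i) (hf i) =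
      AnalyticGerm.mk (∑ i ∈ s, f i) (Finset.analyticAt_sum s fun i _ => hf i) := by
  classical
  induction s using Finset.induction_on with
  | empty => simp; rfl
  | insert i s hi ih =>
    rw [Finset.sum_insert hi, ih, AnalyticGerm.mk_add, AnalyticGerm.mk_eq_mk,
      Finset.sum_insert hi]

variable {Λ : Submodule ℤ W}

theorem ratAnalytic_one_sub_exp {x : W} (h : x ∈ Λ) :
    RatAnalytic Λ (fun ξ : StrongDual ℝ W => 1 - Real.exp (ξ x)) := by
  have := (RatAnalytic.const (Λ := Λ) 1).sub (RatAnalytic.exp (isRationalPoint_of_mem h))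
  simp only [Rat.cast_one] at this
  exact this

theorem one_sub_expGerm_eq_mk (x : W) : 1 - expGerm x =
    AnalyticGerm.mk (fun ξ : StrongDual ℝ W => 1 - Real.exp (ξ x))
      (analyticAt_const.sub (analyticAt_exp_eval x 0)) := rfl

/-- `fracSum` is a quotient of entire functions with rational Taylor coefficients; the numerator and
the denominator are evaluated termwise. -/
theorem isRationalQuotient_fracSum [Fintype ι] {v : ι → W} (hv : ∀ i, v i ≠ 0) (hvΛ : ∀ i, v i ∈ Λ)
    (T : Finset (Finset ι)) (n : Finset ι → StrongDual ℝ W → ℝ) (hn : ∀ I, IsEntire (n I))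
    (hnr : ∀ I, RatAnalytic Λ (n I)) :
    ∃ g h : StrongDual ℝ W → ℝ,
      IsRationalQuotient Λ (fracSum (fun i => 1 - expGerm (v i)) T fun I => AnalyticGerm.mk (n I) (hnr I).1) g h ∧
      ∀ (ξ : StrongDual ℝ W) (τ : Finset ι → ℝ),
        (∀ I ∈ T, (∏ i ∈ I, (1 - Real.exp (ξ (v i)))) * τ I = n I ξ) →
          g ξ = h ξ * ∑ I ∈ T, τ I := by
  classical
  set d : ι → StrongDual ℝ W → ℝ := fun i ξ => 1 - Real.exp (ξ (v i)) with hd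
  have hdr : ∀ i, RatAnalytic Λ (d i) := fun i => ratAnalytic_one_sub_exp (hvΛ i)
  have hde : ∀ i, IsEntire (d i) := fun i => (IsEntire.const 1).sub (IsEntire.exp (v i))
  have hp : ∀ I : Finset ι, RatAnalytic Λ (∏ i ∈ Iᶜ, d i) := fun I =>
    RatAnalytic.prod _ fun i _ => hdr i
  refine ⟨∑ I ∈ T, (∏ i ∈ Iᶜ, d i) * n I, ∏ i, d i, ⟨⟨?_, ?_⟩, ⟨?_, ?_⟩, ?_⟩, ?_⟩
  · exact IsEntire.sum _ fun I _ => (IsEntire.prod _ fun i _ => hde i).mul (hn I)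
  · exact (RatAnalytic.sum _ fun I _ => (hp I).mul (hnr I)).2
  · exact IsEntire.prod _ fun i _ => hde i
  · exact (RatAnalytic.prod _ fun i _ => hdr i).2
  · refine ⟨∑ I ∈ T, (∏ i ∈ Iᶜ, (1 - expGerm (v i))) * AnalyticGerm.mk (n I) (hnr I).1,
      ∏ i, (1 - expGerm (v i)), ?_, ?_, prod_one_sub_ne_zero hv _, ?_⟩
    · simp only [one_sub_expGerm_eq_mk, coe_prod_mk, AnalyticGerm.mk_mul]
      rw [coe_sum_mk]
      rfl
    · simp only [one_sub_expGerm_eq_mk, coe_prod_mk]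
      rfl
    · rw [mul_comm]
      exact denominator_mul_fracSum (fun i => one_sub_expGerm_ne_zero (hv i)) T _
  · intro ξ τ hτ
    simp only [Finset.sum_apply, Pi.mul_apply, Finset.prod_apply, hd, Finset.mul_sum]
    refine Finset.sum_congr rfl fun I hI => ?_
    rw [← hτ I hI, ← Finset.prod_mul_prod_compl I]
    ring

end FracSum

/-! ### The exponential sum of a pointed affine cone -/

/-- The terms of the exponential sum over `p ∩ Λ`, as a series over `Λ`. -/
theorem summable_subtype_lattice_iff {W : Type*} [NormedAddCommGroup W]
    (Λ : Submodule ℤ W) (p : Set W) (f : W → ℝ) :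
    Summable (fun x : {x : W // x ∈ p ∧ x ∈ Λ} => f x) ↔
      Summable (fun x : Λ => Set.indicator p f x) := by
  have h : (fun x : Λ => Set.indicator p f x) =
      Set.indicator {x : Λ | (x : W) ∈ p} (fun x : Λ => f x) := by
    classical
    funext x; simp [Set.indicator_apply]
  rw [h, ← summable_subtype_iff_indicator, ← Equiv.summable_iff
    (⟨fun x => ⟨⟨x, x.2.2⟩, x.2.1⟩, fun x => ⟨x, x.2, x.1.2⟩, fun _ => rfl, fun _ => rfl⟩ :
      {x : W // x ∈ p ∧ x ∈ Λ} ≃ {x : Λ | (x : W) ∈ p})]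
  rfl

theorem tsum_subtype_lattice {W : Type*} [NormedAddCommGroup W] (Λ : Submodule ℤ W)
    (p : Set W) (f : W → ℝ) :
    ∑' x : {x : W // x ∈ p ∧ x ∈ Λ}, f x = ∑' x : Λ, Set.indicator p f x := by
  have h : (fun x : Λ => Set.indicator p f x) =
      Set.indicator {x : Λ | (x : W) ∈ p} (fun x : Λ => f x) := by
    classical
    funext x; simp [Set.indicator_apply]
  rw [h, ← tsum_subtype, ← Equiv.tsum_eq
    (⟨fun x => ⟨⟨x, x.2.2⟩, x.2.1⟩, fun x => ⟨x, x.2, x.1.2⟩, fun _ => rfl, fun _ => rfl⟩ :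
      {x : W // x ∈ p ∧ x ∈ Λ} ≃ {x : Λ | (x : W) ∈ p})]
  rfl

section ExpSum

variable {W : Type*} [NormedAddCommGroup W] [NormedSpace ℝ W] {ι : Type*} [Fintype ι]

/-- If the sum of coordinates is bounded then so is the point. -/
theorem norm_sum_smul_le (v : ι → W) {t : ι → ℝ} (ht : ∀ i, 0 ≤ t i) :
    ‖∑ i, t i • v i‖ ≤ (∑ i, t i) * (1 + ∑ i, ‖v i‖) := by
  refine (norm_sum_le _ _).trans ?_
  rw [Finset.sum_mul]
  refine Finset.sum_le_sum fun i _ => ?_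
  rw [norm_smul, Real.norm_of_nonneg (ht i)]
  refine mul_le_mul_of_nonneg_left ?_ (ht i)
  have := Finset.single_le_sum (f := fun i => ‖v i‖) (fun j _ => norm_nonneg _) (Finset.mem_univ i)
  linarith

theorem exists_neg_bound {v : ι → W} {l : StrongDual ℝ W} (hl : ∀ i, l (v i) < 0) :
    ∃ δ > 0, ∀ i, l (v i) ≤ -δ := by
  rcases isEmpty_or_nonempty ι with h | h
  · exact ⟨1, one_pos, fun i => (IsEmpty.false i).elim⟩
  · obtain ⟨i₀, hi₀⟩ := Finite.exists_max fun i => l (v i)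
    exact ⟨-l (v i₀), by simpa using hl i₀, fun i => by simpa using hi₀ i⟩

/-- A linear form which is negative on the generators decreases at a linear rate on the cone. -/
theorem exists_decay (s : W) {v : ι → W} {l : StrongDual ℝ W} (hl : ∀ i, l (v i) < 0) :
    ∃ c > 0, ∃ b, ∀ x ∈ (fun y => s + y) '' cone v, l x ≤ b - c * ‖x‖ := by
  obtain ⟨δ, hδ, hδ'⟩ := exists_neg_bound hl
  set M := 1 + ∑ i, ‖v i‖ with hM
  have hM0 : 0 < M := by
    have := Finset.sum_nonneg (s := Finset.univ) fun i (_ : i ∈ Finset.univ) => norm_nonneg (v i)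
    linarith
  refine ⟨δ / M, by positivity, l s + δ / M * ‖s‖, ?_⟩
  rintro _ ⟨_, ⟨t, ht, rfl⟩, rfl⟩
  have h1 : l (∑ i, t i • v i) ≤ -δ * ∑ i, t i := by
    rw [map_sum, Finset.mul_sum]
    refine Finset.sum_le_sum fun i _ => ?_
    rw [map_smul, smul_eq_mul, mul_comm (-δ)]
    exact mul_le_mul_of_nonneg_left (hδ' i) (ht i)
  have h2 := norm_sum_smul_le v ht
  have h3 : ‖s + ∑ i, t i • v i‖ ≤ ‖s‖ + (∑ i, t i) * M := (norm_add_le _ _).trans (by gcongr)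
  have h4 : δ / M * ‖s + ∑ i, t i • v i‖ ≤ δ / M * ‖s‖ + δ * ∑ i, t i := by
    calc _ ≤ δ / M * (‖s‖ + (∑ i, t i) * M) := by gcongr
      _ = _ := by field_simp
  simp only [map_add]
  linarith

theorem not_containsLine (s : W) {v : ι → W} {l : StrongDual ℝ W} (hl : ∀ i, l (v i) < 0) :
    ¬ ContainsLine ((fun y => s + y) '' cone v) := by
  rintro ⟨x, w, hw, h⟩
  obtain ⟨c, hc, b, hb⟩ := exists_decay s hl
  have hw0 : 0 < ‖w‖ := norm_pos_iff.2 hw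
  -- one of the two directions of the line does not decrease `l`
  wlog hlw : 0 ≤ l w generalizing w
  · refine this (-w) (neg_ne_zero.2 hw) (fun t => ?_) (by simpa using hw0) ?_
    · simpa using h (-t)
    · simpa using (not_le.1 hlw).le
  set t : ℝ := ((b - l x) / c + ‖x‖ + 1) / ‖w‖ with ht
  have hx := hb _ (by simpa using h 0)
  have hbl : 0 ≤ (b - l x) / c := div_nonneg (by
    have := mul_nonneg hc.le (norm_nonneg x); linarith) hc.le
  have ht0 : 0 ≤ t := by positivity
  have h1 := hb _ (h t)
  have h2 : ‖t • w‖ ≤ ‖x + t • w‖ + ‖x‖ := by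
    have := norm_sub_le (x + t • w) x
    simpa using this
  have h3 : ‖t • w‖ = (b - l x) / c + ‖x‖ + 1 := by
    rw [norm_smul, Real.norm_of_nonneg ht0, ht, div_mul_cancel₀ _ hw0.ne']
  have h4 : c * ((b - l x) / c + 1) ≤ c * ‖x + t • w‖ :=
    mul_le_mul_of_nonneg_left (by linarith) hc.le
  rw [mul_add, mul_div_cancel₀ _ hc.ne'] at h4
  simp only [map_add, map_smul, smul_eq_mul] at h1
  have := mul_nonneg ht0 hlw
  linarith

theorem isOpen_negative (v : ι → W) : IsOpen {ξ : StrongDual ℝ W | ∀ i, ξ (v i) < 0} := by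
  simp only [Set.ofPred_forall]
  exact isOpen_iInter_of_finite fun i =>
    isOpen_lt (ContinuousLinearMap.apply ℝ ℝ (v i)).continuous continuous_const

variable [FiniteDimensional ℝ W] (Λ : Submodule ℤ W) [DiscreteTopology Λ]

theorem summable_exp_neg_norm {c : ℝ} (hc : 0 < c) :
    Summable fun x : Λ => Real.exp (-(c * ‖(x : W)‖)) := by
  set n := Module.finrank ℤ Λ + 1 with hn
  have h := (ZLattice.summable_norm_pow_inv Λ n (Nat.lt_succ_self _)).mul_left
    ((n.factorial : ℝ) / c ^ n)
  refine Summable.of_norm_bounded_eventually h ?_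
  rw [Filter.eventually_cofinite]
  refine (Set.finite_singleton (0 : Λ)).subset fun x hx => ?_
  by_contra h0
  apply hx
  have hx0 : 0 < ‖x‖ := norm_pos_iff.2 h0
  rw [Real.norm_of_nonneg (Real.exp_pos _).le, Real.exp_neg]
  have h1 := Real.pow_div_factorial_le_exp (x := c * ‖(x : W)‖) (by positivity) n
  have h2 : 0 < (c * ‖(x : W)‖) ^ n / n.factorial := by
    have : 0 < ‖(x : W)‖ := hx0
    positivity
  refine (inv_anti₀ h2 h1).trans (le_of_eq ?_)
  have : ‖(x : W)‖ = ‖x‖ := rfl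
  rw [inv_div, mul_pow, inv_pow, this]
  field_simp

theorem summable_cone (s : W) {v : ι → W} {ξ : StrongDual ℝ W} (hξ : ∀ i, ξ (v i) < 0) :
    Summable (fun x : {x : W // x ∈ (fun y => s + y) '' cone v ∧ x ∈ Λ} => Real.exp (ξ x)) := by
  obtain ⟨c, hc, b, hb⟩ := exists_decay s hξ
  rw [summable_subtype_lattice_iff Λ _ fun x => Real.exp (ξ x)]
  refine Summable.of_nonneg_of_le (fun x => Set.indicator_nonneg (fun _ _ => (Real.exp_pos _).le) _)
    (fun x => ?_) ((summable_exp_neg_norm Λ hc).mul_left (Real.exp b))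
  classical
  rw [Set.indicator_apply]
  split_ifs with h
  · rw [← Real.exp_add, Real.exp_le_exp]
    linarith [hb _ h]
  · positivity

theorem finite_box_inter (s : W) (v : ι → W) (I : Finset ι) :
    (box s v I ∩ (Λ : Set W)).Finite := by
  have hcl : IsClosed (Λ : Set W) := by
    rw [← Submodule.coe_toAddSubgroup]
    exact AddSubgroup.isClosed_of_discrete
  refine Metric.finite_isBounded_inter_isClosed DiscreteTopology.isDiscrete ?_ hcl
  rw [isBounded_iff_forall_norm_le]
  refine ⟨‖s‖ + Fintype.card ι * (1 + ∑ i, ‖v i‖), ?_⟩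
  rintro _ ⟨t, h1, h2, rfl⟩
  have ht : ∀ i, 0 ≤ t i ∧ t i ≤ 1 := fun i => by
    by_cases hi : i ∈ I
    · exact ⟨(h1 i hi).1.le, (h1 i hi).2⟩
    · simp [h2 i hi]
  refine (norm_add_le _ _).trans (add_le_add le_rfl
    ((norm_sum_smul_le v fun i => (ht i).1).trans ?_))
  have : ∑ i, t i ≤ Fintype.card ι := by
    simpa using Finset.sum_le_card_nsmul Finset.univ t 1 fun i _ => (ht i).2
  have h0 : 0 ≤ ∑ i, ‖v i‖ := Finset.sum_nonneg fun i _ => norm_nonneg _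
  gcongr

/-- The lattice points of the half-open parallelepiped `box s v I`. -/
noncomputable def boxPoints (s : W) (v : ι → W) (I : Finset ι) : Finset W :=
  (finite_box_inter Λ s v I).toFinset

theorem mem_boxPoints {s : W} {v : ι → W} {I : Finset ι} {x : W} :
    x ∈ boxPoints Λ s v I ↔ x ∈ box s v I ∧ x ∈ Λ := by
  simp [boxPoints]

/-- The exponential sum over the lattice points of a box. -/
noncomputable def boxSum (s : W) (v : ι → W) (I : Finset ι) : StrongDual ℝ W → ℝ :=
  ∑ x ∈ boxPoints Λ s v I, fun ξ => Real.exp (ξ x)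

theorem ratAnalytic_boxSum (s : W) (v : ι → W) (I : Finset ι) :
    RatAnalytic Λ (boxSum Λ s v I) :=
  RatAnalytic.sum _ fun _ hx =>
    RatAnalytic.exp (isRationalPoint_of_mem ((mem_boxPoints Λ).1 hx).2)

/-- The germ of the exponential sum over the lattice points of a box. -/
noncomputable def boxSumGerm (s : W) (v : ι → W) (I : Finset ι) : AnalyticGerm (StrongDual ℝ W) :=
  AnalyticGerm.mk (boxSum Λ s v I) (ratAnalytic_boxSum Λ s v I).1

theorem boxSumGerm_eq (s : W) (v : ι → W) (I : Finset ι) :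
    boxSumGerm Λ s v I = ∑ x ∈ boxPoints Λ s v I, expGerm x := by
  simp only [expGerm]
  rw [coe_sum_mk]
  rfl

/-- The exponential sum of a pointed affine cone: each simplex `I` contributes the sum over its box,
divided by `∏_{i ∈ I} (1 - e^⟨ξ,v i⟩)`. -/
theorem isExpSum_cone {r : ι → ℕ} (hr : Function.Injective r) (s : W) {v : ι → W}
    (hvΛ : ∀ i, v i ∈ Λ) {l : StrongDual ℝ W} (hl : ∀ i, l (v i) < 0) :
    IsExpSum Λ ((fun y => s + y) '' cone v)
      (fracSum (fun i => 1 - expGerm (v i)) (simplices r v) (boxSumGerm Λ s v)) := by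
  refine ⟨fun h => absurd h (not_containsLine s hl), fun _ => ?_⟩
  have hv : ∀ i, v i ≠ 0 := fun i h => by
    have := hl i
    rw [h, map_zero] at this
    exact lt_irrefl _ this
  obtain ⟨g, h, hq, hgh⟩ := isRationalQuotient_fracSum hv hvΛ (simplices r v) (boxSum Λ s v)
    (fun I => IsEntire.sum _ fun x _ => IsEntire.exp x) (fun I => ratAnalytic_boxSum Λ s v I)
  refine ⟨g, h, hq, fun ξ hsum => ?_⟩
  rw [summable_subtype_lattice_iff Λ _ fun x => Real.exp (ξ x)] at hsum
  rw [tsum_subtype_lattice Λ _ fun x => Real.exp (ξ x)]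
  have hpart : ∀ I, Summable
      (fun x : Λ => Set.indicator (openCone s v I) (fun x => Real.exp (ξ x)) x) := by
    intro I
    refine Summable.of_nonneg_of_le
      (fun x => Set.indicator_nonneg (fun _ _ => (Real.exp_pos _).le) _) (fun x => ?_) hsum
    exact Set.indicator_le_indicator_of_subset (openCone_subset s v I)
      (fun _ => (Real.exp_pos _).le) _
  have htot : ∑' x : Λ, Set.indicator ((fun y => s + y) '' cone v) (fun x => Real.exp (ξ x)) x =
      ∑ I ∈ simplices r v,
        ∑' x : Λ, Set.indicator (openCone s v I) (fun x => Real.exp (ξ x)) x := by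
    rw [← Summable.tsum_finsetSum fun I _ => hpart I]
    exact tsum_congr fun x => indicator_eq_sum hr s hl _ _
  rw [htot]
  refine hgh ξ _ fun I hI => ?_
  have key := telescope (fun f : W → ℝ => Summable fun x : Λ => f x) (fun f => ∑' x : Λ, f x)
    (fun f g hf hg => ⟨hf.sub hg, hf.tsum_sub hg⟩)
    (fun a f hf => ⟨hf.mul_left a, hf.tsum_mul_left a⟩) s v I
    (mem_simplices.1 hI).linearIndependent ?_ ξ (hpart I)
  · refine key.trans ?_
    rw [boxSum, Finset.sum_apply, ← tsum_subtype_lattice Λ _ fun x => Real.exp (ξ x)]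
    have : ∑ x ∈ boxPoints Λ s v I, Real.exp (ξ x) =
        ∑' x : (boxPoints Λ s v I : Set W), Real.exp (ξ x) :=
      (Finset.tsum_subtype _ fun x => Real.exp (ξ x)).symm
    rw [this]
    exact Equiv.tsum_eq (Equiv.subtypeEquivRight fun x => by
      simp [mem_boxPoints] : {x : W // x ∈ box s v I ∧ x ∈ Λ} ≃ (boxPoints Λ s v I : Set W))
      (fun x => Real.exp (ξ x))
  · intro i _ f hf
    have e : (fun x : Λ => f (x - v i)) = (fun x : Λ => f x) ∘ Equiv.subRight (⟨v i, hvΛ i⟩ : Λ) := by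
      funext x; simp
    exact ⟨by rw [e, Equiv.summable_iff]; exact hf,
      (Equiv.subRight (⟨v i, hvΛ i⟩ : Λ)).tsum_eq (fun x : Λ => f x)⟩

theorem IsExpSum.unique (s : W) {v : ι → W} {l : StrongDual ℝ W} (hl : ∀ i, l (v i) < 0)
    {m m' : MeromorphicGerm (StrongDual ℝ W)}
    (h : IsExpSum Λ ((fun y => s + y) '' cone v) m)
    (h' : IsExpSum Λ ((fun y => s + y) '' cone v) m') : m = m' := by
  obtain ⟨g₁, h₁, hq, hT⟩ := h.2 (not_containsLine s hl)
  obtain ⟨g₂, h₂, hq', hT'⟩ := h'.2 (not_containsLine s hl)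
  exact hq.unique hq' (isOpen_negative v) ⟨l, hl⟩ (fun ξ hξ => hT ξ (summable_cone Λ s hξ))
    (fun ξ hξ => hT' ξ (summable_cone Λ s hξ))

theorem expSum_cone {r : ι → ℕ} (hr : Function.Injective r) (s : W) {v : ι → W}
    (hvΛ : ∀ i, v i ∈ Λ) {l : StrongDual ℝ W} (hl : ∀ i, l (v i) < 0) :
    expSum Λ ((fun y => s + y) '' cone v) =
      fracSum (fun i => 1 - expGerm (v i)) (simplices r v) (boxSumGerm Λ s v) := by
  have h := isExpSum_cone Λ hr s hvΛ hl
  have hex : ∃ m, IsExpSum Λ ((fun y => s + y) '' cone v) m := ⟨_, h⟩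
  rw [expSum, dif_pos hex]
  exact IsExpSum.unique Λ s hl hex.choose_spec h

/-- Lattice points of a box containing the primitive direction `v i` correspond to lattice points of
its image modulo `ℝ v i`: the coordinate along `v i` is determined modulo `1`. -/
theorem pullback_boxSumGerm [DecidableEq ι] {W' : Type*} [NormedAddCommGroup W']
    [NormedSpace ℝ W'] [FiniteDimensional ℝ W'] (Λ' : Submodule ℤ W') [DiscreteTopology Λ']
    (π : W →L[ℝ] W') (hΛ' : ∀ y, y ∈ Λ' ↔ ∃ x ∈ Λ, π x = y)
    (s : W) {v : ι → W} (i : ι) (hvi : v i ∈ Λ)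
    (hprim : ∀ c : ℝ, c • v i ∈ Λ → ∃ n : ℤ, c = n)
    (hker : ∀ x, π x = 0 ↔ ∃ c : ℝ, x = c • v i) (I' : Finset {j // j ≠ i})
    (hI : LinearIndependent ℝ
      (fun j : (insert i (I'.map (Function.Embedding.subtype _)) : Finset ι) => v j)) :
    pullbackHom (dualMapCLM π)
      (boxSumGerm Λ s v (insert i (I'.map (Function.Embedding.subtype _)))) =
      boxSumGerm Λ' (π s) (fun j : {j // j ≠ i} => π (v j)) I' := by
  set I : Finset ι := insert i (I'.map (Function.Embedding.subtype _)) with hIdef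
  have hmem : ∀ j : {j // j ≠ i}, (j : ι) ∈ I ↔ j ∈ I' := by
    intro j
    simp [hIdef, j.2]
  have hiI : i ∈ I := by simp [hIdef]
  have hπi : π (v i) = 0 := (hker _).2 ⟨1, by simp⟩
  have hsum : ∀ d : ι → ℝ, ∑ j, d j • v j = d i • v i + ∑ j : {j // j ≠ i}, d j • v j := by
    intro d
    rw [← Finset.add_sum_erase _ _ (Finset.mem_univ i)]
    congr 1
    exact Finset.sum_subtype _ (fun j => by simp) _
  have hπsum : ∀ d : ι → ℝ, π (s + ∑ j, d j • v j) =
      π s + ∑ j : {j // j ≠ i}, d j • π (v j) := by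
    intro d
    rw [hsum, map_add, map_add, map_smul, hπi, smul_zero, zero_add, map_sum]
    simp
  rw [boxSumGerm_eq, boxSumGerm_eq, map_sum]
  refine Finset.sum_bij (fun x _ => π x) ?_ ?_ ?_ (fun x _ => pullbackHom_expGerm π x)
  · intro x hx
    obtain ⟨⟨t, h1, h2, rfl⟩, hxΛ⟩ := (mem_boxPoints Λ).1 hx
    refine (mem_boxPoints Λ').2 ⟨⟨fun j => t j, fun j hj => h1 j ((hmem j).2 hj),
      fun j hj => h2 j fun h => hj ((hmem j).1 h), hπsum t⟩, (hΛ' _).2 ⟨_, hxΛ, rfl⟩⟩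
  · intro x hx y hy hxy
    obtain ⟨⟨t, h1, h2, hxt⟩, hxΛ⟩ := (mem_boxPoints Λ).1 hx
    obtain ⟨⟨u, k1, k2, hyu⟩, hyΛ⟩ := (mem_boxPoints Λ).1 hy
    have hxy' : π x = π y := hxy
    obtain ⟨c, hc⟩ := (hker (x - y)).1 (by rw [map_sub, hxy', sub_self])
    obtain ⟨n, rfl⟩ := hprim c (hc ▸ Λ.sub_mem hxΛ hyΛ)
    have htu : t = u + Pi.single i (n : ℝ) := by
      refine coords_unique hI h2 (fun j hj => ?_) ?_
      · have : j ≠ i := fun h => hj (h ▸ hiI)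
        simp [k2 j hj, this]
      · rw [hxt, hyu, add_sub_add_left_eq_sub, sub_eq_iff_eq_add'] at hc
        rw [hc]
        simp [add_smul, Finset.sum_add_distrib, Pi.single_apply, ite_smul]
    have hti : t i = u i + n := by rw [htu]; simp
    have hn : n = 0 := by
      have a1 := h1 i hiI
      have a2 := k1 i hiI
      have b1 : (n : ℝ) < 1 := by linarith
      have b2 : (-1 : ℝ) < n := by linarith
      have c1 : n < 1 := by exact_mod_cast b1
      have c2 : -1 < n := by exact_mod_cast b2
      omega
    rw [hn] at hc
    simpa [sub_eq_zero] using hc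
  · intro y hy
    obtain ⟨⟨t', h1, h2, hyt⟩, hyΛ⟩ := (mem_boxPoints Λ').1 hy
    obtain ⟨x, hxΛ, hxy⟩ := (hΛ' y).1 hyΛ
    set t : ι → ℝ := fun j => if hj : j ≠ i then t' ⟨j, hj⟩ else 0 with ht
    obtain ⟨c, hc⟩ := (hker (x - (s + ∑ j, t j • v j))).1 (by
      rw [map_sub, hπsum, hxy, hyt, sub_eq_zero]
      congr 1
      exact Finset.sum_congr rfl fun j _ => by simp [ht, j.2])
    -- shift the coordinate along `v i` into `(0, 1]`
    obtain ⟨n, hc1, hc2⟩ : ∃ n : ℤ, (n : ℝ) < c ∧ c - n ≤ 1 := by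
      refine ⟨⌈c⌉ - 1, ?_, ?_⟩
      · have := Int.ceil_lt_add_one c
        push_cast; linarith
      · have := Int.le_ceil c
        push_cast; linarith
    have hx' : x - n • v i = s + ∑ j, (t + Pi.single i (c - n) : ι → ℝ) j • v j := by
      have e : ∑ j, (t + Pi.single i (c - n) : ι → ℝ) j • v j =
          ∑ j, t j • v j + (c - n) • v i := by
        simp [add_smul, Finset.sum_add_distrib, Pi.single_apply, ite_smul]
      rw [e, sub_smul, ← hc, Int.cast_smul_eq_zsmul]
      abel
    refine ⟨x - n • v i, (mem_boxPoints Λ).2 ⟨⟨_, fun j hj => ?_, fun j hj => ?_, hx'⟩,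
      Λ.sub_mem hxΛ (Λ.smul_mem n hvi)⟩, ?_⟩
    · rcases eq_or_ne j i with rfl | hji
      · have : (t + Pi.single j (c - n) : ι → ℝ) j = c - n := by simp [ht]
        rw [this]
        exact ⟨sub_pos.2 hc1, hc2⟩
      · simpa [ht, hji] using h1 ⟨j, hji⟩ ((hmem ⟨j, hji⟩).1 hj)
    · have hji : j ≠ i := fun h => hj (h ▸ hiI)
      simpa [ht, hji] using h2 ⟨j, hji⟩ fun h => hj ((hmem ⟨j, hji⟩).2 h)
    · simp [hπi, hxy]

end ExpSum

/-! ### Lebesgue measure in simplicial coordinates -/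

section BasisMeasure

open Module

/-- Haar measure normalized by a lattice `L`, in the coordinates of a basis of vectors of `L`:
the density is the index of the sublattice generated by the basis. -/
theorem inv_covolume_smul_eq {E κ : Type*} [NormedAddCommGroup E] [NormedSpace ℝ E]
    [FiniteDimensional ℝ E] [MeasurableSpace E] [BorelSpace E] [Fintype κ] (L : Submodule ℤ E)
    [DiscreteTopology L] [IsZLattice ℝ L] (μ : Measure E) [μ.IsAddHaarMeasure] (b : Basis κ ℝ E)
    (hb : ∀ i, b i ∈ L) :
    (Submodule.span ℤ (Set.range b)).toAddSubgroup.relIndex L.toAddSubgroup ≠ 0 ∧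
    (ENNReal.ofReal (ZLattice.covolume L μ))⁻¹ • μ =
      ((Submodule.span ℤ (Set.range b)).toAddSubgroup.relIndex L.toAddSubgroup : ENNReal) •
        (volume : Measure (κ → ℝ)).map b.equivFunL.symm := by
  set f : (κ → ℝ) ≃L[ℝ] E := b.equivFunL.symm with hf
  set M := Submodule.span ℤ (Set.range b) with hM
  set ν := (volume : Measure (κ → ℝ)).map f with hν
  have : ν.IsAddHaarMeasure := f.isAddHaarMeasure_map volume
  have : DiscreteTopology M := inferInstanceAs (DiscreteTopology (Submodule.span ℤ (Set.range b)))
  have : IsZLattice ℝ M := inferInstanceAs (IsZLattice ℝ (Submodule.span ℤ (Set.range b)))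
  have hfp : MeasurePreserving f volume ν := ⟨f.continuous.measurable, rfl⟩
  have hML : M ≤ L := by
    rw [hM, Submodule.span_le]
    rintro _ ⟨i, rfl⟩
    exact hb i
  have hνM : ZLattice.covolume M ν = 1 := by
    rw [ZLattice.covolume_eq_measure_fundamentalDomain M ν (ZSpan.isAddFundamentalDomain b ν)]
    rw [← hfp.measureReal_preimage
      (ZSpan.fundamentalDomain_measurableSet b).nullMeasurableSet]
    have : f ⁻¹' ZSpan.fundamentalDomain b = Set.univ.pi fun _ => Set.Ico (0 : ℝ) 1 := by
      ext t
      have : ∀ i, b.repr (f t) i = t i := fun i => congrFun (b.equivFun.apply_symm_apply t) i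
      simp [ZSpan.mem_fundamentalDomain, this, Set.mem_pi]
    rw [this, Measure.real, volume_pi_pi]
    simp
  have hidx : (M.toAddSubgroup.relIndex L.toAddSubgroup : ℝ) = (ZLattice.covolume L ν)⁻¹ := by
    rw [← one_div, ← hνM, ← ZLattice.covolume_comap L ν volume hfp,
      ← ZLattice.covolume_comap M ν volume hfp,
      ZLattice.covolume_div_covolume_eq_relIndex _ _ (fun _ h' => hML h'),
      ZLattice.comap_toAddSubgroup, ZLattice.comap_toAddSubgroup, Nat.cast_inj,
      LinearEquiv.toAddMonoidHom_commutes, AddSubgroup.comap_equiv_eq_map_symm',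
      AddSubgroup.comap_equiv_eq_map_symm',
      AddSubgroup.relIndex_map_map_of_injective _ _ f.symm.injective]
  have hνL := ZLattice.covolume_pos L ν
  set N := M.toAddSubgroup.relIndex L.toAddSubgroup
  have hN : (0 : ℝ) < N := by rw [hidx]; positivity
  refine ⟨by exact_mod_cast hN.ne', ?_⟩
  set c := μ.addHaarScalarFactor ν with hc
  have hμν : μ = c • ν := Measure.isAddLeftInvariant_eq_smul μ ν
  have hcov : ZLattice.covolume L μ = c * ZLattice.covolume L ν := by
    rw [ZLattice.covolume_eq_measure_fundamentalDomain L μ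
        (ZLattice.isAddFundamentalDomain (Free.chooseBasis ℤ L) μ),
      ZLattice.covolume_eq_measure_fundamentalDomain L ν
        (ZLattice.isAddFundamentalDomain (Free.chooseBasis ℤ L) ν)]
    conv_lhs => rw [hμν]
    simp [Measure.real]
  have hμL := ZLattice.covolume_pos L μ
  have hc0 : (0 : ℝ) < c := by
    rw [hcov] at hμL
    exact pos_of_mul_pos_left hμL hνL.le
  have h1 : ZLattice.covolume L μ = c / N := by
    rw [hcov, hidx]; simp [div_eq_mul_inv]
  rw [h1]
  conv_lhs => rw [hμν]
  have e1 : (ENNReal.ofReal ((c : ℝ) / N))⁻¹ * (c : ENNReal) = N := by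
    rw [← ENNReal.ofReal_inv_of_pos (by positivity), ← ENNReal.ofReal_coe_nnreal,
      ← ENNReal.ofReal_mul (by positivity), inv_div, div_mul_cancel₀ _ hc0.ne',
      ENNReal.ofReal_natCast]
  have e2 : (c • ν : Measure E) = (c : ENNReal) • ν := rfl
  rw [e2, smul_smul, e1]

end BasisMeasure

section RelMeasure

variable {W : Type*} [NormedAddCommGroup W] [NormedSpace ℝ W] {ι : Type*}

/-- The index of the lattice generated by `v i`, `i ∈ I`, in all lattice points of its span. -/
noncomputable def latticeIndex (Λ : Submodule ℤ W) (v : ι → W) (I : Finset ι) : ℕ :=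
  (Submodule.span ℤ (v '' I)).toAddSubgroup.relIndex
    (Λ.toAddSubgroup ⊓ (Submodule.span ℝ (v '' I)).toAddSubgroup)

/-- Simplicial coordinates on the affine space `s + ∑_{i ∈ I} ℝ v i`. -/
def simplexParam (s : W) (v : ι → W) (I : Finset ι) (t : I → ℝ) : W := s + ∑ i, t i • v i

theorem vectorSpan_cone [Fintype ι] (s : W) (v : ι → W) :
    vectorSpan ℝ ((fun y => s + y) '' cone v) = Submodule.span ℝ (Set.range v) := by
  classical
  refine le_antisymm ?_ ?_
  · rw [vectorSpan_def, Submodule.span_le]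
    rintro _ ⟨_, ⟨_, ⟨t, _, rfl⟩, rfl⟩, _, ⟨_, ⟨u, _, rfl⟩, rfl⟩, rfl⟩
    have : (s + ∑ i, t i • v i) -ᵥ (s + ∑ i, u i • v i) = ∑ i, t i • v i - ∑ i, u i • v i := by
      simp
    simp only [SetLike.mem_coe]
    rw [this]
    exact Submodule.sub_mem _
      (Submodule.sum_mem _ fun i _ => Submodule.smul_mem _ _ (Submodule.subset_span ⟨i, rfl⟩))
      (Submodule.sum_mem _ fun i _ => Submodule.smul_mem _ _ (Submodule.subset_span ⟨i, rfl⟩))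
  · rw [Submodule.span_le]
    rintro _ ⟨i, rfl⟩
    have h1 : s + v i ∈ (fun y => s + y) '' cone v :=
      ⟨v i, ⟨Pi.single i 1, fun j => by
        rcases eq_or_ne j i with rfl | h <;> simp [*], by
        simp [Pi.single_apply, ite_smul]⟩, rfl⟩
    have h2 : s ∈ (fun y => s + y) '' cone v := ⟨0, ⟨0, fun _ => le_rfl, by simp⟩, by simp⟩
    simpa using vsub_mem_vectorSpan ℝ h1 h2

variable [FiniteDimensional ℝ W]

theorem relMeasure_eq_map (Λ : Submodule ℤ W) {p : Set W} (hp : p.Nonempty) {U : Submodule ℝ W}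
    (hU : vectorSpan ℝ p = U) :
    relMeasure Λ p = @Measure.map U W (borel U) (borel W)
      (fun u : U => hp.some + (u : W)) (subMeasure Λ U) := by
  subst hU
  simp only [relMeasure, dif_pos hp]

/-- The relative Lebesgue measure in simplicial coordinates. -/
theorem relMeasure_eq (Λ : Submodule ℤ W) [DiscreteTopology Λ]
    {p : Set W} {s : W} (hs : s ∈ p) {v : ι → W} (hvΛ : ∀ i, v i ∈ Λ) {I : Finset ι}
    (hI : LinearIndependent ℝ (fun i : I => v i))
    (hspan : Submodule.span ℝ (v '' I) = vectorSpan ℝ p) :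
    latticeIndex Λ v I ≠ 0 ∧
    relMeasure Λ p = @Measure.map (I → ℝ) W _ (borel W) (simplexParam s v I)
      ((latticeIndex Λ v I : ENNReal) • volume) := by
  let _ : MeasurableSpace W := borel W
  have : BorelSpace W := ⟨rfl⟩
  set U := Submodule.span ℝ (v '' I) with hU
  have hp : p.Nonempty := ⟨s, hs⟩
  rw [relMeasure_eq_map Λ hp hspan.symm]
  let _ : MeasurableSpace U := borel U
  have : BorelSpace U := ⟨rfl⟩
  have hrange : Set.range (fun i : I => v i) = v '' I := by
    rw [Set.image_eq_range]; rfl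
  set b : Module.Basis I ℝ U :=
    (Module.Basis.span hI).map (LinearEquiv.ofEq _ _ (by rw [hrange])) with hb
  have hbv : ∀ i, (b i : W) = v i := fun i => by
    simp [hb, Module.Basis.span_apply]
  have hbL : ∀ i, b i ∈ subLattice Λ U := fun i => by
    have : (b i : W) ∈ Λ := hbv i ▸ hvΛ i
    exact this
  have : DiscreteTopology (subLattice Λ U) :=
    ZLattice.comap_discreteTopology ℝ Λ (e := U.subtype) continuous_subtype_val
      Subtype.val_injective
  have : IsZLattice ℝ (subLattice Λ U) := ⟨by
    rw [eq_top_iff, ← b.span_eq]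
    exact Submodule.span_mono (by rintro _ ⟨i, rfl⟩; exact hbL i)⟩
  obtain ⟨h0, h1⟩ := inv_covolume_smul_eq (subLattice Λ U) Measure.addHaar b hbL
  have hidx : (Submodule.span ℤ (Set.range b)).toAddSubgroup.relIndex
      (subLattice Λ U).toAddSubgroup = latticeIndex Λ v I := by
    rw [latticeIndex, ← AddSubgroup.relIndex_map_map_of_injective (f := U.subtype.toAddMonoidHom)
      _ _ Subtype.val_injective]
    congr 1
    · have : (Submodule.span ℤ (Set.range b)).map (U.subtype.restrictScalars ℤ) =
          Submodule.span ℤ (v '' I) := by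
        rw [Submodule.map_span, ← Set.range_comp, ← hrange]
        congr 2
        funext i
        exact hbv i
      rw [← this]
      rfl
    · ext x
      constructor
      · rintro ⟨y, hy, rfl⟩
        exact ⟨hy, y.2⟩
      · rintro ⟨h2, h3⟩
        exact ⟨⟨x, h3⟩, h2, rfl⟩
  rw [hidx] at h0 h1
  refine ⟨h0, ?_⟩
  have hsub : subMeasure Λ U = (latticeIndex Λ v I : ENNReal) •
      (volume : Measure (I → ℝ)).map b.equivFunL.symm := h1
  rw [hsub, ← Measure.map_smul]
  have hm1 : Measurable (fun u : U => hp.some + (u : W)) :=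
    (continuous_const.add continuous_subtype_val).measurable
  have hm2 : Measurable (b.equivFunL.symm : (I → ℝ) → U) := b.equivFunL.symm.continuous.measurable
  rw [Measure.map_map hm1 hm2]
  -- the base points `hp.some` and `s` differ by a translation in coordinates
  obtain ⟨t₀, ht₀⟩ : ∃ t₀ : I → ℝ, (b.equivFunL.symm t₀ : W) = hp.some - s := by
    have : hp.some - s ∈ U := by
      rw [hspan]
      exact vsub_mem_vectorSpan ℝ hp.some_mem hs
    exact ⟨b.equivFunL ⟨_, this⟩, by simp⟩
  have hcoe : ∀ t : I → ℝ, (b.equivFunL.symm t : W) = ∑ i, t i • v i := by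
    intro t
    have : b.equivFunL.symm t = ∑ i, t i • b i := b.equivFun_symm_apply t
    rw [this]
    simp [hbv]
  have hcomp : ((fun u : U => hp.some + (u : W)) ∘ b.equivFunL.symm) =
      simplexParam s v I ∘ fun t => t + t₀ := by
    funext t
    simp only [Function.comp, simplexParam, ← hcoe, map_add, Submodule.coe_add, ht₀]
    abel
  have hm3 : Measurable (simplexParam s v I) := by
    refine Continuous.measurable ?_
    unfold simplexParam
    fun_prop
  rw [hcomp, ← Measure.map_map hm3 (measurable_add_const t₀), Measure.map_smul,
    (measurePreserving_add_right volume t₀).map_eq]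

end RelMeasure

/-! ### The exponential integral of a pointed affine cone -/

section Param

variable {W : Type*} [NormedAddCommGroup W] [NormedSpace ℝ W] {ι : Type*} [Fintype ι]

theorem sum_extend_zero (v : ι → W) (I : Finset ι) {t : ι → ℝ} (h : ∀ i ∉ I, t i = 0) :
    ∑ i, t i • v i = ∑ i : I, t i • v i := by
  rw [Finset.sum_coe_sort I (fun i => t i • v i)]
  exact (Finset.sum_subset (Finset.subset_univ I) fun j _ hj => by simp [h j hj]).symm

theorem injective_sum {v : ι → W} {I : Finset ι} (hI : LinearIndependent ℝ (fun i : I => v i))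
    {t u : I → ℝ} (h : ∑ i, t i • v i = ∑ i, u i • v i) : t = u := by
  rw [Fintype.linearIndependent_iff] at hI
  funext i
  refine sub_eq_zero.1 (hI (t - u) ?_ i)
  simp only [Pi.sub_apply, sub_smul, Finset.sum_sub_distrib, h, sub_self]

theorem simplexParam_mem_openCone {s : W} {v : ι → W} {I : Finset ι}
    (hI : LinearIndependent ℝ (fun i : I => v i)) (t : I → ℝ) :
    simplexParam s v I t ∈ openCone s v I ↔ ∀ i, t i ∈ Set.Ioi (0 : ℝ) := by
  classical
  constructor
  · rintro ⟨u, h1, h2, h3⟩ i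
    rw [sum_extend_zero v I h2] at h3
    have := injective_sum hI (add_left_cancel h3)
    rw [this]
    exact h1 i i.2
  · intro h
    refine ⟨fun i => if hi : i ∈ I then t ⟨i, hi⟩ else 0, fun i hi => by simpa [hi] using h ⟨i, hi⟩,
      fun i hi => by simp [hi], ?_⟩
    rw [sum_extend_zero v I fun i hi => by simp [hi]]
    simp [simplexParam]

theorem simplexParam_mem_box {s : W} {v : ι → W} {I : Finset ι}
    (hI : LinearIndependent ℝ (fun i : I => v i)) (t : I → ℝ) :
    simplexParam s v I t ∈ box s v I ↔ ∀ i, t i ∈ Set.Ioc (0 : ℝ) 1 := by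
  classical
  constructor
  · rintro ⟨u, h1, h2, h3⟩ i
    rw [sum_extend_zero v I h2] at h3
    have := injective_sum hI (add_left_cancel h3)
    rw [this]
    exact h1 i i.2
  · intro h
    refine ⟨fun i => if hi : i ∈ I then t ⟨i, hi⟩ else 0, fun i hi => by simpa [hi] using h ⟨i, hi⟩,
      fun i hi => by simp [hi], ?_⟩
    rw [sum_extend_zero v I fun i hi => by simp [hi]]
    simp [simplexParam]

theorem openCone_subset_range (s : W) (v : ι → W) (I : Finset ι) :
    openCone s v I ⊆ Set.range (simplexParam s v I) := by
  rintro _ ⟨t, _, h2, rfl⟩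
  exact ⟨fun i => t i, by rw [simplexParam, sum_extend_zero v I h2]⟩

/-- In simplicial coordinates the exponential is a product. -/
theorem indicator_simplexParam {P : Set W} {A : Set ℝ} {s : W} {v : ι → W} {I : Finset ι}
    (h : ∀ t, simplexParam s v I t ∈ P ↔ ∀ i, t i ∈ A) (ξ : StrongDual ℝ W) (t : I → ℝ) :
    Set.indicator P (fun x => Real.exp (ξ x)) (simplexParam s v I t) =
      Real.exp (ξ s) * ∏ i : I, Set.indicator A (fun r => Real.exp (ξ (v i) * r)) (t i) := by
  classical
  by_cases ht : ∀ i, t i ∈ A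
  · rw [Set.indicator_of_mem ((h t).2 ht)]
    rw [Finset.prod_congr rfl fun i _ => Set.indicator_of_mem (ht i) _, ← Real.exp_sum,
      ← Real.exp_add]
    simp [simplexParam, mul_comm]
  · rw [Set.indicator_of_notMem fun h' => ht ((h t).1 h')]
    push Not at ht
    obtain ⟨i, hi⟩ := ht
    rw [Finset.prod_eq_zero (Finset.mem_univ i) (Set.indicator_of_notMem hi _), mul_zero]

theorem integral_Ioc_exp (c : ℝ) :
    ∫ r, Set.indicator (Set.Ioc (0 : ℝ) 1) (fun r => Real.exp (c * r)) r = expQuot c := by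
  rw [integral_indicator measurableSet_Ioc, ← intervalIntegral.integral_of_le zero_le_one]
  by_cases hc : c = 0
  · simp [hc, expQuot_zero]
  · rw [intervalIntegral.integral_comp_mul_left (fun x => Real.exp x) hc, integral_exp]
    simp [expQuot, hc, div_eq_inv_mul]

/-- The integral over a box is a product of the integrals over the sides. -/
theorem integral_box (ξ : StrongDual ℝ W) {s : W} {v : ι → W} {I : Finset ι}
    (hI : LinearIndependent ℝ (fun i : I => v i)) :
    ∫ t, Set.indicator (box s v I) (fun x => Real.exp (ξ x)) (simplexParam s v I t) =
      Real.exp (ξ s) * ∏ i ∈ I, expQuot (ξ (v i)) := by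
  simp only [indicator_simplexParam (simplexParam_mem_box hI) ξ]
  rw [integral_const_mul, integral_fintype_prod_volume_eq_prod
    (fun (i : I) (r : ℝ) => Set.indicator (Set.Ioc (0 : ℝ) 1) (fun r => Real.exp (ξ (v i) * r)) r)]
  simp only [integral_Ioc_exp]
  rw [Finset.prod_coe_sort I fun i => expQuot (ξ (v i))]

theorem integrable_openCone_param {ξ : StrongDual ℝ W} {s : W} {v : ι → W} {I : Finset ι}
    (hI : LinearIndependent ℝ (fun i : I => v i)) (hξ : ∀ i, ξ (v i) < 0) :
    Integrable fun t =>
      Set.indicator (openCone s v I) (fun x => Real.exp (ξ x)) (simplexParam s v I t) := by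
  simp only [indicator_simplexParam (simplexParam_mem_openCone hI) ξ]
  refine Integrable.const_mul ?_ _
  refine Integrable.fintype_prod (μ := fun _ => volume)
    (f := fun (i : I) (r : ℝ) => Set.indicator (Set.Ioi (0 : ℝ)) (fun r => Real.exp (ξ (v i) * r)) r)
    fun i => ?_
  rw [integrable_indicator_iff measurableSet_Ioi]
  exact integrableOn_exp_mul_Ioi (hξ i) 0

theorem measurableEmbedding_simplexParam [FiniteDimensional ℝ W] [MeasurableSpace W]
    [BorelSpace W] (s : W) {v : ι → W} {I : Finset ι}
    (hI : LinearIndependent ℝ (fun i : I => v i)) :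
    MeasurableEmbedding (simplexParam s v I) := by
  have h1 : IsClosedEmbedding (Fintype.linearCombination ℝ (fun i : I => v i)) := by
    refine LinearMap.isClosedEmbedding_of_injective (LinearMap.ker_eq_bot.2 fun t u h => ?_)
    rw [Fintype.linearCombination_apply, Fintype.linearCombination_apply] at h
    exact injective_sum hI h
  have h2 := (Homeomorph.addLeft s).isClosedEmbedding.comp h1
  have h3 : (Homeomorph.addLeft s) ∘ (Fintype.linearCombination ℝ (fun i : I => v i)) =
      simplexParam s v I := by
    funext t
    simp [simplexParam, Fintype.linearCombination_apply]
  rw [← h3]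
  exact h2.measurableEmbedding

theorem measurableSet_openCone [FiniteDimensional ℝ W] [MeasurableSpace W]
    [BorelSpace W] (s : W) {v : ι → W} {I : Finset ι}
    (hI : LinearIndependent ℝ (fun i : I => v i)) : MeasurableSet (openCone s v I) := by
  have : openCone s v I = simplexParam s v I '' {t | ∀ i, t i ∈ Set.Ioi (0 : ℝ)} := by
    ext x
    constructor
    · intro hx
      obtain ⟨t, rfl⟩ := openCone_subset_range s v I hx
      exact ⟨t, (simplexParam_mem_openCone hI t).1 hx, rfl⟩
    · rintro ⟨t, ht, rfl⟩
      exact (simplexParam_mem_openCone hI t).2 ht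
  rw [this, (measurableEmbedding_simplexParam s hI).measurableSet_image]
  have h2 : {t : I → ℝ | ∀ i, t i ∈ Set.Ioi (0 : ℝ)} = Set.univ.pi fun _ => Set.Ioi (0 : ℝ) := by
    ext; simp
  rw [h2]
  exact MeasurableSet.univ_pi fun _ => measurableSet_Ioi

theorem exists_spanning_simplex (v : ι → W) : ∃ I : Finset ι,
    LinearIndependent ℝ (fun i : I => v i) ∧
      Submodule.span ℝ (v '' I) = Submodule.span ℝ (Set.range v) := by
  classical
  obtain ⟨b, -, -, h1, h2⟩ := exists_linearIndepOn_extension (K := ℝ) (v := v)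
    (linearIndepOn_empty ℝ v) (Set.empty_subset Set.univ)
  refine ⟨b.toFinset, ?_, le_antisymm (Submodule.span_mono (Set.image_subset_range _ _)) ?_⟩
  · have : LinearIndepOn ℝ v (b.toFinset : Set ι) := by simpa using h2
    exact this
  · rw [Submodule.span_le, ← Set.image_univ]
    simpa using h1

end Param

section ExpIntegral

variable {W : Type*} [NormedAddCommGroup W] [NormedSpace ℝ W] {ι : Type*} [Fintype ι]

open Classical in
/-- The simplices of full dimension of the triangulation of the cone generated by `v`. -/
noncomputable def topSimplices (r : ι → ℕ) (v : ι → W) : Finset (Finset ι) :=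
  (simplices r v).filter fun I => Submodule.span ℝ (v '' I) = Submodule.span ℝ (Set.range v)

theorem mem_topSimplices {r : ι → ℕ} {v : ι → W} {I : Finset ι} :
    I ∈ topSimplices r v ↔
      LexAdm r v I ∧ Submodule.span ℝ (v '' I) = Submodule.span ℝ (Set.range v) := by
  classical
  simp [topSimplices, mem_simplices]

/-- The exponential integral over a box, with respect to Lebesgue measure normalized by `Λ`. -/
noncomputable def boxIntegral (Λ : Submodule ℤ W) (s : W) (v : ι → W) (I : Finset ι) :
    StrongDual ℝ W → ℝ :=
  (fun _ => (latticeIndex Λ v I : ℝ)) * (fun ξ => Real.exp (ξ s)) *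
    ∏ i ∈ I, fun ξ => expQuot (ξ (v i))

variable [FiniteDimensional ℝ W] (Λ : Submodule ℤ W)

theorem ratAnalytic_boxIntegral {s : W} (hs : IsRationalPoint Λ s) {v : ι → W}
    (hvΛ : ∀ i, v i ∈ Λ) (I : Finset ι) : RatAnalytic Λ (boxIntegral Λ s v I) := by
  have h1 := RatAnalytic.const (Λ := Λ) (latticeIndex Λ v I : ℚ)
  simp only [Rat.cast_natCast] at h1
  exact (h1.mul (RatAnalytic.exp hs)).mul
    (RatAnalytic.prod _ fun i _ => RatAnalytic.expQuot (isRationalPoint_of_mem (hvΛ i)))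

theorem isEntire_boxIntegral (s : W) (v : ι → W) (I : Finset ι) :
    IsEntire (boxIntegral Λ s v I) :=
  ((IsEntire.const _).mul (IsEntire.exp s)).mul (IsEntire.prod _ fun i _ => IsEntire.expQuot (v i))

/-- The germ of the exponential integral over a box. -/
noncomputable def boxIntegralGerm (s : W) (v : ι → W) (I : Finset ι) :
    AnalyticGerm (StrongDual ℝ W) :=
  (latticeIndex Λ v I : AnalyticGerm (StrongDual ℝ W)) * expGerm s * ∏ i ∈ I, expQuotGerm (v i)

theorem boxIntegralGerm_eq {s : W} {v : ι → W} {I : Finset ι}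
    (h : AnalyticAt ℝ (boxIntegral Λ s v I) 0) :
    boxIntegralGerm Λ s v I = AnalyticGerm.mk (boxIntegral Λ s v I) h := by
  have h1 : ∀ n : ℕ, (n : AnalyticGerm (StrongDual ℝ W)) =
      AnalyticGerm.mk (fun _ => (n : ℝ)) analyticAt_const := by
    intro n
    apply Subtype.ext
    simp [AnalyticGerm.mk]
  simp only [boxIntegralGerm, expGerm, expQuotGerm]
  rw [coe_prod_mk, h1, AnalyticGerm.mk_mul, AnalyticGerm.mk_mul]
  rfl

variable [DiscreteTopology Λ] {s : W} {v : ι → W} {l : StrongDual ℝ W} {r : ι → ℕ}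

/-- Integration over a cone in the coordinates of a maximal linearly independent set of generators. -/
theorem integral_relMeasure_cone {I : Finset ι} (hvΛ : ∀ i, v i ∈ Λ)
    (hI : LinearIndependent ℝ (fun i : I => v i))
    (hspan : Submodule.span ℝ (v '' I) = Submodule.span ℝ (Set.range v)) (f : W → ℝ) :
    letI : MeasurableSpace W := borel W
    (Integrable f (relMeasure Λ ((fun y => s + y) '' cone v)) ↔
      Integrable fun t => f (simplexParam s v I t)) ∧
    ∫ x, f x ∂(relMeasure Λ ((fun y => s + y) '' cone v)) =
      latticeIndex Λ v I * ∫ t, f (simplexParam s v I t) := by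
  let _ : MeasurableSpace W := borel W
  have : BorelSpace W := ⟨rfl⟩
  have hs : s ∈ (fun y => s + y) '' cone v := ⟨0, ⟨0, fun _ => le_rfl, by simp⟩, by simp⟩
  obtain ⟨h0, h1⟩ := relMeasure_eq Λ hs hvΛ hI (hspan.trans (vectorSpan_cone s v).symm)
  have hme := measurableEmbedding_simplexParam s hI
  refine ⟨?_, ?_⟩
  · rw [h1, hme.integrable_map_iff, integrable_smul_measure (by simpa using h0) (by simp)]
    rfl
  · rw [h1, hme.integral_map, integral_smul_measure]
    simp

theorem relMeasure_openCone_eq_zero {J : Finset ι} (hvΛ : ∀ i, v i ∈ Λ)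
    (hspan : Submodule.span ℝ (v '' J) ≠ Submodule.span ℝ (Set.range v)) :
    relMeasure Λ ((fun y => s + y) '' cone v) (openCone s v J) = 0 := by
  let _ : MeasurableSpace W := borel W
  have : BorelSpace W := ⟨rfl⟩
  obtain ⟨I, hI, hIspan⟩ := exists_spanning_simplex v
  have hs : s ∈ (fun y => s + y) '' cone v := ⟨0, ⟨0, fun _ => le_rfl, by simp⟩, by simp⟩
  obtain ⟨h0, h1⟩ := relMeasure_eq Λ hs hvΛ hI (hIspan.trans (vectorSpan_cone s v).symm)
  have hme := measurableEmbedding_simplexParam s hI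
  rw [h1, hme.map_apply, Measure.smul_apply, smul_eq_mul, mul_eq_zero]
  right
  set S := (Submodule.span ℝ (v '' J)).comap (Fintype.linearCombination ℝ (fun i : I => v i))
    with hS
  refine measure_mono_null (fun t ht => ?_) (Measure.addHaar_submodule volume S fun htop => ?_)
  · obtain ⟨u, _, h2, h3⟩ := ht
    rw [sum_extend_zero v J h2] at h3
    have : ∑ i, t i • v i = ∑ i : J, u i • v i := add_left_cancel h3
    simp only [hS, SetLike.mem_coe, Submodule.mem_comap, Fintype.linearCombination_apply]
    rw [this]
    exact Submodule.sum_mem _ fun i _ => Submodule.smul_mem _ _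
      (Submodule.subset_span ⟨i, i.2, rfl⟩)
  · classical
    refine hspan (le_antisymm (Submodule.span_mono (Set.image_subset_range _ _)) ?_)
    rw [← hIspan, Submodule.span_le]
    rintro _ ⟨i, hi, rfl⟩
    have : (Pi.single ⟨i, hi⟩ 1 : I → ℝ) ∈ S := htop ▸ Submodule.mem_top
    simpa [hS, Fintype.linearCombination_apply, Pi.single_apply, ite_smul] using this

theorem integrable_openCone (hvΛ : ∀ i, v i ∈ Λ) {I : Finset ι} (hI : LexAdm r v I)
    {ξ : StrongDual ℝ W} (hξ : ∀ i, ξ (v i) < 0) :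
    letI : MeasurableSpace W := borel W
    Integrable (Set.indicator (openCone s v I) fun x => Real.exp (ξ x))
      (relMeasure Λ ((fun y => s + y) '' cone v)) := by
  let _ : MeasurableSpace W := borel W
  have : BorelSpace W := ⟨rfl⟩
  by_cases hspan : Submodule.span ℝ (v '' I) = Submodule.span ℝ (Set.range v)
  · exact (integral_relMeasure_cone Λ hvΛ hI.linearIndependent hspan _).1.2
      (integrable_openCone_param hI.linearIndependent hξ)
  · rw [integrable_indicator_iff (measurableSet_openCone s hI.linearIndependent)]
    have h0 := relMeasure_openCone_eq_zero (s := s) Λ hvΛ hspan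
    rw [IntegrableOn, Measure.restrict_eq_zero.2 h0]
    exact integrable_zero_measure

theorem measurableSet_cone (hl : ∀ i, l (v i) < 0) :
    MeasurableSet[borel W] ((fun y => s + y) '' cone v) := by
  let _ : MeasurableSpace W := borel W
  have : BorelSpace W := ⟨rfl⟩
  obtain ⟨e, -⟩ : ∃ e : ι ≃ Fin (Fintype.card ι), True := ⟨Fintype.equivFin ι, trivial⟩
  set r : ι → ℕ := fun i => e i with hr
  have hinj : Function.Injective r := Fin.val_injective.comp e.injective
  have : ((fun y => s + y) '' cone v) = ⋃ I ∈ simplices r v, openCone s v I := by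
    ext x
    simp only [Set.mem_iUnion, exists_prop]
    constructor
    · intro hx
      obtain ⟨I, hI, hxI⟩ := exists_mem_openCone hinj hl hx
      exact ⟨I, mem_simplices.2 hI, hxI⟩
    · rintro ⟨I, _, hxI⟩
      exact openCone_subset s v I hxI
  rw [this]
  exact Finset.measurableSet_biUnion _ fun I hI =>
    measurableSet_openCone s (mem_simplices.1 hI).linearIndependent

theorem integrableOn_cone (hvΛ : ∀ i, v i ∈ Λ) {ξ : StrongDual ℝ W} (hξ : ∀ i, ξ (v i) < 0) :
    letI : MeasurableSpace W := borel W
    IntegrableOn (fun x : W => Real.exp (ξ x)) ((fun y => s + y) '' cone v)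
      (relMeasure Λ ((fun y => s + y) '' cone v)) := by
  let _ : MeasurableSpace W := borel W
  have : BorelSpace W := ⟨rfl⟩
  obtain ⟨e, -⟩ : ∃ e : ι ≃ Fin (Fintype.card ι), True := ⟨Fintype.equivFin ι, trivial⟩
  set r : ι → ℕ := fun i => e i with hr
  have hinj : Function.Injective r := Fin.val_injective.comp e.injective
  rw [← integrable_indicator_iff (measurableSet_cone hξ)]
  have : Set.indicator ((fun y => s + y) '' cone v) (fun x : W => Real.exp (ξ x)) =
      fun x => ∑ I ∈ simplices r v, Set.indicator (openCone s v I) (fun x => Real.exp (ξ x)) x :=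
    funext fun x => indicator_eq_sum hinj s hξ _ x
  rw [this]
  exact integrable_finsetSum _ fun I hI => integrable_openCone Λ hvΛ (mem_simplices.1 hI) hξ

/-- The exponential integral of a pointed affine cone: each simplex `I` of full dimension contributes
the integral over its box, divided by `∏_{i ∈ I} (1 - e^⟨ξ,v i⟩)`. The other simplices are null sets. -/
theorem isExpIntegral_cone (hr : Function.Injective r) (hs : IsRationalPoint Λ s)
    (hvΛ : ∀ i, v i ∈ Λ) (hl : ∀ i, l (v i) < 0) :
    IsExpIntegral Λ ((fun y => s + y) '' cone v)
      (fracSum (fun i => 1 - expGerm (v i)) (topSimplices r v) (boxIntegralGerm Λ s v)) := by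
  let _ : MeasurableSpace W := borel W
  have : BorelSpace W := ⟨rfl⟩
  refine ⟨fun h => absurd h (not_containsLine s hl), fun _ => ?_⟩
  have hv : ∀ i, v i ≠ 0 := fun i h => by
    have := hl i
    rw [h, map_zero] at this
    exact lt_irrefl _ this
  obtain ⟨g, h, hq, hgh⟩ := isRationalQuotient_fracSum hv hvΛ (topSimplices r v)
    (boxIntegral Λ s v) (fun I => isEntire_boxIntegral Λ s v I)
    (fun I => ratAnalytic_boxIntegral Λ hs hvΛ I)
  have hgerm : boxIntegralGerm Λ s v = fun I => AnalyticGerm.mk (boxIntegral Λ s v I)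
      (ratAnalytic_boxIntegral Λ hs hvΛ I).1 := funext fun I => boxIntegralGerm_eq Λ _
  rw [← hgerm] at hq
  refine ⟨g, h, hq, fun ξ hint => ?_⟩
  set ν := relMeasure Λ ((fun y => s + y) '' cone v) with hν
  have hpart : ∀ I ∈ simplices r v,
      Integrable (Set.indicator (openCone s v I) fun x => Real.exp (ξ x)) ν := by
    intro I hI
    rw [integrable_indicator_iff
      (measurableSet_openCone s (mem_simplices.1 hI).linearIndependent)]
    exact hint.mono_set (openCone_subset s v I)
  have htot : ∫ x in (fun y => s + y) '' cone v, Real.exp (ξ x) ∂ν =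
      ∑ I ∈ topSimplices r v,
        ∫ x, Set.indicator (openCone s v I) (fun x => Real.exp (ξ x)) x ∂ν := by
    have hsub : topSimplices r v ⊆ simplices r v := Finset.filter_subset _ _
    rw [← integral_indicator (measurableSet_cone hl), Finset.sum_subset hsub,
      ← integral_finsetSum _ hpart]
    · exact integral_congr_ae (Eventually.of_forall fun x => indicator_eq_sum hr s hl _ x)
    · intro I hI hI'
      have hspan : Submodule.span ℝ (v '' I) ≠ Submodule.span ℝ (Set.range v) :=
        fun h0 => hI' (mem_topSimplices.2 ⟨mem_simplices.1 hI, h0⟩)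
      rw [integral_indicator (measurableSet_openCone s (mem_simplices.1 hI).linearIndependent),
        Measure.restrict_eq_zero.2 (relMeasure_openCone_eq_zero (s := s) Λ hvΛ hspan),
        integral_zero_measure]
  rw [htot]
  refine hgh ξ _ fun I hI => ?_
  obtain ⟨hI1, hI2⟩ := mem_topSimplices.1 hI
  have hLI := hI1.linearIndependent
  rw [(integral_relMeasure_cone Λ hvΛ hLI hI2 _).2]
  have key := telescope
    (fun f : W → ℝ => Integrable (fun t => f (simplexParam s v I t)) volume)
    (fun f => ∫ t, f (simplexParam s v I t))
    (fun f g hf hg => ⟨hf.sub hg, integral_sub hf hg⟩)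
    (fun a f hf => ⟨show Integrable (fun t => a * f (simplexParam s v I t)) volume from
        Integrable.const_mul hf a,
      integral_const_mul a fun t => f (simplexParam s v I t)⟩) s v I hLI ?_ ξ
    ((integral_relMeasure_cone Λ hvΛ hLI hI2 _).1.1 (hpart I (mem_simplices.2 hI1)))
  · rw [mul_left_comm, key, integral_box ξ hLI]
    simp [boxIntegral, mul_assoc]
  · intro i hi f hf
    classical
    have e : (fun t => f (simplexParam s v I t - v i)) =
        fun t => f (simplexParam s v I (t - Pi.single ⟨i, hi⟩ 1)) := by
      funext t
      congr 1
      simp [simplexParam, sub_smul, Finset.sum_sub_distrib, Pi.single_apply, ite_smul,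
        add_sub_assoc]
    rw [e]
    exact ⟨hf.comp_sub_right (Pi.single ⟨i, hi⟩ 1),
      integral_sub_right_eq_self (fun t => f (simplexParam s v I t)) (Pi.single ⟨i, hi⟩ 1)⟩

theorem IsExpIntegral.unique (hvΛ : ∀ i, v i ∈ Λ) (hl : ∀ i, l (v i) < 0)
    {m m' : MeromorphicGerm (StrongDual ℝ W)}
    (h : IsExpIntegral Λ ((fun y => s + y) '' cone v) m)
    (h' : IsExpIntegral Λ ((fun y => s + y) '' cone v) m') : m = m' := by
  let _ : MeasurableSpace W := borel W
  obtain ⟨g₁, h₁, hq, hT⟩ := h.2 (not_containsLine s hl)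
  obtain ⟨g₂, h₂, hq', hT'⟩ := h'.2 (not_containsLine s hl)
  exact hq.unique hq' (isOpen_negative v) ⟨l, hl⟩ (fun ξ hξ => hT ξ (integrableOn_cone Λ hvΛ hξ))
    (fun ξ hξ => hT' ξ (integrableOn_cone Λ hvΛ hξ))

theorem expIntegral_cone (hr : Function.Injective r) (hs : IsRationalPoint Λ s)
    (hvΛ : ∀ i, v i ∈ Λ) (hl : ∀ i, l (v i) < 0) :
    expIntegral Λ ((fun y => s + y) '' cone v) =
      fracSum (fun i => 1 - expGerm (v i)) (topSimplices r v) (boxIntegralGerm Λ s v) := by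
  have h := isExpIntegral_cone Λ hr hs hvΛ hl
  have hex : ∃ m, IsExpIntegral Λ ((fun y => s + y) '' cone v) m := ⟨_, h⟩
  rw [expIntegral, dif_pos hex]
  exact IsExpIntegral.unique Λ hvΛ hl hex.choose_spec h

end ExpIntegral

/-! ### Residues along the edges of a cone -/

section Residue

variable {W : Type*} [NormedAddCommGroup W] [NormedSpace ℝ W] {ι : Type*} [Fintype ι]
  {W' : Type*} [NormedAddCommGroup W'] [NormedSpace ℝ W']

theorem exists_rank (ι : Type*) [Fintype ι] : ∃ r : ι → ℕ, Function.Injective r :=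
  ⟨fun i => Fintype.equivFin ι i, Fin.val_injective.comp (Fintype.equivFin ι).injective⟩

/-- Any generator can be put last in the lexicographic order. -/
theorem exists_rank_last (i : ι) :
    ∃ r : ι → ℕ, Function.Injective r ∧ ∀ j, j ≠ i → r j < r i := by
  classical
  obtain ⟨r, hr⟩ := exists_rank ι
  obtain ⟨N, hN⟩ : ∃ N, ∀ j, r j < N := by
    obtain ⟨N, hN⟩ := (Set.finite_range r).bddAbove
    exact ⟨N + 1, fun j => Nat.lt_succ_of_le (hN ⟨j, rfl⟩)⟩
  refine ⟨Function.update r i N, fun j k h => ?_, fun j hj => by simp [hj, hN]⟩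
  by_cases hj : j = i
  · by_cases hk : k = i
    · rw [hj, hk]
    · subst hj
      simp only [Function.update_self, Function.update_of_ne hk] at h
      exact absurd h (hN k).ne'
  · by_cases hk : k = i
    · subst hk
      simp only [Function.update_self, Function.update_of_ne hj] at h
      exact absurd h (hN j).ne
    · simp only [Function.update_of_ne hk, Function.update_of_ne hj] at h
      exact hr h

variable (π : W →L[ℝ] W') {v : ι → W} (i : ι)

theorem image_cone [DecidableEq ι] (s : W) (hπi : π (v i) = 0) :
    π '' ((fun y => s + y) '' cone v) =
      (fun y => π s + y) '' cone (fun j : {j // j ≠ i} => π (v j)) := by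
  have hsum : ∀ d : ι → ℝ, π (∑ j, d j • v j) = ∑ j : {j // j ≠ i}, d j • π (v j) := by
    intro d
    rw [← Finset.add_sum_erase _ _ (Finset.mem_univ i), map_add, map_smul, hπi, smul_zero, zero_add,
      map_sum]
    simp only [map_smul]
    exact Finset.sum_subtype _ (fun j => by simp) _
  ext y
  constructor
  · rintro ⟨_, ⟨_, ⟨t, ht, rfl⟩, rfl⟩, rfl⟩
    exact ⟨_, ⟨fun j => t j, fun j => ht j, rfl⟩, by rw [map_add, hsum]⟩
  · rintro ⟨_, ⟨t, ht, rfl⟩, rfl⟩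
    refine ⟨_, ⟨_, ⟨fun j => if hj : j ≠ i then t ⟨j, hj⟩ else 0, fun j => ?_, rfl⟩, rfl⟩, ?_⟩
    · dsimp only
      split_ifs
      exacts [ht _, le_rfl]
    · rw [map_add, hsum]
      congr 1
      exact Finset.sum_congr rfl fun j _ => by simp [j.2]

variable {i}

theorem map_span_insert [DecidableEq ι] (hπi : π (v i) = 0) (I' : Finset {j // j ≠ i}) :
    (Submodule.span ℝ (v '' (insert i (I'.map (Function.Embedding.subtype _)) : Finset ι))).map
      π.toLinearMap = Submodule.span ℝ ((fun j : {j // j ≠ i} => π (v j)) '' I') := by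
  rw [Submodule.map_span, ← Set.image_comp]
  have : ((π.toLinearMap : W → W') ∘ v) '' (insert i (I'.map (Function.Embedding.subtype _)) : Finset ι) =
      insert 0 ((fun j : {j // j ≠ i} => π (v j)) '' I') := by
    simp [Set.image_insert_eq, hπi, ← Set.image_comp]
  rw [this, Submodule.span_insert_zero]

theorem map_span_range (hπi : π (v i) = 0) :
    (Submodule.span ℝ (Set.range v)).map π.toLinearMap =
      Submodule.span ℝ (Set.range fun j : {j // j ≠ i} => π (v j)) := by
  classical
  rw [Submodule.map_span, ← Set.range_comp]
  refine le_antisymm (Submodule.span_le.2 ?_) (Submodule.span_mono ?_)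
  · rintro _ ⟨j, rfl⟩
    by_cases hj : j = i
    · subst hj
      simp [hπi]
    · exact Submodule.subset_span ⟨⟨j, hj⟩, rfl⟩
  · rintro _ ⟨j, rfl⟩
    exact ⟨j, rfl⟩

/-- The correspondence `lexAdm_link` respects simplices of full dimension. -/
theorem topSimplices_link [DecidableEq ι] (hker : ∀ x, π x = 0 ↔ ∃ c : ℝ, x = c • v i)
    {r : ι → ℕ} (hv : v i ≠ 0) (hi : ∀ j, j ≠ i → r j < r i)
    (I' : Finset {j // j ≠ i}) :
    I' ∈ topSimplices (fun j : {j // j ≠ i} => r j) (fun j => π (v j)) ↔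
      insert i (I'.map (Function.Embedding.subtype _)) ∈ topSimplices r v := by
  have hπi : π (v i) = 0 := (hker _).2 ⟨1, by simp⟩
  rw [mem_topSimplices, mem_topSimplices, lexAdm_link π i hv hker hi, and_congr_right_iff]
  intro _
  rw [← map_span_insert π hπi, ← map_span_range π hπi]
  set A := Submodule.span ℝ
    (v '' (insert i (I'.map (Function.Embedding.subtype _)) : Finset ι)) with hA
  have hle : ∀ B : Submodule ℝ W, v i ∈ B → LinearMap.ker π.toLinearMap ≤ B := by
    intro B hB x hx
    obtain ⟨c, rfl⟩ := (hker x).1 (by simpa using hx)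
    exact B.smul_mem _ hB
  have h1 := hle A (Submodule.subset_span ⟨i, by simp, rfl⟩)
  have h2 := hle (Submodule.span ℝ (Set.range v)) (Submodule.subset_span ⟨i, rfl⟩)
  constructor
  · intro h
    have := congrArg (Submodule.comap π.toLinearMap) h
    rwa [Submodule.comap_map_eq, Submodule.comap_map_eq, sup_eq_left.2 h1, sup_eq_left.2 h2] at this
  · intro h
    rw [h]

/-- The lattice index of a simplex does not change when a primitive edge vector is divided out. -/
theorem latticeIndex_link [DecidableEq ι] (hker : ∀ x, π x = 0 ↔ ∃ c : ℝ, x = c • v i)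
    (Λ : Submodule ℤ W) (Λ' : Submodule ℤ W')
    (hΛ' : ∀ y, y ∈ Λ' ↔ ∃ x ∈ Λ, π x = y) (hvΛ : ∀ j, v j ∈ Λ)
    (hprim : ∀ c : ℝ, c • v i ∈ Λ → ∃ n : ℤ, c = n) (I' : Finset {j // j ≠ i}) :
    latticeIndex Λ v (insert i (I'.map (Function.Embedding.subtype _))) =
      latticeIndex Λ' (fun j : {j // j ≠ i} => π (v j)) I' := by
  have hπi : π (v i) = 0 := (hker _).2 ⟨1, by simp⟩
  set I : Finset ι := insert i (I'.map (Function.Embedding.subtype _)) with hI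
  set f : W →+ W' := π.toLinearMap.toAddMonoidHom with hf
  set H := (Submodule.span ℤ (v '' I)).toAddSubgroup with hH
  set K := Λ.toAddSubgroup ⊓ (Submodule.span ℝ (v '' I)).toAddSubgroup with hK
  have hmapspan := map_span_insert π hπi I'
  have h1 : H.map f =
      (Submodule.span ℤ ((fun j : {j // j ≠ i} => π (v j)) '' I')).toAddSubgroup := by
    have e1 : (Submodule.span ℤ (v '' I)).map (π.toLinearMap.restrictScalars ℤ) =
        Submodule.span ℤ ((fun j : {j // j ≠ i} => π (v j)) '' I') := by
      rw [Submodule.map_span, ← Set.image_comp]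
      have : ((π.toLinearMap.restrictScalars ℤ : W → W') ∘ v) '' I =
          insert 0 ((fun j : {j // j ≠ i} => π (v j)) '' I') := by
        simp [hI, Set.image_insert_eq, hπi, ← Set.image_comp, Function.comp_def]
      rw [this, Submodule.span_insert_zero]
    rw [← e1]
    rfl
  have hvi : v i ∈ Submodule.span ℝ (v '' I) := Submodule.subset_span ⟨i, by simp [hI], rfl⟩
  have h2 : K.map f = Λ'.toAddSubgroup ⊓
      (Submodule.span ℝ ((fun j : {j // j ≠ i} => π (v j)) '' I')).toAddSubgroup := by
    ext y
    constructor
    · rintro ⟨x, ⟨hx1, hx2⟩, rfl⟩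
      refine ⟨(hΛ' _).2 ⟨x, hx1, rfl⟩, ?_⟩
      have : π x ∈ Submodule.span ℝ ((fun j : {j // j ≠ i} => π (v j)) '' I') := by
        rw [← hmapspan]
        exact ⟨x, hx2, rfl⟩
      exact this
    · rintro ⟨hy1, hy2⟩
      obtain ⟨x, hx, rfl⟩ := (hΛ' y).1 hy1
      refine ⟨x, ⟨hx, ?_⟩, rfl⟩
      have hy3 : π x ∈ Submodule.span ℝ ((fun j : {j // j ≠ i} => π (v j)) '' I') := hy2
      rw [← hmapspan] at hy3
      obtain ⟨z, hz, hzx⟩ := hy3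
      have hzx' : π z = π x := hzx
      obtain ⟨c, hc⟩ := (hker (x - z)).1 (by rw [map_sub, hzx', sub_self])
      have : x = z + c • v i := by rw [← hc]; abel
      have h3 : x ∈ Submodule.span ℝ (v '' I) := by
        rw [this]
        exact Submodule.add_mem _ hz (Submodule.smul_mem _ _ hvi)
      exact h3
  have hHK : H ≤ K := by
    refine le_inf ?_ ?_
    · have : Submodule.span ℤ (v '' I) ≤ Λ := Submodule.span_le.2 (by
        rintro _ ⟨j, _, rfl⟩
        exact hvΛ j)
      exact this
    · have : Submodule.span ℤ (v '' I) ≤ (Submodule.span ℝ (v '' I)).restrictScalars ℤ :=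
        Submodule.span_le.2 Submodule.subset_span
      exact this
  have hkK : f.ker ⊓ K ≤ H := by
    rintro x ⟨hx1, hx2, -⟩
    obtain ⟨c, rfl⟩ := (hker x).1 hx1
    obtain ⟨n, rfl⟩ := hprim c hx2
    have : (n : ℝ) • v i ∈ Submodule.span ℤ (v '' I) := by
      rw [Int.cast_smul_eq_zsmul]
      exact Submodule.smul_mem _ _ (Submodule.subset_span ⟨i, by simp [hI], rfl⟩)
    exact this
  rw [latticeIndex, latticeIndex, ← h1, ← h2, AddSubgroup.relIndex_map_map]
  have e2 : K ⊔ f.ker = K ⊔ (H ⊔ f.ker) := by rw [← sup_assoc, sup_eq_left.2 hHK]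
  rw [e2, AddSubgroup.relIndex_sup_right, ← AddSubgroup.inf_relIndex_right (H ⊔ f.ker) K,
    sup_inf_assoc_of_le _ hHK, sup_eq_left.2 hkK]

variable [FiniteDimensional ℝ W] [FiniteDimensional ℝ W'] (Λ : Submodule ℤ W) [DiscreteTopology Λ]
  (Λ' : Submodule ℤ W') [DiscreteTopology Λ'] {l : StrongDual ℝ W} {l' : StrongDual ℝ W'}

/-- The residue of the exponential sum of a pointed cone along an edge is the exponential sum of
the transverse cone. -/
theorem specializes_expSum (hker : ∀ x, π x = 0 ↔ ∃ c : ℝ, x = c • v i)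
    (hΛ' : ∀ y, y ∈ Λ' ↔ ∃ x ∈ Λ, π x = y) (s : W) (hvΛ : ∀ j, v j ∈ Λ)
    (hprim : ∀ c : ℝ, c • v i ∈ Λ → ∃ n : ℤ, c = n) (hl : ∀ j, l (v j) < 0)
    (hl' : ∀ j, j ≠ i → l' (π (v j)) < 0) :
    Specializes (pullbackHom (dualMapCLM π))
      (algebraMap _ _ (1 - expGerm (v i)) * expSum Λ ((fun y => s + y) '' cone v))
      (expSum Λ' (π '' ((fun y => s + y) '' cone v))) := by
  classical
  have hπi : π (v i) = 0 := (hker _).2 ⟨1, by simp⟩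
  have hv : ∀ j, v j ≠ 0 := fun j h => by
    have := hl j
    rw [h, map_zero] at this
    exact lt_irrefl _ this
  have hπv : ∀ j, j ≠ i → π (v j) ≠ 0 := fun j hj h => by
    have := hl' j hj
    rw [h, map_zero] at this
    exact lt_irrefl _ this
  obtain ⟨r, hr, hri⟩ := exists_rank_last i
  have hΛ'v : ∀ j : {j // j ≠ i}, π (v j) ∈ Λ' := fun j => (hΛ' _).2 ⟨_, hvΛ j, rfl⟩
  have hr' : Function.Injective (fun j : {j // j ≠ i} => r j) := hr.comp Subtype.val_injective
  rw [image_cone π i s hπi, expSum_cone Λ hr s hvΛ hl,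
    expSum_cone Λ' hr' (π s) hΛ'v (fun j => hl' j j.2)]
  have := specializes_fracSum (pullbackHom (dualMapCLM π)) (d := fun j => 1 - expGerm (v j))
    (fun j => one_sub_expGerm_ne_zero (hv j)) i
    (by rw [map_sub, map_one, pullbackHom_expGerm, hπi, expGerm_zero, sub_self])
    (fun j hj => by
      rw [map_sub, map_one, pullbackHom_expGerm]
      exact one_sub_expGerm_ne_zero (hπv j hj))
    (simplices r v) (simplices (fun j : {j // j ≠ i} => r j) (fun j => π (v j)))
    (fun I' => by
      rw [mem_simplices, mem_simplices]
      exact lexAdm_link π i (hv i) hker hri I')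
    (boxSumGerm Λ s v) (boxSumGerm Λ' (π s) (fun j : {j // j ≠ i} => π (v j)))
    (fun I' hI' => pullback_boxSumGerm Λ Λ' π hΛ' s i (hvΛ i) hprim hker I'
      (((lexAdm_link π i (hv i) hker hri I').1 (mem_simplices.1 hI')).linearIndependent))
  simpa only [map_sub, map_one, pullbackHom_expGerm] using this

/-- The residue of the exponential integral of a pointed cone along an edge is the exponential
integral of the transverse cone. -/
theorem specializes_expIntegral (hker : ∀ x, π x = 0 ↔ ∃ c : ℝ, x = c • v i)
    (hΛ' : ∀ y, y ∈ Λ' ↔ ∃ x ∈ Λ, π x = y) {s : W} (hs : IsRationalPoint Λ s)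
    (hvΛ : ∀ j, v j ∈ Λ)
    (hprim : ∀ c : ℝ, c • v i ∈ Λ → ∃ n : ℤ, c = n) (hl : ∀ j, l (v j) < 0)
    (hl' : ∀ j, j ≠ i → l' (π (v j)) < 0) :
    Specializes (pullbackHom (dualMapCLM π))
      (algebraMap _ _ (1 - expGerm (v i)) * expIntegral Λ ((fun y => s + y) '' cone v))
      (expIntegral Λ' (π '' ((fun y => s + y) '' cone v))) := by
  classical
  have hπi : π (v i) = 0 := (hker _).2 ⟨1, by simp⟩
  have hv : ∀ j, v j ≠ 0 := fun j h => by
    have := hl j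
    rw [h, map_zero] at this
    exact lt_irrefl _ this
  have hπv : ∀ j, j ≠ i → π (v j) ≠ 0 := fun j hj h => by
    have := hl' j hj
    rw [h, map_zero] at this
    exact lt_irrefl _ this
  obtain ⟨r, hr, hri⟩ := exists_rank_last i
  have hΛ'v : ∀ j : {j // j ≠ i}, π (v j) ∈ Λ' := fun j => (hΛ' _).2 ⟨_, hvΛ j, rfl⟩
  have hr' : Function.Injective (fun j : {j // j ≠ i} => r j) := hr.comp Subtype.val_injective
  have hs' : IsRationalPoint Λ' (π s) := by
    obtain ⟨q, hq, hqs⟩ := hs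
    exact ⟨q, hq, (hΛ' _).2 ⟨_, hqs, map_zsmul π q s⟩⟩
  rw [image_cone π i s hπi, expIntegral_cone Λ hr hs hvΛ hl,
    expIntegral_cone Λ' hr' hs' hΛ'v (fun j => hl' j j.2)]
  have := specializes_fracSum (pullbackHom (dualMapCLM π)) (d := fun j => 1 - expGerm (v j))
    (fun j => one_sub_expGerm_ne_zero (hv j)) i
    (by rw [map_sub, map_one, pullbackHom_expGerm, hπi, expGerm_zero, sub_self])
    (fun j hj => by
      rw [map_sub, map_one, pullbackHom_expGerm]
      exact one_sub_expGerm_ne_zero (hπv j hj))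
    (topSimplices r v) (topSimplices (fun j : {j // j ≠ i} => r j) (fun j => π (v j)))
    (fun I' => topSimplices_link π hker (hv i) hri I')
    (boxIntegralGerm Λ s v) (boxIntegralGerm Λ' (π s) (fun j : {j // j ≠ i} => π (v j)))
    (fun I' _ => by
      have hnot : i ∉ I'.map (Function.Embedding.subtype _) := by simp
      rw [boxIntegralGerm, boxIntegralGerm, latticeIndex_link π hker Λ Λ' hΛ' hvΛ hprim I',
        Finset.prod_insert hnot, Finset.prod_map]
      simp only [map_mul, map_natCast, map_prod, pullbackHom_expGerm, pullbackHom_expQuotGerm, hπi,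
        expQuotGerm_zero, one_mul, Function.Embedding.coe_subtype])
  simpa only [map_sub, map_one, pullbackHom_expGerm] using this

/-- The exponential integral of a cone has no pole along the hyperplane defined by a vector `u`
unless `u` is proportional to one of its edges. -/
theorem specializes_expIntegral_zero {u : W} (hu : π u = 0) {s : W} (hs : IsRationalPoint Λ s)
    (hvΛ : ∀ j, v j ∈ Λ) (hl : ∀ j, l (v j) < 0) (hπv : ∀ j, π (v j) ≠ 0) :
    Specializes (pullbackHom (dualMapCLM π))
      (algebraMap _ _ (1 - expGerm u) * expIntegral Λ ((fun y => s + y) '' cone v)) 0 := by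
  obtain ⟨r, hr⟩ := exists_rank ι
  rw [expIntegral_cone Λ hr hs hvΛ hl]
  have h1 : Specializes (pullbackHom (dualMapCLM π))
      (fracSum (fun i => 1 - expGerm (v i)) (topSimplices r v) (boxIntegralGerm Λ s v)) _ :=
    Specializes.sum _ fun I _ => (Specializes.of_algebraMap _).div (by
      rw [map_prod, Finset.prod_ne_zero_iff]
      intro j _
      rw [map_sub, map_one, pullbackHom_expGerm]
      exact one_sub_expGerm_ne_zero (hπv j))
  have h2 := (Specializes.of_algebraMap (c := pullbackHom (dualMapCLM π)) (1 - expGerm u)).mul h1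
  have hc : pullbackHom (dualMapCLM π) (1 - expGerm u) = 0 := by
    rw [map_sub, map_one, pullbackHom_expGerm, hu, expGerm_zero, sub_self]
  rw [hc, map_zero, zero_mul] at h2
  exact h2

/-- Multiplied by its denominators, `S` becomes an analytic germ with rational coefficients. -/
theorem denominator_mul_expSum (s : W) (hvΛ : ∀ j, v j ∈ Λ) (hl : ∀ j, l (v j) < 0) :
    ∃ (f : StrongDual ℝ W → ℝ) (hf : RatAnalytic Λ f),
      algebraMap _ _ (∏ j, (1 - expGerm (v j))) * expSum Λ ((fun y => s + y) '' cone v) =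
        algebraMap _ (MeromorphicGerm (StrongDual ℝ W)) (AnalyticGerm.mk f hf.1) := by
  classical
  have hv : ∀ j, v j ≠ 0 := fun j h => by
    have := hl j
    rw [h, map_zero] at this
    exact lt_irrefl _ this
  obtain ⟨r, hr⟩ := exists_rank ι
  have hf : RatAnalytic Λ (∑ I ∈ simplices r v,
      (∏ i ∈ Iᶜ, fun ξ : StrongDual ℝ W => 1 - Real.exp (ξ (v i))) * boxSum Λ s v I) :=
    RatAnalytic.sum _ fun I _ => (RatAnalytic.prod _ fun i _ => ratAnalytic_one_sub_exp (hvΛ i)).mul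
      (ratAnalytic_boxSum Λ s v I)
  refine ⟨_, hf, ?_⟩
  rw [expSum_cone Λ hr s hvΛ hl, denominator_mul_fracSum fun i => one_sub_expGerm_ne_zero (hv i)]
  congr 1
  simp only [one_sub_expGerm_eq_mk, coe_prod_mk, boxSumGerm, AnalyticGerm.mk_mul]
  rw [coe_sum_mk]

theorem denominator_mul_expIntegral {s : W} (hs : IsRationalPoint Λ s) (hvΛ : ∀ j, v j ∈ Λ)
    (hl : ∀ j, l (v j) < 0) :
    ∃ (f : StrongDual ℝ W → ℝ) (hf : RatAnalytic Λ f),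
      algebraMap _ _ (∏ j, (1 - expGerm (v j))) * expIntegral Λ ((fun y => s + y) '' cone v) =
        algebraMap _ (MeromorphicGerm (StrongDual ℝ W)) (AnalyticGerm.mk f hf.1) := by
  classical
  have hv : ∀ j, v j ≠ 0 := fun j h => by
    have := hl j
    rw [h, map_zero] at this
    exact lt_irrefl _ this
  obtain ⟨r, hr⟩ := exists_rank ι
  have hf : RatAnalytic Λ (∑ I ∈ topSimplices r v,
      (∏ i ∈ Iᶜ, fun ξ : StrongDual ℝ W => 1 - Real.exp (ξ (v i))) * boxIntegral Λ s v I) :=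
    RatAnalytic.sum _ fun I _ => (RatAnalytic.prod _ fun i _ => ratAnalytic_one_sub_exp (hvΛ i)).mul
      (ratAnalytic_boxIntegral Λ hs hvΛ I)
  refine ⟨_, hf, ?_⟩
  rw [expIntegral_cone Λ hr hs hvΛ hl,
    denominator_mul_fracSum fun i => one_sub_expGerm_ne_zero (hv i)]
  congr 1
  simp only [one_sub_expGerm_eq_mk, coe_prod_mk,
    fun I => boxIntegralGerm_eq Λ (ratAnalytic_boxIntegral Λ hs hvΛ I).1, AnalyticGerm.mk_mul]
  rw [coe_sum_mk]

end Residue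

/-! ### Lattices of rational quotient spaces -/

section Lattice

variable {V : Type*} [NormedAddCommGroup V] [NormedSpace ℝ V] [FiniteDimensional ℝ V]
  (Λ : Submodule ℤ V) [DiscreteTopology Λ]

theorem span_quotLattice [IsZLattice ℝ Λ] (L : Submodule ℝ V) :
    Submodule.span ℝ (quotLattice Λ L : Set (V ⧸ L)) = ⊤ := by
  have h : (quotLattice Λ L : Set (V ⧸ L)) = L.mkQ '' (Λ : Set V) := rfl
  rw [h, ← Submodule.map_span, IsZLattice.span_top, Submodule.map_top, Submodule.range_mkQ]

/-- By comparison of ranks, a `ℤ`-basis of the image of `Λ` in a rational quotient space is linearly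
independent over `ℝ`. -/
theorem exists_basis_quotLattice [IsZLattice ℝ Λ] {L : Submodule ℝ V}
    (hL : IsRationalSubspace Λ L) : ∃ (n : ℕ) (b : Module.Basis (Fin n) ℝ (V ⧸ L)),
      quotLattice Λ L = Submodule.span ℤ (Set.range b) := by
  set g : Λ →ₗ[ℤ] (V ⧸ L) := (L.mkQ.restrictScalars ℤ).domRestrict Λ with hg
  have hrange : LinearMap.range g = quotLattice Λ L := by
    rw [hg, LinearMap.range_domRestrict]
    rfl
  have : DiscreteTopology (subLattice Λ L) :=
    ZLattice.comap_discreteTopology ℝ Λ (e := L.subtype) continuous_subtype_val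
      Subtype.val_injective
  have : IsZLattice ℝ (subLattice Λ L) := ⟨by
    apply Submodule.map_injective_of_injective L.subtype_injective
    rw [Submodule.map_span, Submodule.map_top, Submodule.range_subtype]
    have e : L.subtype '' (subLattice Λ L : Set L) = {x : V | x ∈ Λ ∧ x ∈ L} := by
      ext x
      constructor
      · rintro ⟨y, hy, rfl⟩
        exact ⟨hy, y.2⟩
      · rintro ⟨h1, h2⟩
        exact ⟨⟨x, h2⟩, h1, rfl⟩
    rw [e]
    exact hL⟩
  have hker : Module.finrank ℤ (LinearMap.ker g) = Module.finrank ℝ L := by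
    rw [← ZLattice.rank ℝ (subLattice Λ L)]
    refine LinearEquiv.finrank_eq
      { toFun := fun x => ⟨⟨x, (Submodule.Quotient.mk_eq_zero L).1 x.2⟩, x.1.2⟩
        invFun := fun x => ⟨⟨x, x.2⟩, (Submodule.Quotient.mk_eq_zero L).2 x.1.2⟩
        map_add' := fun _ _ => rfl
        map_smul' := fun _ _ => rfl
        left_inv := fun _ => rfl
        right_inv := fun _ => rfl }
  have hfin : Module.Finite ℤ (LinearMap.range g) := inferInstance
  have hfree : Module.Free ℤ (LinearMap.range g) := by
    have : Module.IsTorsionFree ℤ (V ⧸ L) := .trans ℝ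
    infer_instance
  have hrank : Module.finrank ℤ (LinearMap.range g) = Module.finrank ℝ (V ⧸ L) := by
    have h1 := Submodule.finrank_quotient_add_finrank (LinearMap.ker g)
    rw [g.quotKerEquivRange.finrank_eq, hker, ZLattice.rank ℝ Λ] at h1
    have h2 := Submodule.finrank_quotient_add_finrank L
    omega
  set b₀ := Module.finBasis ℤ (LinearMap.range g) with hb₀
  have hspan : Submodule.span ℤ (Set.range fun i => (b₀ i : V ⧸ L)) = quotLattice Λ L := by
    have h1 := congrArg (Submodule.map (LinearMap.range g).subtype) b₀.span_eq
    rw [Submodule.map_span, Submodule.map_top, Submodule.range_subtype, ← Set.range_comp]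
      at h1
    exact h1.trans hrange
  have htop : ⊤ ≤ Submodule.span ℝ (Set.range fun i => (b₀ i : V ⧸ L)) := by
    rw [← span_quotLattice Λ L, ← hspan]
    refine Submodule.span_le.2 ?_
    have : Submodule.span ℤ (Set.range fun i => (b₀ i : V ⧸ L)) ≤
        (Submodule.span ℝ (Set.range fun i => (b₀ i : V ⧸ L))).restrictScalars ℤ :=
      Submodule.span_le.2 Submodule.subset_span
    exact this
  refine ⟨_, basisOfTopLeSpanOfCardEqFinrank _ htop (by simpa using hrank), ?_⟩
  rw [coe_basisOfTopLeSpanOfCardEqFinrank, hspan]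

theorem discreteTopology_quotLattice [IsZLattice ℝ Λ] {L : Submodule ℝ V}
    (hL : IsRationalSubspace Λ L) : DiscreteTopology (quotLattice Λ L) := by
  obtain ⟨n, b, hb⟩ := exists_basis_quotLattice Λ hL
  rw [hb]
  infer_instance

end Lattice

section Primitive

variable {W : Type*} [NormedAddCommGroup W] [NormedSpace ℝ W] (Λ : Submodule ℤ W)
  [DiscreteTopology Λ]

/-- Each rational direction contains a primitive lattice vector. -/
theorem exists_primitive {x : W} (hx : IsRationalPoint Λ x) (hx0 : x ≠ 0) :
    ∃ c : ℝ, 0 < c ∧ c • x ∈ Λ ∧ ∀ d : ℝ, d • (c • x) ∈ Λ → ∃ n : ℤ, d = n := by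
  set G : AddSubgroup ℝ :=
    Λ.toAddSubgroup.comap (LinearMap.toSpanSingleton ℝ W x).toAddMonoidHom with hG
  have hGm : ∀ r : ℝ, r ∈ G ↔ r • x ∈ Λ := fun r => Iff.rfl
  obtain ⟨q, hq, hqx⟩ := hx
  have hqG : (q : ℝ) ∈ G := by
    rw [hGm, Int.cast_smul_eq_zsmul]
    exact hqx
  rcases AddSubgroup.dense_or_cyclic G with hd | ⟨a, ha⟩
  · -- a dense group of multiples contradicts the discreteness of `Λ`
    exfalso
    obtain ⟨ε, hε, hball⟩ : ∃ ε > 0, ∀ y ∈ Λ, ‖y‖ < ε → y = 0 := by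
      obtain ⟨ε, hε, h⟩ := Metric.nhds_basis_ball.mem_iff.1
        ((discreteTopology_iff_isOpen_singleton_zero.1 ‹DiscreteTopology Λ›).mem_nhds
          (Set.mem_singleton _))
      refine ⟨ε, hε, fun y hy hn => ?_⟩
      have : (⟨y, hy⟩ : Λ) ∈ Metric.ball (0 : Λ) ε := by simpa using hn
      simpa using h this
    have hx1 : 0 < ‖x‖ := norm_pos_iff.2 hx0
    obtain ⟨r, hr, hrG⟩ := hd.exists_between (show (0 : ℝ) < ε / ‖x‖ by positivity)
    have h0 : r • x = 0 := by
      refine hball _ ((hGm r).1 hr) ?_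
      rw [norm_smul, Real.norm_of_nonneg hrG.1.le]
      exact (lt_div_iff₀ hx1).1 hrG.2
    rcases smul_eq_zero.1 h0 with h | h
    · exact hrG.1.ne' h
    · exact hx0 h
  · have ha' : ∀ r : ℝ, r ∈ G ↔ ∃ n : ℤ, n • a = r := fun r => by
      rw [ha, AddSubgroup.mem_closure_singleton]
    have ha0 : a ≠ 0 := by
      rintro rfl
      obtain ⟨n, hn⟩ := (ha' _).1 hqG
      simp only [smul_zero] at hn
      exact hq (by exact_mod_cast hn.symm)
    refine ⟨|a|, abs_pos.2 ha0, ?_, fun d hd => ?_⟩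
    · rw [← hGm]
      rcases abs_choice a with h | h <;> rw [h]
      · exact (ha' _).2 ⟨1, one_smul _ _⟩
      · exact (ha' _).2 ⟨-1, by simp⟩
    · rw [smul_smul, ← hGm] at hd
      obtain ⟨n, hn⟩ := (ha' _).1 hd
      rcases abs_choice a with h | h <;> rw [h] at hn
      · refine ⟨n, mul_right_cancel₀ ha0 ?_⟩
        rw [← hn, zsmul_eq_mul]
      · refine ⟨-n, mul_right_cancel₀ ha0 ?_⟩
        rw [zsmul_eq_mul] at hn
        push_cast
        linarith

/-- The coordinate forms of a lattice basis are dual integral. -/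
theorem isDualIntegral_coord {n : ℕ} (b : Module.Basis (Fin n) ℝ W) [FiniteDimensional ℝ W]
    (i : Fin n) :
    IsDualIntegral (Submodule.span ℤ (Set.range b)) (b.coord i).toContinuousLinearMap := by
  intro x hx
  obtain ⟨m, hm⟩ := (b.mem_span_iff_repr_mem ℤ x).1 hx i
  exact ⟨m, by simpa using hm.symm⟩

theorem exists_isDualIntegral_ne_zero {V : Type*} [NormedAddCommGroup V] [NormedSpace ℝ V]
    [FiniteDimensional ℝ V] (Λ : Submodule ℤ V) [DiscreteTopology Λ] [IsZLattice ℝ Λ]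
    {L : Submodule ℝ V} (hL : IsRationalSubspace Λ L) {x : V ⧸ L} (hx : x ≠ 0) :
    ∃ w, IsDualIntegral (quotLattice Λ L) w ∧ w x ≠ 0 := by
  obtain ⟨n, b, hb⟩ := exists_basis_quotLattice Λ hL
  by_contra! h
  refine hx (b.ext_elem fun i => ?_)
  have := h _ (hb ▸ isDualIntegral_coord b i)
  simpa using this

end Primitive

/-! ### Rationality of the orthogonal projections -/

section Projection

variable {V : Type*} [NormedAddCommGroup V] [NormedSpace ℝ V] [FiniteDimensional ℝ V]
  {Λ : Submodule ℤ V}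

theorem IsDualIntegral.dualIncl {L : Submodule ℝ V} {η : StrongDual ℝ (V ⧸ L)}
    (h : IsDualIntegral (quotLattice Λ L) η) : IsDualIntegral Λ (dualIncl L η) :=
  fun x hx => h _ ⟨x, hx, rfl⟩

theorem quotForm_dualProj (Q : RationalScalarProduct Λ) (L L' : Submodule ℝ V)
    (ξ : StrongDual ℝ (V ⧸ L)) (ζ : StrongDual ℝ (V ⧸ L')) :
    quotForm Q L' (dualProj Q L L' ξ) ζ = Q.form (RatCone.dualIncl L ξ) (RatCone.dualIncl L' ζ) := by
  simp [dualProj, LinearMap.BilinForm.apply_toDual_symm_apply]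

theorem eq_dualProj (Q : RationalScalarProduct Λ) (L L' : Submodule ℝ V)
    (ξ : StrongDual ℝ (V ⧸ L)) (θ : StrongDual ℝ (V ⧸ L'))
    (h : ∀ ζ, quotForm Q L' θ ζ = Q.form (RatCone.dualIncl L ξ) (RatCone.dualIncl L' ζ)) :
    θ = dualProj Q L L' ξ := by
  rw [← sub_eq_zero]
  refine (quotForm_nondegenerate Q L').1 _ fun ζ => ?_
  rw [map_sub, LinearMap.sub_apply, h, quotForm_dualProj, sub_self]

theorem dualProj_self (Q : RationalScalarProduct Λ) (L : Submodule ℝ V) :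
    dualProj Q L L = ContinuousLinearMap.id ℝ _ := by
  ext1 ξ
  exact (eq_dualProj Q L L ξ ξ fun ζ => rfl).symm

theorem exists_common_denominator {κ : Type*} [Fintype κ] (x : κ → ℚ) :
    ∃ m : ℤ, m ≠ 0 ∧ ∀ i, ∃ n : ℤ, (m : ℚ) * x i = n := by
  obtain ⟨b, hb⟩ := IsLocalization.exist_integer_multiples_of_finite (nonZeroDivisors ℤ) x
  refine ⟨b, nonZeroDivisors.coe_ne_zero b, fun i => ?_⟩
  obtain ⟨n, hn⟩ := hb i
  refine ⟨n, ?_⟩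
  have : ((b : ℤ) • x i : ℚ) = n := hn.symm
  rwa [zsmul_eq_mul] at this

/-- The orthogonal projection is rational: its coordinates solve a linear system with rational
coefficients, given by the Gram matrix of a basis of the dual lattice. -/
theorem dualProj_rational [DiscreteTopology Λ] [IsZLattice ℝ Λ] (Q : RationalScalarProduct Λ)
    (L : Submodule ℝ V) {L' : Submodule ℝ V} (hL' : IsRationalSubspace Λ L')
    {η : StrongDual ℝ (V ⧸ L)} (hη : IsDualIntegral (quotLattice Λ L) η) :
    ∃ m : ℤ, m ≠ 0 ∧ IsDualIntegral (quotLattice Λ L') (m • dualProj Q L L' η) := by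
  obtain ⟨n, b, hb⟩ := exists_basis_quotLattice Λ hL'
  set e : Fin n → StrongDual ℝ (V ⧸ L') := fun i => (b.coord i).toContinuousLinearMap with he
  have heint : ∀ i, IsDualIntegral (quotLattice Λ L') (e i) := fun i =>
    hb ▸ isDualIntegral_coord b i
  have hexp : ∀ ζ : StrongDual ℝ (V ⧸ L'), ζ = ∑ i, ζ (b i) • e i := by
    intro ζ
    refine ContinuousLinearMap.coe_injective (b.ext fun j => ?_)
    simp [he, Finsupp.single_apply]
  have hG : ∀ i j, ∃ q : ℚ, quotForm Q L' (e i) (e j) = q := fun i j =>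
    Q.rational _ _ (heint i).dualIncl (heint j).dualIncl
  choose G hG using hG
  have hR : ∀ j, ∃ q : ℚ, Q.form (RatCone.dualIncl L η) (RatCone.dualIncl L' (e j)) = q := fun j =>
    Q.rational _ _ hη.dualIncl (heint j).dualIncl
  choose R hR using hR
  set T : (Fin n → ℚ) →ₗ[ℚ] (Fin n → ℚ) := (Matrix.of G).vecMulLinear with hT
  have hTapp : ∀ x j, T x j = ∑ i, x i * G i j := fun x j => rfl
  have hinj : Function.Injective T := by
    rw [← LinearMap.ker_eq_bot, LinearMap.ker_eq_bot']
    intro x hx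
    set y : StrongDual ℝ (V ⧸ L') := ∑ i, (x i : ℝ) • e i with hy
    have hy0 : y = 0 := by
      refine (quotForm_nondegenerate Q L').1 _ fun ζ => ?_
      rw [hexp ζ, map_sum]
      refine Finset.sum_eq_zero fun j _ => ?_
      have h1 : quotForm Q L' y (e j) = ((T x j : ℚ) : ℝ) := by
        rw [hTapp, hy]
        simp [hG]
      rw [map_smul, h1, hx]
      simp
    funext j
    have := congrArg (fun f : StrongDual ℝ (V ⧸ L') => f (b j)) hy0
    simpa [hy, he, Finsupp.single_apply] using this
  obtain ⟨x, hx⟩ := LinearMap.injective_iff_surjective.1 hinj R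
  have hproj : ∑ i, (x i : ℝ) • e i = dualProj Q L L' η := by
    refine eq_dualProj Q L L' η _ fun ζ => ?_
    rw [hexp ζ]
    simp only [map_sum, map_smul]
    refine Finset.sum_congr rfl fun j _ => ?_
    rw [hR, ← congrFun hx j, hTapp]
    simp [hG]
  obtain ⟨m, hm, hmx⟩ := exists_common_denominator x
  choose k hk using hmx
  refine ⟨m, hm, ?_⟩
  have : m • dualProj Q L L' η = ∑ i, k i • e i := by
    rw [← hproj, Finset.smul_sum]
    refine Finset.sum_congr rfl fun i _ => ?_
    rw [← Int.cast_smul_eq_zsmul ℝ m, smul_smul, ← Int.cast_smul_eq_zsmul ℝ (k i)]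
    congr 1
    exact_mod_cast hk i
  rw [this]
  exact IsDualIntegral.sum _ fun i _ => (heint i).zsmul _

end Projection

/-! ### Faces and edges of affine cones -/

section Polyhedral

variable {W : Type*} [NormedAddCommGroup W] [NormedSpace ℝ W] {ι : Type*} [Fintype ι]

theorem mem_cone_restrict {v : ι → W} {I : Finset ι} {x : W} :
    x ∈ cone (fun i : I => v i) ↔
      ∃ t : ι → ℝ, (∀ i, 0 ≤ t i) ∧ (∀ i ∉ I, t i = 0) ∧ x = ∑ i, t i • v i := by
  classical
  constructor
  · rintro ⟨t, ht, rfl⟩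
    refine ⟨fun i => if hi : i ∈ I then t ⟨i, hi⟩ else 0, fun i => ?_, fun i hi => by simp [hi], ?_⟩
    · dsimp only
      split_ifs
      exacts [ht _, le_rfl]
    · rw [sum_extend_zero v I fun i hi => by simp [hi]]
      simp
  · rintro ⟨t, ht, h0, rfl⟩
    exact ⟨fun i => t i, fun i => ht i, sum_extend_zero v I h0⟩

theorem mem_cone_self (v : ι → W) (i : ι) : v i ∈ cone v := by
  classical
  refine ⟨Pi.single i 1, fun j => ?_, by simp [Pi.single_apply, ite_smul]⟩
  rcases eq_or_ne j i with rfl | h <;> simp [*]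

theorem add_mem_cone {v : ι → W} {x y : W} (hx : x ∈ cone v) (hy : y ∈ cone v) :
    x + y ∈ cone v := by
  obtain ⟨t, ht, rfl⟩ := hx
  obtain ⟨u, hu, rfl⟩ := hy
  exact ⟨t + u, fun i => add_nonneg (ht i) (hu i), by simp [add_smul, Finset.sum_add_distrib]⟩

theorem smul_mem_cone {v : ι → W} {x : W} (hx : x ∈ cone v) {c : ℝ} (hc : 0 ≤ c) :
    c • x ∈ cone v := by
  obtain ⟨t, ht, rfl⟩ := hx
  exact ⟨fun i => c * t i, fun i => mul_nonneg hc (ht i), by simp [Finset.smul_sum, mul_smul]⟩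

theorem zero_mem_cone (v : ι → W) : (0 : W) ∈ cone v := ⟨0, fun _ => le_rfl, by simp⟩

/-- Gordan's alternative: either some linear form is negative on all `v i`, or there is a
nontrivial nonnegative linear relation between them. -/
theorem exists_neg_form {v : ι → W}
    (h : ∀ t : ι → ℝ, (∀ i, 0 ≤ t i) → ∑ i, t i • v i = 0 → t = 0) :
    ∃ l : StrongDual ℝ W, ∀ i, l (v i) < 0 := by
  classical
  set f : (ι → ℝ) →ₗ[ℝ] W := Fintype.linearCombination ℝ v with hf
  have hK : IsCompact (f '' stdSimplex ℝ ι) := (isCompact_stdSimplex ℝ ι).image (by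
    have : (f : (ι → ℝ) → W) = fun t => ∑ i, t i • v i := by
      funext t; rw [hf, Fintype.linearCombination_apply]
    rw [this]
    fun_prop)
  have hc : Convex ℝ (f '' stdSimplex ℝ ι) := (convex_stdSimplex ℝ ι).linear_image f
  have h0 : (0 : W) ∉ f '' stdSimplex ℝ ι := by
    rintro ⟨t, ⟨ht, ht1⟩, h0⟩
    rw [hf, Fintype.linearCombination_apply] at h0
    rw [h t ht h0] at ht1
    simp at ht1
  obtain ⟨l, u, w, h1, h2, h3⟩ := geometric_hahn_banach_compact_closed hc hK
    (convex_singleton (0 : W)) isClosed_singleton (Set.disjoint_singleton_right.2 h0)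
  refine ⟨l, fun i => ?_⟩
  have h4 := h3 0 rfl
  rw [map_zero] at h4
  have h5 := h1 (v i) ⟨Pi.single i 1, single_mem_stdSimplex ℝ i, by
    rw [hf, Fintype.linearCombination_apply]
    simp [Pi.single_apply, ite_smul]⟩
  linarith

/-- A nonnegative linear relation which involves `v j` puts the line `ℝ v j` into the cone. -/
theorem smul_mem_cone_of_relation {v : ι → W} {t : ι → ℝ} (ht : ∀ i, 0 ≤ t i)
    (hsum : ∑ i, t i • v i = 0) {j : ι} (hj0 : 0 < t j) (r : ℝ) : r • v j ∈ cone v := by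
  classical
  have hneg : -(t j • v j) ∈ cone v := by
    refine ⟨fun i => if i = j then 0 else t i, fun i => ?_, ?_⟩
    · dsimp only
      split_ifs
      exacts [le_rfl, ht i]
    · have h1 : ∑ i, (if i = j then 0 else t i) • v i = ∑ i, t i • v i - t j • v j := by
        rw [eq_sub_iff_add_eq, ← Finset.sum_erase_add _ _ (Finset.mem_univ j),
          ← Finset.sum_erase_add Finset.univ (fun i => t i • v i) (Finset.mem_univ j)]
        simp only [if_true, zero_smul, add_zero]
        congr 1
        exact Finset.sum_congr rfl fun i hi => by simp [Finset.ne_of_mem_erase hi]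
      rw [h1, hsum, zero_sub]
  rcases le_total 0 r with hr | hr
  · exact smul_mem_cone (mem_cone_self v j) hr
  · have h2 := smul_mem_cone hneg (c := (-r) / t j) (div_nonneg (by linarith) hj0.le)
    have h3 : ((-r) / t j) • -(t j • v j) = r • v j := by
      rw [smul_neg, smul_smul, div_mul_cancel₀ _ hj0.ne', neg_smul, neg_neg]
    rwa [h3] at h2

/-- If an affine cone contains a line, then it is invariant under all translations in some
direction. -/
theorem exists_lineality {s : W} {v : ι → W} (h : ContainsLine ((fun y => s + y) '' cone v)) :
    ∃ u : W, u ≠ 0 ∧ ∀ y ∈ (fun y => s + y) '' cone v, ∀ r : ℝ,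
      y + r • u ∈ (fun y => s + y) '' cone v := by
  classical
  set I : Finset ι := Finset.univ.filter fun i => v i ≠ 0 with hI
  have hcone : cone v = cone (fun i : I => v i) := by
    ext x
    rw [mem_cone_restrict]
    constructor
    · rintro ⟨t, ht, rfl⟩
      refine ⟨fun i => if v i ≠ 0 then t i else 0, fun i => ?_, fun i hi => ?_, ?_⟩
      · dsimp only
        split_ifs
        exacts [ht _, le_rfl]
      · have : v i = 0 := by simpa [hI] using hi
        simp [this]
      · refine Finset.sum_congr rfl fun i _ => ?_
        by_cases h0 : v i = 0 <;> simp [h0]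
    · rintro ⟨t, ht, _, rfl⟩
      exact ⟨t, ht, rfl⟩
  have hrel : ∃ t : I → ℝ, (∀ i, 0 ≤ t i) ∧ ∑ i, t i • v i = 0 ∧ t ≠ 0 := by
    by_contra! hno
    obtain ⟨l, hl⟩ := exists_neg_form (v := fun i : I => v i) hno
    rw [hcone] at h
    exact not_containsLine s hl h
  obtain ⟨t, ht, hsum, hne⟩ := hrel
  obtain ⟨j, hj⟩ := Function.ne_iff.1 hne
  have hj0 : 0 < t j := lt_of_le_of_ne (ht j) (Ne.symm hj)
  refine ⟨v j, (Finset.mem_filter.1 j.2).2, ?_⟩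
  rintro _ ⟨y, hy, rfl⟩ r
  refine ⟨y + r • v j, add_mem_cone hy ?_, by simp [add_assoc]⟩
  rw [hcone]
  exact smul_mem_cone_of_relation ht hsum hj0 r

/-- Each face of an affine cone with a line contains a line: the form which defines the face is
bounded above on the cone, hence constant in the lineality directions. -/
theorem containsLine_face {s : W} {v : ι → W} (h : ContainsLine ((fun y => s + y) '' cone v))
    (f : Face ((fun y => s + y) '' cone v)) : ContainsLine f.1 := by
  obtain ⟨u, hu, hline⟩ := exists_lineality h
  obtain ⟨l, hl⟩ := f.2.2 f.2.1
  obtain ⟨x, hx⟩ := f.2.1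
  have hx' := hx
  rw [hl] at hx'
  have hlu : l u = 0 := by
    have h1 := hx'.2 _ (hline x hx'.1 1)
    have h2 := hx'.2 _ (hline x hx'.1 (-1))
    simp only [map_add, map_smul, smul_eq_mul] at h1 h2
    linarith
  refine ⟨x, u, hu, fun t => ?_⟩
  rw [hl]
  exact ⟨hline x hx'.1 t, fun y hy => by simpa [hlu] using hx'.2 y hy⟩

open Classical in
/-- The generators on which a linear form vanishes. -/
noncomputable def zeroSet (v : ι → W) (l : StrongDual ℝ W) : Finset ι :=
  Finset.univ.filter fun i => l (v i) = 0

theorem mem_zeroSet {v : ι → W} {l : StrongDual ℝ W} {i : ι} :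
    i ∈ zeroSet v l ↔ l (v i) = 0 := by
  classical
  simp [zeroSet]

theorem argmax_cone {s : W} {v : ι → W} {l : StrongDual ℝ W} (hl : ∀ i, l (v i) ≤ 0) :
    {x | x ∈ (fun y => s + y) '' cone v ∧ ∀ y ∈ (fun y => s + y) '' cone v, l y ≤ l x} =
      (fun y => s + y) '' cone (fun i : zeroSet v l => v i) := by
  ext x
  constructor
  · rintro ⟨⟨_, ⟨t, ht, rfl⟩, rfl⟩, hmax⟩
    refine ⟨_, mem_cone_restrict.2 ⟨t, ht, fun i hi => ?_, rfl⟩, rfl⟩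
    have h1 := hmax _ ⟨0, zero_mem_cone v, rfl⟩
    simp only [map_add, map_zero, map_sum, map_smul, smul_eq_mul] at h1
    have h2 : ∀ i ∈ Finset.univ, t i * l (v i) ≤ 0 :=
      fun i _ => mul_nonpos_of_nonneg_of_nonpos (ht i) (hl i)
    have h3 : ∑ i, t i * l (v i) = 0 := le_antisymm (Finset.sum_nonpos h2) (by linarith)
    rw [Finset.sum_eq_zero_iff_of_nonpos h2] at h3
    exact (mul_eq_zero.1 (h3 i (Finset.mem_univ i))).resolve_right fun h => hi (mem_zeroSet.2 h)
  · rintro ⟨_, hx, rfl⟩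
    obtain ⟨t, ht, h0, rfl⟩ := mem_cone_restrict.1 hx
    refine ⟨⟨_, ⟨t, ht, rfl⟩, rfl⟩, ?_⟩
    rintro _ ⟨_, ⟨u, hu, rfl⟩, rfl⟩
    have h1 : ∑ i, t i * l (v i) = 0 := Finset.sum_eq_zero fun i _ => by
      by_cases hi : i ∈ zeroSet v l
      · rw [mem_zeroSet.1 hi, mul_zero]
      · rw [h0 i hi, zero_mul]
    have h2 : ∑ i, u i * l (v i) ≤ 0 :=
      Finset.sum_nonpos fun i _ => mul_nonpos_of_nonneg_of_nonpos (hu i) (hl i)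
    simp only [map_add, map_sum, map_smul, smul_eq_mul]
    linarith

/-- The face of an affine cone on which a linear form which is nonpositive on the generators
attains its maximum. -/
noncomputable def formFace (s : W) (v : ι → W) (l : StrongDual ℝ W) (hl : ∀ i, l (v i) ≤ 0) :
    Face ((fun y => s + y) '' cone v) :=
  ⟨(fun y => s + y) '' cone (fun i : zeroSet v l => v i), ⟨_, 0, zero_mem_cone _, rfl⟩,
    fun _ => ⟨l, (argmax_cone hl).symm⟩⟩

/-- All faces of an affine cone come from forms which are nonpositive on the generators. -/
theorem exists_eq_formFace {s : W} {v : ι → W} (f : Face ((fun y => s + y) '' cone v)) :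
    ∃ (l : StrongDual ℝ W) (hl : ∀ i, l (v i) ≤ 0), f = formFace s v l hl := by
  obtain ⟨l, hfl⟩ := f.2.2 f.2.1
  have hl : ∀ i, l (v i) ≤ 0 := by
    intro i
    obtain ⟨x, hx⟩ := f.2.1
    rw [hfl] at hx
    obtain ⟨⟨y, hy, rfl⟩, hmax⟩ := hx
    have := hmax _ ⟨y + v i, add_mem_cone hy (mem_cone_self v i), rfl⟩
    simp only [map_add] at this
    linarith
  exact ⟨l, hl, Subtype.ext (hfl.trans (argmax_cone hl))⟩

theorem finite_face_cone (s : W) (v : ι → W) : Finite (Face ((fun y => s + y) '' cone v)) := by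
  choose l hl h using fun f : Face ((fun y => s + y) '' cone v) => exists_eq_formFace f
  refine Finite.of_injective (fun f => zeroSet v (l f)) fun f g hfg => Subtype.ext ?_
  have hfg' : zeroSet v (l f) = zeroSet v (l g) := hfg
  rw [h f, h g]
  simp only [formFace]
  rw [hfg']

/-- The generators `v i` of a pointed cone are primitive lattice vectors, and they are the edge
vectors: each of them spans an extreme ray. -/
structure IsEdgeSystem (Λ : Submodule ℤ W) (v : ι → W) : Prop where
  mem : ∀ i, v i ∈ Λ
  primitive : ∀ i (c : ℝ), c • v i ∈ Λ → ∃ n : ℤ, c = n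
  exists_neg : ∃ l : StrongDual ℝ W, ∀ i, l (v i) < 0
  exists_edge : ∀ i, ∃ l : StrongDual ℝ W, l (v i) = 0 ∧ ∀ j, j ≠ i → l (v j) < 0

theorem cone_smul {v : ι → W} {c : ι → ℝ} (hc : ∀ i, 0 < c i) :
    cone (fun i => c i • v i) = cone v := by
  ext x
  constructor
  · rintro ⟨t, ht, rfl⟩
    exact ⟨fun i => t i * c i, fun i => mul_nonneg (ht i) (hc i).le, by simp [mul_smul]⟩
  · rintro ⟨t, ht, rfl⟩
    refine ⟨fun i => t i / c i, fun i => div_nonneg (ht i) (hc i).le,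
      Finset.sum_congr rfl fun i _ => ?_⟩
    rw [smul_smul, div_mul_cancel₀ _ (hc i).ne']

/-- A minimal system of generators of a pointed cone consists of edge vectors. -/
theorem exists_edge_form [FiniteDimensional ℝ W] [DecidableEq ι] {v : ι → W}
    (hrel : ∀ t : ι → ℝ, (∀ i, 0 ≤ t i) → ∑ i, t i • v i = 0 → t = 0) (i : ι)
    (hmin : ∀ t : ι → ℝ, (∀ j, 0 ≤ t j) → t i = 0 → v i ≠ ∑ j, t j • v j) :
    ∃ l : StrongDual ℝ W, l (v i) = 0 ∧ ∀ j, j ≠ i → l (v j) < 0 := by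
  set U := Submodule.span ℝ {v i} with hU
  have : ∃ l : StrongDual ℝ (W ⧸ U), ∀ j : {j // j ≠ i}, l (U.mkQ (v j)) < 0 := by
    refine exists_neg_form fun t ht hsum => ?_
    set u : ι → ℝ := fun j => if hj : j ≠ i then t ⟨j, hj⟩ else 0 with hu
    have hu0 : ∀ j, 0 ≤ u j := fun j => by
      simp only [hu]
      split_ifs
      exacts [ht _, le_rfl]
    have hui : u i = 0 := by simp [hu]
    have hsum' : ∑ j, u j • v j = ∑ j : {j // j ≠ i}, t j • v j := by
      rw [← Finset.add_sum_erase _ _ (Finset.mem_univ i), hui, zero_smul, zero_add,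
        Finset.sum_subtype (p := fun j => j ≠ i) _ (fun j => by simp) (fun j => u j • v j)]
      exact Finset.sum_congr rfl fun j _ => by simp [hu, j.2]
    have hmem : ∑ j, u j • v j ∈ U := by
      rw [← Submodule.Quotient.mk_eq_zero, hsum']
      have : U.mkQ (∑ j : {j // j ≠ i}, t j • v j) = 0 := by
        rw [map_sum]
        simpa only [map_smul] using hsum
      exact this
    obtain ⟨c, hc⟩ := Submodule.mem_span_singleton.1 hmem
    have hc0 : c ≤ 0 := by
      by_contra! hpos
      refine hmin (fun j => c⁻¹ * u j) (fun j => mul_nonneg (inv_nonneg.2 hpos.le) (hu0 j))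
        (by simp [hui]) ?_
      simp only [mul_smul]
      rw [← Finset.smul_sum, ← hc, smul_smul, inv_mul_cancel₀ hpos.ne', one_smul]
    have h0 := hrel (u + Pi.single i (-c)) (fun j => by
      rcases eq_or_ne j i with rfl | hj
      · simpa [hui] using hc0
      · simpa [hj] using hu0 j) (by
      simp only [Pi.add_apply, add_smul, Finset.sum_add_distrib, ← hc]
      simp [Pi.single_apply, ite_smul])
    funext j
    have := congrFun h0 j
    simpa [hu, j.2] using this
  obtain ⟨l, hl⟩ := this
  refine ⟨dualIncl U l, ?_, fun j hj => hl ⟨j, hj⟩⟩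
  have h1 : U.mkQ (v i) = 0 :=
    (Submodule.Quotient.mk_eq_zero U).2 (Submodule.mem_span_singleton_self _)
  have h2 : dualIncl U l (v i) = l (U.mkQ (v i)) := rfl
  rw [h2, h1, map_zero]

/-- Each affine cone without lines is generated by its edges. -/
theorem exists_edgeSystem [FiniteDimensional ℝ W] {Λ : Submodule ℤ W} [DiscreteTopology Λ]
    {a : Set W} (ha : IsAffineCone Λ a) (hline : ¬ ContainsLine a) :
    ∃ (ι : Type) (_ : Fintype ι) (s : W) (v : ι → W), IsRationalPoint Λ s ∧
      a = (fun y => s + y) '' cone v ∧ IsEdgeSystem Λ v := by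
  classical
  obtain ⟨s, _, hs, ⟨k, v, hv, rfl⟩, rfl⟩ := ha
  have hcv : coneHull v = cone v := rfl
  -- choose a minimal set of generators
  obtain ⟨I, hI, hmin⟩ := (Finset.univ.filter fun I : Finset (Fin k) =>
    cone (fun i : I => v i) = coneHull v).exists_min_image Finset.card ⟨Finset.univ, by
      simp only [Finset.mem_filter, Finset.mem_univ, true_and]
      ext x
      rw [mem_cone_restrict, hcv]
      constructor
      · rintro ⟨t, ht, _, rfl⟩
        exact ⟨t, ht, rfl⟩
      · rintro ⟨t, ht, rfl⟩
        exact ⟨t, ht, by simp, rfl⟩⟩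
  simp only [Finset.mem_filter, Finset.mem_univ, true_and] at hI hmin
  rw [← hI] at hline hmin ⊢
  clear hcv hI
  set v' : I → W := fun i => v i with hv'
  have hirr : ∀ (i : I) (t : I → ℝ), (∀ j, 0 ≤ t j) → t i = 0 → v' i ≠ ∑ j, t j • v' j := by
    intro i t ht hti heq
    have hi : (i : Fin k) ∈ I := i.2
    have hcard := hmin (I.erase i) ?_
    · have := Finset.card_erase_lt_of_mem hi
      omega
    · ext x
      rw [mem_cone_restrict]
      constructor
      · rintro ⟨u, hu, hu0, rfl⟩
        exact mem_cone_restrict.2 ⟨u, hu, fun j hj => hu0 j fun h => hj (Finset.mem_of_mem_erase h),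
          rfl⟩
      · rintro ⟨u, hu, rfl⟩
        set w : I → ℝ := fun j => if j = i then 0 else u j + u i * t j with hw
        have hwsum : ∑ j, u j • v' j = ∑ j, w j • v' j := by
          rw [← Finset.add_sum_erase _ _ (Finset.mem_univ i),
            ← Finset.add_sum_erase Finset.univ (fun j => w j • v' j) (Finset.mem_univ i)]
          have e1 : w i = 0 := by simp [hw]
          have e2 : ∀ j ∈ Finset.univ.erase i, w j • v' j = u j • v' j + u i • (t j • v' j) := by
            intro j hj
            simp [hw, Finset.ne_of_mem_erase hj, add_smul, mul_smul]
          have e3 : ∑ j ∈ Finset.univ.erase i, t j • v' j = v' i := by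
            rw [heq, ← Finset.add_sum_erase Finset.univ (fun j => t j • v' j) (Finset.mem_univ i),
              hti, zero_smul, zero_add]
          rw [Finset.sum_congr rfl e2, Finset.sum_add_distrib, ← Finset.smul_sum, e3, e1, zero_smul,
            zero_add, add_comm]
        rw [hwsum]
        refine ⟨fun j => if hj : j ∈ I then w ⟨j, hj⟩ else 0, fun j => ?_, fun j hj => ?_, ?_⟩
        · simp only [hw]
          split_ifs
          exacts [le_rfl, add_nonneg (hu _) (mul_nonneg (hu _) (ht _)), le_rfl]
        · by_cases hjI : j ∈ I
          · have hji : j = i := by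
              by_contra h
              exact hj (Finset.mem_erase.2 ⟨h, hjI⟩)
            subst hji
            simp [hw]
          · simp [hjI]
        · rw [sum_extend_zero v I fun j hj => by simp [hj]]
          simp [hv']
  have hv0 : ∀ i, v' i ≠ 0 := fun i h =>
    hirr i 0 (fun _ => le_rfl) rfl (by simpa using h)
  -- a nonnegative relation between the generators would produce a line
  have hrel : ∀ t : I → ℝ, (∀ i, 0 ≤ t i) → ∑ i, t i • v' i = 0 → t = 0 := by
    intro t ht hsum
    by_contra hne
    obtain ⟨j, hj⟩ := Function.ne_iff.1 hne
    have hj0 : 0 < t j := lt_of_le_of_ne (ht j) (Ne.symm hj)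
    exact hline ⟨s, v' j, hv0 j, fun r =>
      ⟨r • v' j, smul_mem_cone_of_relation ht hsum hj0 r, rfl⟩⟩
  choose c hc hcΛ hprim using fun i : I => exists_primitive Λ (hv i) (hv0 i)
  obtain ⟨l, hl⟩ := exists_neg_form hrel
  refine ⟨I, inferInstance, s, fun i => c i • v' i, hs, by rw [cone_smul hc], ?_⟩
  refine ⟨hcΛ, hprim, ⟨l, fun i => ?_⟩, fun i => ?_⟩
  · rw [map_smul, smul_eq_mul]
    exact mul_neg_of_pos_of_neg (hc i) (hl i)
  · obtain ⟨l', h1, h2⟩ := exists_edge_form hrel i (hirr i)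
    refine ⟨l', by rw [map_smul, h1, smul_zero], fun j hj => ?_⟩
    rw [map_smul, smul_eq_mul]
    exact mul_neg_of_pos_of_neg (hc j) (h2 j hj)

end Polyhedral

/-! ### The ring of germs with rational Taylor coefficients -/

section RationalGerms

variable {W : Type*} [NormedAddCommGroup W] [NormedSpace ℝ W]

theorem RatAnalytic.congr {Λ : Submodule ℤ W} {f g : StrongDual ℝ W → ℝ} (hf : RatAnalytic Λ f)
    (h : f =ᶠ[𝓝 0] g) : RatAnalytic Λ g := by
  refine ⟨hf.1.congr h, fun n η hη => ?_⟩
  rw [← (h.iteratedFDeriv ℝ n).eq_of_nhds]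
  exact hf.2 n η hη

/-- The ring of germs at `0` of analytic functions with rational Taylor coefficients. -/
def rationalGerms (Λ : Submodule ℤ W) : Subring (AnalyticGerm (StrongDual ℝ W)) where
  carrier := {φ | ∃ (f : StrongDual ℝ W → ℝ) (hf : RatAnalytic Λ f), φ = AnalyticGerm.mk f hf.1}
  mul_mem' := by
    rintro _ _ ⟨f, hf, rfl⟩ ⟨g, hg, rfl⟩
    exact ⟨f * g, hf.mul hg, rfl⟩
  one_mem' := by
    have := RatAnalytic.const (Λ := Λ) 1
    simp only [Rat.cast_one] at this
    exact ⟨_, this, rfl⟩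
  add_mem' := by
    rintro _ _ ⟨f, hf, rfl⟩ ⟨g, hg, rfl⟩
    exact ⟨f + g, hf.add hg, rfl⟩
  zero_mem' := by
    have := RatAnalytic.const (Λ := Λ) 0
    simp only [Rat.cast_zero] at this
    exact ⟨_, this, rfl⟩
  neg_mem' := by
    rintro _ ⟨f, hf, rfl⟩
    have := (RatAnalytic.const (Λ := Λ) 0).sub hf
    refine ⟨_, this, ?_⟩
    have h0 : AnalyticGerm.mk ((fun _ => ((0 : ℚ) : ℝ)) - f) this.1 =
        AnalyticGerm.mk (fun _ => ((0 : ℚ) : ℝ)) analyticAt_const - AnalyticGerm.mk f hf.1 := rfl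
    have h1 : AnalyticGerm.mk (fun _ : StrongDual ℝ W => ((0 : ℚ) : ℝ)) analyticAt_const = 0 := by
      rw [AnalyticGerm.mk_eq_zero]
      exact Eventually.of_forall fun _ => Rat.cast_zero
    rw [h0, h1, zero_sub]

theorem mk_mem_rationalGerms {Λ : Submodule ℤ W} {f : StrongDual ℝ W → ℝ} (hf : RatAnalytic Λ f) :
    AnalyticGerm.mk f hf.1 ∈ rationalGerms Λ :=
  ⟨f, hf, rfl⟩

theorem expGerm_mem_rationalGerms {Λ : Submodule ℤ W} {x : W} (hx : IsRationalPoint Λ x) :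
    expGerm x ∈ rationalGerms Λ :=
  ⟨_, RatAnalytic.exp hx, rfl⟩

theorem rationalGerms_prop {Λ : Submodule ℤ W} {φ : AnalyticGerm (StrongDual ℝ W)}
    (h : φ ∈ rationalGerms Λ) : ∃ f : StrongDual ℝ W → ℝ, AnalyticAt ℝ f 0 ∧ HasRationalTaylor Λ f ∧
      φ.1 = (f : Germ (𝓝 (0 : StrongDual ℝ W)) ℝ) := by
  obtain ⟨f, hf, rfl⟩ := h
  exact ⟨f, hf.1, hf.2, rfl⟩

theorem mem_rationalGerms_of_prop {Λ : Submodule ℤ W} (φ : RationalAnalyticGerm Λ) :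
    φ.1 ∈ rationalGerms Λ := by
  obtain ⟨f, h1, h2, h3⟩ := φ.2
  exact ⟨f, ⟨h1, h2⟩, Subtype.ext h3⟩

theorem mem_rationalGerms_of_one_sub_mul {Λ : Submodule ℤ W} {v : W} (hv : IsRationalPoint Λ v)
    (hw : ∃ w : StrongDual ℝ W, IsDualIntegral Λ w ∧ w v ≠ 0)
    {φ : AnalyticGerm (StrongDual ℝ W)} (h : (1 - expGerm v) * φ ∈ rationalGerms Λ) :
    φ ∈ rationalGerms Λ := by
  obtain ⟨g, hg, rfl⟩ := AnalyticGerm.exists_mk φ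
  obtain ⟨f, hf, hfg⟩ := h
  refine ⟨g, RatAnalytic.of_one_sub_exp_mul hv hw hg (hf.congr ?_), rfl⟩
  rw [one_sub_expGerm_eq_mk, AnalyticGerm.mk_mul, AnalyticGerm.mk_eq_mk] at hfg
  exact hfg.symm

theorem mem_rationalGerms_of_prod_mul {Λ : Submodule ℤ W} {ι : Type*} {v : ι → W}
    (hv : ∀ i, IsRationalPoint Λ (v i))
    (hw : ∀ i, ∃ w : StrongDual ℝ W, IsDualIntegral Λ w ∧ w (v i) ≠ 0) (s : Finset ι)
    {φ : AnalyticGerm (StrongDual ℝ W)}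
    (h : (∏ i ∈ s, (1 - expGerm (v i))) * φ ∈ rationalGerms Λ) : φ ∈ rationalGerms Λ := by
  classical
  induction s using Finset.induction_on with
  | empty => simpa using h
  | insert i s hi ih =>
    rw [Finset.prod_insert hi, mul_assoc] at h
    exact ih (mem_rationalGerms_of_one_sub_mul (hv i) (hw i) h)

theorem pullbackHom_mem_rationalGerms {W' : Type*} [NormedAddCommGroup W'] [NormedSpace ℝ W']
    {Λ : Submodule ℤ W} {Λ' : Submodule ℤ W'} (P : StrongDual ℝ W →L[ℝ] StrongDual ℝ W')
    (hP : ∀ η, IsDualIntegral Λ η → ∃ m : ℤ, m ≠ 0 ∧ IsDualIntegral Λ' (m • P η))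
    {φ : AnalyticGerm (StrongDual ℝ W')} (hφ : φ ∈ rationalGerms Λ') :
    pullbackHom P φ ∈ rationalGerms Λ := by
  obtain ⟨f, hf, rfl⟩ := hφ
  exact ⟨_, hf.comp_clm P hP, rfl⟩

end RationalGerms

/-! ### Cancellation of poles -/

section RegularPart

/-- Removal of poles: if the residues of `S` along the divisors `d i` agree with those of the sum of
the `τ f * I f`, for `f` in a set `p`, then `S` differs from this sum by a regular element. The
ring `R` keeps track of rationality. -/
theorem exists_regular_part {A : Type*} [CommRing A] [IsDomain A] {ι F : Type*} [Fintype ι]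
    [Fintype F] {B : ι → Type*} [∀ i, CommRing (B i)] [∀ i, IsDomain (B i)]
    (c : ∀ i, A →+* B i) (d : ι → A) (hd : ∀ i, d i ≠ 0)
    (hdvd : ∀ i, ∀ φ, c i φ = 0 → d i ∣ φ) (R : Subring A) (S : FractionRing A) (τ : F → A)
    (I : F → FractionRing A) (p : F → Prop) [DecidablePred p]
    (hS : ∃ σ ∈ R, algebraMap _ _ (∏ i, d i) * S = algebraMap _ _ σ)
    (hI : ∀ f, ∃ ρ ∈ R, algebraMap _ _ (∏ i, d i) * I f = algebraMap _ _ ρ) (hτ : ∀ f, τ f ∈ R)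
    (hres : ∀ i, ∃ N : F → FractionRing (B i),
      (∀ f, p f → Specializes (c i) (algebraMap _ _ (d i) * I f) (N f)) ∧
      Specializes (c i) (algebraMap _ _ (d i) * S)
        (∑ f with p f, algebraMap _ _ (c i (τ f)) * N f)) :
    ∃ ψ : A, (∏ i, d i) * ψ ∈ R ∧
      S = (∑ f with p f, algebraMap _ _ (τ f) * I f) + algebraMap _ _ ψ := by
  obtain ⟨σ, hσR, hσ⟩ := hS
  choose ρ hρR hρ using hI
  set M : FractionRing A := S - ∑ f with p f, algebraMap _ _ (τ f) * I f with hM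
  have hφ : algebraMap _ _ (∏ i, d i) * M =
      algebraMap _ _ (σ - ∑ f with p f, τ f * ρ f) := by
    rw [hM, mul_sub, hσ, Finset.mul_sum, map_sub, map_sum]
    congr 1
    refine Finset.sum_congr rfl fun f _ => ?_
    rw [mul_left_comm, hρ, map_mul]
  obtain ⟨ψ, hψ⟩ := exists_eq_algebraMap_of_residues Finset.univ c d (fun i _ => hd i)
    (fun i _ => hdvd i) M (fun i _ => by
      obtain ⟨N, hN, hSN⟩ := hres i
      have h1 : Specializes (c i) (∑ f with p f, algebraMap _ _ (τ f) * (algebraMap _ _ (d i) * I f))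
          (∑ f with p f, algebraMap _ _ (c i (τ f)) * N f) :=
        Specializes.sum _ fun f hf =>
          (Specializes.of_algebraMap (τ f)).mul (hN f (Finset.mem_filter.1 hf).2)
      have h2 := hSN.sub h1
      rw [sub_self] at h2
      convert h2 using 1
      rw [hM, mul_sub, Finset.mul_sum]
      congr 1
      exact Finset.sum_congr rfl fun f _ => mul_left_comm _ _ _) _ hφ
  refine ⟨ψ, ?_, by rw [← hψ, hM]; ring⟩
  have h3 : (∏ i, d i) * ψ = σ - ∑ f with p f, τ f * ρ f := by
    apply FaithfulSMul.algebraMap_injective A (FractionRing A)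
    rw [map_mul, ← hψ, hφ]
  rw [h3]
  exact R.sub_mem hσR (R.sum_mem fun f _ => R.mul_mem (hτ f) (hρR f))

end RegularPart

/-! ### Existence and uniqueness of `S` and `I` -/

section WellDefined

variable {W : Type*} [NormedAddCommGroup W] [NormedSpace ℝ W]

theorem expSum_eq_zero {Λ : Submodule ℤ W} {a : Set W} (h : ContainsLine a) :
    expSum Λ a = 0 := by
  have hex : ∃ m, IsExpSum Λ a m := ⟨0, fun _ => rfl, fun h' => absurd h h'⟩
  rw [expSum, dif_pos hex]
  exact hex.choose_spec.1 h

variable [FiniteDimensional ℝ W]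

theorem expIntegral_eq_zero {Λ : Submodule ℤ W} {a : Set W} (h : ContainsLine a) :
    expIntegral Λ a = 0 := by
  have hex : ∃ m, IsExpIntegral Λ a m := ⟨0, fun _ => rfl, fun h' => absurd h h'⟩
  rw [expIntegral, dif_pos hex]
  exact hex.choose_spec.1 h

theorem existsUnique_isExpSum {Λ : Submodule ℤ W} [DiscreteTopology Λ] {a : Set W}
    (ha : IsAffineCone Λ a) : ∃! m, IsExpSum Λ a m := by
  by_cases h : ContainsLine a
  · exact ⟨0, ⟨fun _ => rfl, fun h' => absurd h h'⟩, fun m hm => hm.1 h⟩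
  · obtain ⟨ι, _, s, v, hs, rfl, hv⟩ := exists_edgeSystem ha h
    obtain ⟨l, hl⟩ := hv.exists_neg
    obtain ⟨r, hr⟩ := exists_rank ι
    have h1 := isExpSum_cone Λ hr s hv.mem hl
    exact ⟨_, h1, fun m hm => IsExpSum.unique Λ s hl hm h1⟩

theorem existsUnique_isExpIntegral {Λ : Submodule ℤ W} [DiscreteTopology Λ] {a : Set W}
    (ha : IsAffineCone Λ a) : ∃! m, IsExpIntegral Λ a m := by
  by_cases h : ContainsLine a
  · exact ⟨0, ⟨fun _ => rfl, fun h' => absurd h h'⟩, fun m hm => hm.1 h⟩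
  · obtain ⟨ι, _, s, v, hs, rfl, hv⟩ := exists_edgeSystem ha h
    obtain ⟨l, hl⟩ := hv.exists_neg
    obtain ⟨r, hr⟩ := exists_rank ι
    have h1 := isExpIntegral_cone Λ hr hs hv.mem hl
    exact ⟨_, h1, fun m hm => IsExpIntegral.unique Λ hv.mem hl hm h1⟩

theorem expIntegral_singleton (Λ : Submodule ℤ W) [DiscreteTopology Λ] {s : W}
    (hs : IsRationalPoint Λ s) : expIntegral Λ {s} = algebraMap _ _ (expGerm s) := by
  have h0 : ({s} : Set W) = (fun y => s + y) '' cone (fun i : Empty => i.elim) := by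
    ext x
    simp [cone]
  obtain ⟨r, hr⟩ := exists_rank Empty
  rw [h0, expIntegral_cone (l := 0) Λ hr hs (fun i => i.elim) (fun i => i.elim)]
  have h1 : topSimplices r (fun i : Empty => (i.elim : W)) = {∅} := by
    ext I
    obtain rfl : I = ∅ := Subsingleton.elim _ _
    simp only [mem_topSimplices, Finset.mem_singleton, iff_true]
    refine ⟨fun d _ _ => fun ⟨i, _⟩ => i.elim, ?_⟩
    rw [Set.range_eq_empty]
    simp
  have h2 : latticeIndex Λ (fun i : Empty => (i.elim : W)) ∅ = 1 := by
    simp [latticeIndex]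
  simp [fracSum, h1, boxIntegralGerm, h2]

theorem expSum_zero (Λ : Submodule ℤ W) [DiscreteTopology Λ] : expSum Λ ({0} : Set W) = 1 := by
  have h0 : ({0} : Set W) = (fun y => 0 + y) '' cone (fun i : Empty => i.elim) := by
    ext x
    simp [cone]
  obtain ⟨r, hr⟩ := exists_rank Empty
  rw [h0, expSum_cone (l := 0) Λ hr 0 (fun i => i.elim) (fun i => i.elim)]
  have h1 : simplices r (fun i : Empty => (i.elim : W)) = {∅} := by
    ext I
    obtain rfl : I = ∅ := Subsingleton.elim _ _
    simp only [mem_simplices, Finset.mem_singleton, iff_true]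
    exact fun d _ _ => fun ⟨i, _⟩ => i.elim
  have h2 : boxPoints Λ 0 (fun i : Empty => (i.elim : W)) ∅ = {0} := by
    ext x
    rw [mem_boxPoints]
    simp only [box, Finset.mem_singleton]
    constructor
    · rintro ⟨⟨t, -, -, rfl⟩, -⟩
      simp
    · rintro rfl
      exact ⟨⟨0, by simp, by simp, by simp⟩, Λ.zero_mem⟩
  simp [fracSum, h1, boxSumGerm_eq, h2, expGerm_zero]

end WellDefined

/-! ### Transverse cones along edges -/

section GenericProjection

variable {W W' : Type*} [NormedAddCommGroup W] [NormedSpace ℝ W]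
  [NormedAddCommGroup W'] [NormedSpace ℝ W'] [FiniteDimensional ℝ W'] (π : W →L[ℝ] W')

/-- The linear form defining a face is constant on the face. -/
theorem apply_eq_zero_of_mem_vectorSpan {p f : Set W} {l : StrongDual ℝ W}
    (hf : f = {x | x ∈ p ∧ ∀ y ∈ p, l y ≤ l x}) {u : W} (hu : u ∈ vectorSpan ℝ f) : l u = 0 := by
  have hle : vectorSpan ℝ f ≤ LinearMap.ker l.toLinearMap := by
    rw [vectorSpan_def, Submodule.span_le]
    rintro _ ⟨x, hx, y, hy, rfl⟩
    rw [hf] at hx hy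
    have : l x = l y := le_antisymm (hy.2 x hx.1) (hx.2 y hy.1)
    simp [this]
  simpa using hle hu

theorem image_argmax {p : Set W} {l : StrongDual ℝ W} {l' : StrongDual ℝ W'}
    (h : ∀ x, l' (π x) = l x) :
    π '' {x | x ∈ p ∧ ∀ y ∈ p, l y ≤ l x} = {x | x ∈ π '' p ∧ ∀ y ∈ π '' p, l' y ≤ l' x} := by
  ext y
  constructor
  · rintro ⟨x, ⟨hx, hmax⟩, rfl⟩
    refine ⟨⟨x, hx, rfl⟩, ?_⟩
    rintro _ ⟨z, hz, rfl⟩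
    rw [h, h]
    exact hmax z hz
  · rintro ⟨⟨x, hx, rfl⟩, hmax⟩
    refine ⟨x, ⟨hx, fun z hz => ?_⟩, rfl⟩
    rw [← h, ← h]
    exact hmax _ ⟨z, hz, rfl⟩

variable {π}

/-- A face is recovered from its image modulo one of its directions. -/
theorem face_eq_inter_preimage (hπ : Function.Surjective π) {u : W}
    (hker : ∀ x, π x = 0 ↔ ∃ c : ℝ, x = c • u)
    {p : Set W} (f : Face p) (hu : u ∈ vectorSpan ℝ f.1) : f.1 = p ∩ π ⁻¹' (π '' f.1) := by
  obtain ⟨l, hl⟩ := f.2.2 f.2.1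
  obtain ⟨l', h'⟩ := exists_comp_eq_of_apply_eq_zero π hπ hker
    (apply_eq_zero_of_mem_vectorSpan hl hu)
  ext x
  constructor
  · intro hx
    have hx' := hx
    rw [hl] at hx'
    exact ⟨hx'.1, x, hx, rfl⟩
  · rintro ⟨hx, y, hy, hyx⟩
    rw [hl] at hy ⊢
    refine ⟨hx, fun z hz => ?_⟩
    rw [← h' x, ← hyx, h']
    exact hy.2 z hz

/-- The image of a face modulo one of its directions. -/
noncomputable def imageFace (hπ : Function.Surjective π) {u : W}
    (hker : ∀ x, π x = 0 ↔ ∃ c : ℝ, x = c • u)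
    {p : Set W} (f : Face p) (hu : u ∈ vectorSpan ℝ f.1) : Face (π '' p) :=
  ⟨π '' f.1, f.2.1.image _, fun _ => by
    obtain ⟨l, hl⟩ := f.2.2 f.2.1
    obtain ⟨l', h'⟩ := exists_comp_eq_of_apply_eq_zero π hπ hker
      (apply_eq_zero_of_mem_vectorSpan hl hu)
    refine ⟨l', ?_⟩
    conv_lhs => rw [hl]
    exact image_argmax π h'⟩

theorem mem_vectorSpan_formFace {ι : Type*} [Fintype ι] {s : W} {v : ι → W} {l : StrongDual ℝ W}
    (hl : ∀ i, l (v i) ≤ 0) (i : ι) :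
    v i ∈ vectorSpan ℝ (formFace s v l hl).1 ↔ l (v i) = 0 := by
  constructor
  · intro h
    exact apply_eq_zero_of_mem_vectorSpan (argmax_cone hl).symm h
  · intro h
    rw [formFace, vectorSpan_cone]
    exact Submodule.subset_span ⟨⟨i, mem_zeroSet.2 h⟩, rfl⟩

/-- All faces of the transverse cone along an edge come from faces through that edge. -/
theorem exists_imageFace_eq {ι : Type*} [Fintype ι] (hπ : Function.Surjective π) {s : W}
    {v : ι → W} {i : ι} (hker : ∀ x, π x = 0 ↔ ∃ c : ℝ, x = c • v i)
    (g : Face (π '' ((fun y => s + y) '' cone v))) :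
    ∃ (f : Face ((fun y => s + y) '' cone v)) (hf : v i ∈ vectorSpan ℝ f.1),
      imageFace hπ hker f hf = g := by
  obtain ⟨l', hl'⟩ := g.2.2 g.2.1
  set l : StrongDual ℝ W := l'.comp π with hl
  have himg := image_argmax π (p := (fun y => s + y) '' cone v) (l := l) (l' := l') fun x => rfl
  rw [← hl'] at himg
  have hne : {x | x ∈ (fun y => s + y) '' cone v ∧
      ∀ y ∈ (fun y => s + y) '' cone v, l y ≤ l x}.Nonempty := by
    rw [← Set.image_nonempty, himg]
    exact g.2.1
  have hlv : ∀ j, l (v j) ≤ 0 := by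
    intro j
    obtain ⟨_, ⟨y, hy, rfl⟩, hmax⟩ := hne
    have := hmax _ ⟨y + v j, add_mem_cone hy (mem_cone_self v j), rfl⟩
    simp only [map_add] at this
    linarith
  have hlvi : l (v i) = 0 := by
    have : π (v i) = 0 := (hker _).2 ⟨1, by simp⟩
    simp [hl, this]
  refine ⟨formFace s v l hlv, (mem_vectorSpan_formFace hlv i).2 hlvi, Subtype.ext ?_⟩
  rw [← himg, argmax_cone hlv]
  rfl

end GenericProjection

section Transverse

variable {V : Type*} [NormedAddCommGroup V] [NormedSpace ℝ V] [FiniteDimensional ℝ V]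
  {Λ : Submodule ℤ V}

/-- The projection `V ⧸ L → V ⧸ M` for `L ≤ M`, as a continuous linear map. -/
noncomputable def factorCLM {L M : Submodule ℝ V} (h : L ≤ M) : (V ⧸ L) →L[ℝ] (V ⧸ M) :=
  (Submodule.factor h).toContinuousLinearMap

theorem factorCLM_mk {L M : Submodule ℝ V} (h : L ≤ M) (x : V) :
    factorCLM h (L.mkQ x) = M.mkQ x := rfl

theorem factorCLM_surjective {L M : Submodule ℝ V} (h : L ≤ M) :
    Function.Surjective (factorCLM h) := by
  intro y
  obtain ⟨x, rfl⟩ := M.mkQ_surjective y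
  exact ⟨L.mkQ x, factorCLM_mk h x⟩

theorem mem_quotLattice_iff_factorCLM {L M : Submodule ℝ V} (h : L ≤ M) (y : V ⧸ M) :
    y ∈ quotLattice Λ M ↔ ∃ x ∈ quotLattice Λ L, factorCLM h x = y := by
  constructor
  · rintro ⟨x, hx, rfl⟩
    exact ⟨L.mkQ x, ⟨x, hx, rfl⟩, rfl⟩
  · rintro ⟨_, ⟨x, hx, rfl⟩, rfl⟩
    exact ⟨x, hx, rfl⟩

theorem factorCLM_faceSubspace_eq_zero (L : RationalSubspace Λ)
    (a : AffineCone (quotLattice Λ L.1)) (f : Face a.1) (x : V ⧸ L.1) :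
    factorCLM (le_faceSubspace L a f) x = 0 ↔ x ∈ vectorSpan ℝ f.1 := by
  obtain ⟨z, rfl⟩ := L.1.mkQ_surjective x
  rw [factorCLM_mk]
  have h1 : (faceSubspace L a f).1.mkQ z = 0 ↔ z ∈ (faceSubspace L a f).1 :=
    Submodule.Quotient.mk_eq_zero _
  exact h1

/-- Affine cones in all rational quotient spaces of `V`. -/
abbrev QuotientCone (Λ : Submodule ℤ V) : Type _ :=
  Σ L : RationalSubspace Λ, AffineCone (quotLattice Λ L.1)

/-- A cone in a rational quotient space is determined by its preimage in `V`. -/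
theorem QuotientCone.ext {c c' : QuotientCone Λ} (h1 : c.1.1 = c'.1.1)
    (h2 : c.1.1.mkQ ⁻¹' c.2.1 = c'.1.1.mkQ ⁻¹' c'.2.1) : c = c' := by
  obtain ⟨⟨L, hL⟩, ⟨a, ha⟩⟩ := c
  obtain ⟨⟨L', hL'⟩, ⟨a', ha'⟩⟩ := c'
  obtain rfl : L = L' := h1
  obtain rfl : a = a' := L.mkQ_surjective.preimage_injective h2
  rfl

/-- The transverse cone of the affine cone `a` along `f`, with its ambient quotient space. -/
noncomputable def transverse (L : RationalSubspace Λ) (a : AffineCone (quotLattice Λ L.1))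
    (f : Face a.1) : QuotientCone Λ :=
  ⟨faceSubspace L a f, transverseCone L a f⟩

theorem mem_preimage_transverse (L : RationalSubspace Λ) (a : AffineCone (quotLattice Λ L.1))
    (f : Face a.1) (x : V) :
    x ∈ (transverse L a f).1.1.mkQ ⁻¹' (transverse L a f).2.1 ↔
      ∃ z, L.1.mkQ z ∈ a.1 ∧ z - x ∈ (faceSubspace L a f).1 := by
  have key : ∀ z, factorCLM (le_faceSubspace L a f) (L.1.mkQ z) = (faceSubspace L a f).1.mkQ x ↔
      z - x ∈ (faceSubspace L a f).1 := by
    intro z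
    rw [factorCLM_mk, ← sub_eq_zero, ← map_sub]
    exact Submodule.Quotient.mk_eq_zero _
  constructor
  · rintro ⟨y, hy, hyx⟩
    obtain ⟨z, rfl⟩ := L.1.mkQ_surjective y
    exact ⟨z, hy, (key z).1 hyx⟩
  · rintro ⟨z, hz, hzx⟩
    exact ⟨L.1.mkQ z, hz, (key z).2 hzx⟩

/-- Transitivity of transverse cones. -/
theorem transverse_transverse (L : RationalSubspace Λ) (a : AffineCone (quotLattice Λ L.1))
    (e f : Face a.1) (hef : vectorSpan ℝ e.1 ≤ vectorSpan ℝ f.1)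
    (g : Face (transverseCone L a e).1) (hg : g.1 = factorCLM (le_faceSubspace L a e) '' f.1) :
    transverse (faceSubspace L a e) (transverseCone L a e) g = transverse L a f := by
  have hspan : vectorSpan ℝ g.1 =
      (vectorSpan ℝ f.1).map (factorCLM (le_faceSubspace L a e)).toLinearMap := by
    rw [hg]
    exact ((factorCLM (le_faceSubspace L a e)).toLinearMap.toAffineMap.map_vectorSpan
      (s := f.1)).symm
  have hsub : (faceSubspace (faceSubspace L a e) (transverseCone L a e) g).1 =
      (faceSubspace L a f).1 := by
    ext x
    have h1 : x ∈ (faceSubspace (faceSubspace L a e) (transverseCone L a e) g).1 ↔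
        factorCLM (le_faceSubspace L a e) (L.1.mkQ x) ∈ vectorSpan ℝ g.1 := Iff.rfl
    have h2 : x ∈ (faceSubspace L a f).1 ↔ L.1.mkQ x ∈ vectorSpan ℝ f.1 := Iff.rfl
    rw [h1, h2, hspan]
    constructor
    · rintro ⟨z, hz, hzx⟩
      have h3 : L.1.mkQ x - z ∈ vectorSpan ℝ e.1 := by
        rw [← factorCLM_faceSubspace_eq_zero L a e, map_sub, sub_eq_zero]
        exact hzx.symm
      simpa using Submodule.add_mem _ (hef h3) hz
    · intro h
      exact ⟨_, h, rfl⟩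
  refine QuotientCone.ext hsub ?_
  ext x
  rw [mem_preimage_transverse, mem_preimage_transverse, hsub]
  constructor
  · rintro ⟨z, ⟨y, hy, hyz⟩, hzx⟩
    obtain ⟨w, rfl⟩ := L.1.mkQ_surjective y
    refine ⟨w, hy, ?_⟩
    have h4 : w - z ∈ (faceSubspace L a e).1 := by
      rw [← Submodule.Quotient.mk_eq_zero]
      have : (faceSubspace L a e).1.mkQ w = (faceSubspace L a e).1.mkQ z := hyz
      have h5 : (faceSubspace L a e).1.mkQ (w - z) = 0 := by rw [map_sub, this, sub_self]
      exact h5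
    have h6 : w - z ∈ (faceSubspace L a f).1 := hef h4
    simpa using Submodule.add_mem _ h6 hzx
  · rintro ⟨z, hz, hzx⟩
    exact ⟨z, ⟨_, hz, rfl⟩, hzx⟩

theorem transverse_eq_self (L : RationalSubspace Λ) (a : AffineCone (quotLattice Λ L.1))
    (f : Face a.1) (hf : (faceSubspace L a f).1 = L.1) : transverse L a f = ⟨L, a⟩ := by
  refine QuotientCone.ext hf ?_
  ext x
  rw [mem_preimage_transverse, hf]
  constructor
  · rintro ⟨z, hz, hzx⟩
    have : L.1.mkQ z = L.1.mkQ x := by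
      rw [← sub_eq_zero, ← map_sub]
      exact (Submodule.Quotient.mk_eq_zero _).2 hzx
    rwa [Set.mem_preimage, ← this]
  · intro hx
    exact ⟨x, hx, by simp⟩

theorem faceSubspace_eq_iff (L : RationalSubspace Λ) (a : AffineCone (quotLattice Λ L.1))
    (f : Face a.1) : (faceSubspace L a f).1 = L.1 ↔ vectorSpan ℝ f.1 = ⊥ := by
  constructor
  · intro h
    rw [eq_bot_iff]
    intro x hx
    obtain ⟨z, rfl⟩ := L.1.mkQ_surjective x
    have : z ∈ (faceSubspace L a f).1 := hx
    rw [h] at this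
    exact (Submodule.Quotient.mk_eq_zero _).2 this
  · intro h
    ext z
    have h2 : z ∈ (faceSubspace L a f).1 ↔ L.1.mkQ z ∈ vectorSpan ℝ f.1 := Iff.rfl
    rw [h2, h, Submodule.mem_bot]
    exact Submodule.Quotient.mk_eq_zero _

variable (Q : RationalScalarProduct Λ)

theorem extendGerm_eq (L L' : Submodule ℝ V) (φ : AnalyticGerm (StrongDual ℝ (V ⧸ L'))) :
    extendGerm Q L L' φ = pullbackHom (dualProj Q L L') φ := rfl

theorem extendGerm_self (L : Submodule ℝ V) (φ : AnalyticGerm (StrongDual ℝ (V ⧸ L))) :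
    extendGerm Q L L φ = φ := by
  rw [extendGerm_eq, dualProj_self, pullbackHom_id, RingHom.id_apply]

/-- Restriction to `M^⊥` of a germ which is extended to `L^⊥` by orthogonal projection. -/
theorem pullbackHom_extendGerm {L M : Submodule ℝ V} (h : L ≤ M) (L' : Submodule ℝ V)
    (φ : AnalyticGerm (StrongDual ℝ (V ⧸ L'))) :
    pullbackHom (dualMapCLM (factorCLM h)) (extendGerm Q L L' φ) = extendGerm Q M L' φ := by
  rw [extendGerm_eq, extendGerm_eq, pullbackHom_pullbackHom]
  have hcomp : (dualProj Q L L').comp (dualMapCLM (factorCLM h)) = dualProj Q M L' := by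
    ext1 ξ
    refine eq_dualProj Q M L' ξ _ fun ζ => ?_
    rw [ContinuousLinearMap.comp_apply, quotForm_dualProj]
    rfl
  rw [hcomp]

theorem extendGerm_mem_rationalGerms [DiscreteTopology Λ] [IsZLattice ℝ Λ] (L : Submodule ℝ V)
    (L' : RationalSubspace Λ) (φ : RationalAnalyticGerm (quotLattice Λ L'.1)) :
    extendGerm Q L L'.1 φ.1 ∈ rationalGerms (quotLattice Λ L) :=
  pullbackHom_mem_rationalGerms _ (fun _ hη => dualProj_rational Q L L'.2 hη)
    (mem_rationalGerms_of_prop φ)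

end Transverse

/-! ### Residues of `S` and `I` for all faces of a pointed cone -/

section EdgeResidues

variable {W W' : Type*} [NormedAddCommGroup W] [NormedSpace ℝ W] [FiniteDimensional ℝ W]
  [NormedAddCommGroup W'] [NormedSpace ℝ W'] [FiniteDimensional ℝ W']
  {Λ : Submodule ℤ W} [DiscreteTopology Λ] {Λ' : Submodule ℤ W'} [DiscreteTopology Λ']
  {ι : Type*} [Fintype ι] {s : W} {v : ι → W} {i : ι} {π : W →L[ℝ] W'}

theorem IsEdgeSystem.ne_zero {W ι : Type*} [NormedAddCommGroup W] [NormedSpace ℝ W]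
    {Λ : Submodule ℤ W} {v : ι → W} (hv : IsEdgeSystem Λ v) (i : ι) : v i ≠ 0 := fun h => by
  obtain ⟨l, hl⟩ := hv.exists_neg
  have := hl i
  rw [h, map_zero] at this
  exact lt_irrefl _ this

theorem IsEdgeSystem.exists_edge_comp (hv : IsEdgeSystem Λ v) (hπ : Function.Surjective π)
    (hker : ∀ x, π x = 0 ↔ ∃ c : ℝ, x = c • v i) :
    ∃ l' : StrongDual ℝ W', ∀ j, j ≠ i → l' (π (v j)) < 0 := by
  obtain ⟨l, hl0, hl⟩ := hv.exists_edge i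
  obtain ⟨l', h'⟩ := exists_comp_eq_of_apply_eq_zero π hπ hker hl0
  exact ⟨l', fun j hj => by rw [h']; exact hl j hj⟩

open Classical in
/-- The residue of `I(f)` along an edge, for a face `f` of a pointed cone: it is `I` of the image of
`f` if the edge is a direction of `f`, and vanishes otherwise. -/
theorem IsEdgeSystem.specializes_expIntegral_face (hv : IsEdgeSystem Λ v)
    (hs : IsRationalPoint Λ s) (hπ : Function.Surjective π)
    (hker : ∀ x, π x = 0 ↔ ∃ c : ℝ, x = c • v i)
    (hΛ' : ∀ y, y ∈ Λ' ↔ ∃ x ∈ Λ, π x = y) (f : Face ((fun y => s + y) '' cone v)) :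
    Specializes (pullbackHom (dualMapCLM π)) (algebraMap _ _ (1 - expGerm (v i)) * expIntegral Λ f.1)
      (if v i ∈ vectorSpan ℝ f.1 then expIntegral Λ' (π '' f.1) else 0) := by
  obtain ⟨l₀, hl₀⟩ := hv.exists_neg
  obtain ⟨l', hl'⟩ := hv.exists_edge_comp hπ hker
  obtain ⟨l, hl, rfl⟩ := exists_eq_formFace f
  rw [mem_vectorSpan_formFace]
  split_ifs with h
  · exact specializes_expIntegral π (v := fun j : zeroSet v l => v j)
      (i := ⟨i, mem_zeroSet.2 h⟩) Λ Λ' hker hΛ' hs (fun j => hv.mem j) (hv.primitive i)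
      (fun j => hl₀ j) (l' := l') (fun j hj => hl' j fun h0 => hj (Subtype.ext h0))
  · refine specializes_expIntegral_zero π (v := fun j : zeroSet v l => v j)
      Λ ((hker _).2 ⟨1, by simp⟩) hs (fun j => hv.mem j) (fun j => hl₀ j) fun j h0 => ?_
    have hj : (j : ι) ≠ i := fun h1 => h (h1 ▸ mem_zeroSet.1 j.2)
    have := hl' j hj
    rw [h0, map_zero] at this
    exact lt_irrefl _ this

theorem IsEdgeSystem.specializes_expSum_edge (hv : IsEdgeSystem Λ v) (hπ : Function.Surjective π)
    (hker : ∀ x, π x = 0 ↔ ∃ c : ℝ, x = c • v i)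
    (hΛ' : ∀ y, y ∈ Λ' ↔ ∃ x ∈ Λ, π x = y) (s : W) :
    Specializes (pullbackHom (dualMapCLM π))
      (algebraMap _ _ (1 - expGerm (v i)) * expSum Λ ((fun y => s + y) '' cone v))
      (expSum Λ' (π '' ((fun y => s + y) '' cone v))) := by
  obtain ⟨l₀, hl₀⟩ := hv.exists_neg
  obtain ⟨l', hl'⟩ := hv.exists_edge_comp hπ hker
  exact specializes_expSum π Λ Λ' hker hΛ' s hv.mem (hv.primitive i) hl₀ hl'

theorem IsEdgeSystem.denominator_mul_expSum (hv : IsEdgeSystem Λ v) (s : W) :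
    ∃ σ ∈ rationalGerms Λ,
      algebraMap _ _ (∏ j, (1 - expGerm (v j))) * expSum Λ ((fun y => s + y) '' cone v) =
        algebraMap _ (MeromorphicGerm (StrongDual ℝ W)) σ := by
  obtain ⟨l₀, hl₀⟩ := hv.exists_neg
  obtain ⟨f, hf, h⟩ := RatCone.denominator_mul_expSum Λ s hv.mem hl₀
  exact ⟨_, mk_mem_rationalGerms hf, h⟩

theorem IsEdgeSystem.denominator_mul_expIntegral (hv : IsEdgeSystem Λ v)
    (hs : IsRationalPoint Λ s) (f : Face ((fun y => s + y) '' cone v)) :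
    ∃ ρ ∈ rationalGerms Λ,
      algebraMap _ _ (∏ j, (1 - expGerm (v j))) * expIntegral Λ f.1 =
        algebraMap _ (MeromorphicGerm (StrongDual ℝ W)) ρ := by
  classical
  obtain ⟨l₀, hl₀⟩ := hv.exists_neg
  obtain ⟨l, hl, rfl⟩ := exists_eq_formFace f
  obtain ⟨g, hg, h⟩ := RatCone.denominator_mul_expIntegral Λ
    (v := fun j : zeroSet v l => v j) hs (fun j => hv.mem j) (fun j => hl₀ j)
  refine ⟨(∏ i ∈ (zeroSet v l)ᶜ, (1 - expGerm (v i))) * AnalyticGerm.mk g hg.1,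
    Subring.mul_mem _ (Subring.prod_mem _ fun i _ => Subring.sub_mem _ (Subring.one_mem _)
      (expGerm_mem_rationalGerms (isRationalPoint_of_mem (hv.mem i))))
      (mk_mem_rationalGerms hg), ?_⟩
  have h1 : (formFace s v l hl).1 = (fun y => s + y) '' cone (fun j : zeroSet v l => v j) := rfl
  have h2 : ∏ j, (1 - expGerm (v j)) = (∏ i ∈ (zeroSet v l)ᶜ, (1 - expGerm (v i))) *
      ∏ j : zeroSet v l, (1 - expGerm (v j)) := by
    rw [Finset.prod_coe_sort (zeroSet v l)
      fun j => (1 - expGerm (v j) : AnalyticGerm (StrongDual ℝ W))]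
    exact (Finset.prod_compl_mul_prod _ _).symm
  rw [h1, h2, map_mul, mul_assoc, h, ← map_mul]

open Classical in
/-- The faces of the transverse cone along an edge are the images of the faces which have this edge
as a direction. -/
theorem sum_face_image {R : Type*} [CommRing R] (hπ : Function.Surjective π)
    (hker : ∀ x, π x = 0 ↔ ∃ c : ℝ, x = c • v i)
    [Fintype (Face ((fun y => s + y) '' cone v))]
    [Fintype (Face (π '' ((fun y => s + y) '' cone v)))]
    (τ : Face ((fun y => s + y) '' cone v) → R)
    (τ' : Face (π '' ((fun y => s + y) '' cone v)) → R) (N : Set W' → R)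
    (p : Face ((fun y => s + y) '' cone v) → Prop) [DecidablePred p]
    (hp : ∀ f, v i ∈ vectorSpan ℝ f.1 → p f)
    (hτ : ∀ (f : Face ((fun y => s + y) '' cone v)) (hf : v i ∈ vectorSpan ℝ f.1),
      τ' (imageFace hπ hker f hf) = τ f) :
    ∑ g, τ' g * N g.1 = ∑ f : Face ((fun y => s + y) '' cone v) with p f,
      τ f * (if v i ∈ vectorSpan ℝ f.1 then N (π '' f.1) else 0) := by
  have hsub : (Finset.univ.filter
      fun f : Face ((fun y => s + y) '' cone v) => v i ∈ vectorSpan ℝ f.1) ⊆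
      Finset.univ.filter p :=
    Finset.monotone_filter_right _ fun f _ hf => hp f hf
  rw [← Finset.sum_subset hsub fun f _ hf => by
    have : v i ∉ vectorSpan ℝ f.1 := by simpa using hf
    rw [if_neg this, mul_zero]]
  symm
  refine Finset.sum_bij (fun f hf => imageFace hπ hker f (Finset.mem_filter.1 hf).2) ?_ ?_ ?_ ?_
  · intro f hf
    exact Finset.mem_univ _
  · intro f hf g hg hfg
    have hfg' : π '' f.1 = π '' g.1 := congrArg Subtype.val hfg
    refine Subtype.ext ?_
    rw [face_eq_inter_preimage hπ hker f (Finset.mem_filter.1 hf).2,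
      face_eq_inter_preimage hπ hker g (Finset.mem_filter.1 hg).2, hfg']
  · intro g _
    obtain ⟨f, hf, hfg⟩ := exists_imageFace_eq hπ hker g
    exact ⟨f, Finset.mem_filter.2 ⟨Finset.mem_univ _, hf⟩, hfg⟩
  · intro f hf
    rw [if_pos (Finset.mem_filter.1 hf).2, hτ]
    rfl

end EdgeResidues

/-! ### The local Euler–Maclaurin formula -/

section EulerMaclaurin

variable {V : Type*} [NormedAddCommGroup V] [NormedSpace ℝ V] [FiniteDimensional ℝ V]
  {Λ : Submodule ℤ V} (Q : RationalScalarProduct Λ)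

/-- The germ which a family `μ` attaches to a cone in a quotient of `V ⧸ L`, extended to `L^⊥`. -/
noncomputable def extendedLocal
    (μ : ∀ L : RationalSubspace Λ,
      AffineCone (quotLattice Λ L.1) → RationalAnalyticGerm (quotLattice Λ L.1))
    (L : Submodule ℝ V) (c : QuotientCone Λ) : AnalyticGerm (StrongDual ℝ (V ⧸ L)) :=
  extendGerm Q L c.1.1 (μ c.1 c.2).1

/-- The Euler–Maclaurin formula `S(a) = ∑ μ(t(a,f)) I(f)` for the affine cone `a` in `V ⧸ L`. -/
def EulerMaclaurin
    (μ : ∀ L : RationalSubspace Λ,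
      AffineCone (quotLattice Λ L.1) → RationalAnalyticGerm (quotLattice Λ L.1))
    (L : RationalSubspace Λ) (a : AffineCone (quotLattice Λ L.1)) : Prop :=
  ∃ _ : Fintype (Face a.1),
    expSum (quotLattice Λ L.1) a.1 =
      ∑ f : Face a.1,
        algebraMap _ (MeromorphicGerm (StrongDual ℝ (V ⧸ L.1)))
          (extendedLocal Q μ L.1 (transverse L a f)) * expIntegral (quotLattice Λ L.1) f.1

theorem finite_face {W : Type*} [NormedAddCommGroup W] [NormedSpace ℝ W] {Λ : Submodule ℤ W}
    (a : AffineCone Λ) : Finite (Face a.1) := by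
  obtain ⟨a, s, _, -, ⟨k, v, -, rfl⟩, rfl⟩ := a
  exact finite_face_cone s v

theorem formFace_eq_singleton {W ι : Type*} [NormedAddCommGroup W] [NormedSpace ℝ W] [Fintype ι]
    {s : W} {v : ι → W} {l : StrongDual ℝ W} (hl : ∀ i, l (v i) < 0) :
    (formFace s v l fun i => (hl i).le).1 = {s} := by
  have : IsEmpty (zeroSet v l) := ⟨fun i => (hl i).ne (mem_zeroSet.1 i.2)⟩
  ext x
  simp [formFace, cone]

/-- A pointed affine cone has exactly one vertex. -/
theorem exists_vertex {W : Type*} [NormedAddCommGroup W] [NormedSpace ℝ W]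
    [FiniteDimensional ℝ W] {Λ : Submodule ℤ W} [DiscreteTopology Λ] (a : AffineCone Λ)
    (ha : ¬ ContainsLine a.1) :
    ∃ (s : W) (f₀ : Face a.1), IsRationalPoint Λ s ∧ f₀.1 = {s} ∧
      ∀ f : Face a.1, vectorSpan ℝ f.1 = ⊥ ↔ f = f₀ := by
  obtain ⟨a, hc⟩ := a
  obtain ⟨ι, _, s, v, hs, rfl, hv⟩ := exists_edgeSystem hc ha
  obtain ⟨l₀, hl₀⟩ := hv.exists_neg
  refine ⟨s, formFace s v l₀ fun i => (hl₀ i).le, hs, formFace_eq_singleton hl₀, fun f => ?_⟩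
  constructor
  · intro h
    obtain ⟨l, hl, rfl⟩ := exists_eq_formFace f
    have hlt : ∀ i, l (v i) < 0 := fun i => lt_of_le_of_ne (hl i) fun h0 => by
      have h1 := (mem_vectorSpan_formFace (s := s) hl i).2 h0
      rw [h, Submodule.mem_bot] at h1
      have h2 := hl₀ i
      rw [h1, map_zero] at h2
      exact lt_irrefl _ h2
    exact Subtype.ext ((formFace_eq_singleton hlt).trans (formFace_eq_singleton hl₀).symm)
  · rintro rfl
    rw [formFace_eq_singleton hl₀, vectorSpan_singleton]

/-- The transverse cone of a pointed cone along an edge, as a cone in some `V ⧸ M`. By transitivity,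
its transverse cones are transverse cones of the original cone. -/
theorem IsEdgeSystem.exists_transverse (L : RationalSubspace Λ) {ι : Type*} [Fintype ι]
    {s : V ⧸ L.1} {v : ι → V ⧸ L.1} (hv : IsEdgeSystem (quotLattice Λ L.1) v)
    (ha : IsAffineCone (quotLattice Λ L.1) ((fun y => s + y) '' cone v)) (i : ι) :
    ∃ (M : RationalSubspace Λ) (h : L.1 < M.1)
      (hb : IsAffineCone (quotLattice Λ M.1) (factorCLM h.le '' ((fun y => s + y) '' cone v))),
      (∀ x, factorCLM h.le x = 0 ↔ ∃ c : ℝ, x = c • v i) ∧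
      ∀ f : Face ((fun y => s + y) '' cone v), v i ∈ vectorSpan ℝ f.1 →
        ∀ g : Face (factorCLM h.le '' ((fun y => s + y) '' cone v)), g.1 = factorCLM h.le '' f.1 →
          transverse M ⟨_, hb⟩ g = transverse L ⟨_, ha⟩ f := by
  obtain ⟨l, hl0, hl⟩ := hv.exists_edge i
  have hle : ∀ j, l (v j) ≤ 0 := fun j => by
    by_cases h : j = i
    · rw [h, hl0]
    · exact (hl j h).le
  have hespan : vectorSpan ℝ (formFace s v l hle).1 = Submodule.span ℝ {v i} := by
    have h1 : (formFace s v l hle).1 =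
      (fun y => s + y) '' cone (fun j : zeroSet v l => v j) := rfl
    rw [h1, vectorSpan_cone]
    congr 1
    ext x
    constructor
    · rintro ⟨j, rfl⟩
      have : (j : ι) = i := by
        by_contra h
        exact (hl j h).ne (mem_zeroSet.1 j.2)
      exact congrArg v this
    · rintro rfl
      exact ⟨⟨i, mem_zeroSet.2 hl0⟩, rfl⟩
  generalize formFace s v l hle = e at hespan
  have hlt : L.1 < (faceSubspace L ⟨_, ha⟩ e).1 := by
    refine lt_of_le_of_ne (le_faceSubspace L ⟨_, ha⟩ e) fun h => hv.ne_zero i ?_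
    have h1 := (faceSubspace_eq_iff L ⟨_, ha⟩ e).1 h.symm
    rw [hespan] at h1
    exact Submodule.span_singleton_eq_bot.1 h1
  refine ⟨faceSubspace L ⟨_, ha⟩ e, hlt, (transverseCone L ⟨_, ha⟩ e).2, fun x => ?_,
    fun f hf g hg => ?_⟩
  · have h1 : factorCLM hlt.le x = 0 ↔ x ∈ vectorSpan ℝ e.1 :=
      factorCLM_faceSubspace_eq_zero L ⟨_, ha⟩ e x
    rw [h1, hespan, Submodule.mem_span_singleton]
    exact exists_congr fun c => eq_comm
  · refine transverse_transverse L ⟨_, ha⟩ e f ?_ g hg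
    rw [hespan, Submodule.span_singleton_le_iff_mem]
    exact hf

variable [DiscreteTopology Λ] [IsZLattice ℝ Λ]
  (μ : ∀ L : RationalSubspace Λ,
    AffineCone (quotLattice Λ L.1) → RationalAnalyticGerm (quotLattice Λ L.1))

set_option maxHeartbeats 2000000 in
open Classical in
/-- The Euler–Maclaurin formula for the transverse cone along an edge expresses the residue of `S(a)`
in terms of the residues of the `I(f)`. -/
theorem IsEdgeSystem.exists_specializes (L : RationalSubspace Λ) {ι : Type*} [Fintype ι]
    {s : V ⧸ L.1} {v : ι → V ⧸ L.1} (hv : IsEdgeSystem (quotLattice Λ L.1) v)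
    (hs : IsRationalPoint (quotLattice Λ L.1) s)
    (ha : IsAffineCone (quotLattice Λ L.1) ((fun y => s + y) '' cone v))
    [Fintype (Face ((fun y => s + y) '' cone v))]
    (IH : ∀ M : RationalSubspace Λ, L.1 < M.1 → ∀ b, EulerMaclaurin Q μ M b) (i : ι) :
    ∃ (M : RationalSubspace Λ) (c : AnalyticGerm (StrongDual ℝ (V ⧸ L.1)) →+*
        AnalyticGerm (StrongDual ℝ (V ⧸ M.1))),
      (∀ φ, c φ = 0 → 1 - expGerm (v i) ∣ φ) ∧
      ∃ N : Face ((fun y => s + y) '' cone v) → MeromorphicGerm (StrongDual ℝ (V ⧸ M.1)),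
        (∀ f, Specializes c
          (algebraMap _ _ (1 - expGerm (v i)) * expIntegral (quotLattice Λ L.1) f.1) (N f)) ∧
        Specializes c (algebraMap _ _ (1 - expGerm (v i)) *
            expSum (quotLattice Λ L.1) ((fun y => s + y) '' cone v))
          (∑ f : Face ((fun y => s + y) '' cone v) with vectorSpan ℝ f.1 ≠ ⊥,
            algebraMap _ _ (c (extendedLocal Q μ L.1 (transverse L ⟨_, ha⟩ f))) * N f) := by
  have hdisc := discreteTopology_quotLattice Λ L.2
  obtain ⟨M, hLM, hb, hker, htrans⟩ := hv.exists_transverse L ha i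
  have hdisc' := discreteTopology_quotLattice Λ M.2
  have hsurj := factorCLM_surjective hLM.le
  have hΛ' := mem_quotLattice_iff_factorCLM (Λ := Λ) hLM.le
  refine ⟨M, pullbackHom (dualMapCLM (factorCLM hLM.le)),
    one_sub_expGerm_dvd _ hsurj (hv.ne_zero i) hker,
    fun f => if v i ∈ vectorSpan ℝ f.1 then
      expIntegral (quotLattice Λ M.1) (factorCLM hLM.le '' f.1) else 0,
    fun f => hv.specializes_expIntegral_face hs hsurj hker hΛ' f, ?_⟩
  have h1 := hv.specializes_expSum_edge hsurj hker hΛ' s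
  obtain ⟨hfin, h2⟩ := IH M hLM ⟨_, hb⟩
  dsimp only at hfin h2
  rw [h2, sum_face_image hsurj hker
    (fun f => algebraMap _ _ (pullbackHom (dualMapCLM (factorCLM hLM.le))
      (extendedLocal Q μ L.1 (transverse L ⟨_, ha⟩ f)))) _
    (fun p => expIntegral (quotLattice Λ M.1) p) (fun f => vectorSpan ℝ f.1 ≠ ⊥)
    (fun f hf h => hv.ne_zero i (by rwa [h, Submodule.mem_bot] at hf))] at h1
  · exact h1
  · intro f hf
    rw [htrans f hf _ rfl]
    exact congrArg _ (pullbackHom_extendGerm Q hLM.le _ _).symm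

set_option maxHeartbeats 2000000 in
open Classical in
/-- The contributions of the positive-dimensional faces account for all poles of `S(a)`: by
induction, both have the same residue along each edge of `a`. -/
theorem exists_regular_part_expSum (L : RationalSubspace Λ) (a : AffineCone (quotLattice Λ L.1))
    (hline : ¬ ContainsLine a.1) [Fintype (Face a.1)]
    (IH : ∀ M : RationalSubspace Λ, L.1 < M.1 → ∀ b, EulerMaclaurin Q μ M b) :
    ∃ ψ ∈ rationalGerms (quotLattice Λ L.1), expSum (quotLattice Λ L.1) a.1 =
      (∑ f : Face a.1 with vectorSpan ℝ f.1 ≠ ⊥,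
        algebraMap _ (MeromorphicGerm (StrongDual ℝ (V ⧸ L.1)))
          (extendedLocal Q μ L.1 (transverse L a f)) * expIntegral (quotLattice Λ L.1) f.1) +
      algebraMap _ _ ψ := by
  have hdisc := discreteTopology_quotLattice Λ L.2
  obtain ⟨a, ha⟩ := a
  obtain ⟨ι, _, s, v, hs, rfl, hv⟩ := exists_edgeSystem ha hline
  choose M c hdvd N hN hSN using hv.exists_specializes Q μ L hs ha IH
  obtain ⟨ψ, hψ, hSψ⟩ := exists_regular_part c (fun i => 1 - expGerm (v i))
    (fun i => one_sub_expGerm_ne_zero (hv.ne_zero i)) hdvd (rationalGerms (quotLattice Λ L.1))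
    (expSum (quotLattice Λ L.1) ((fun y => s + y) '' cone v))
    (fun f => extendedLocal Q μ L.1 (transverse L ⟨_, ha⟩ f))
    (fun f : Face ((fun y => s + y) '' cone v) => expIntegral (quotLattice Λ L.1) f.1)
    (fun f => vectorSpan ℝ f.1 ≠ ⊥) (hv.denominator_mul_expSum s)
    (hv.denominator_mul_expIntegral hs) (fun f => extendGerm_mem_rationalGerms Q L.1 _ _)
    (fun i => ⟨N i, fun f _ => hN i f, hSN i⟩)
  exact ⟨ψ, mem_rationalGerms_of_prod_mul (fun i => isRationalPoint_of_mem (hv.mem i))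
    (fun i => exists_isDualIntegral_ne_zero Λ L.2 (hv.ne_zero i)) Finset.univ hψ, hSψ⟩

set_option maxHeartbeats 2000000 in
open Classical in
/-- The contribution of the vertex can be chosen so that the Euler–Maclaurin formula holds for a
pointed cone. -/
theorem exists_vertex_germ (L : RationalSubspace Λ) (a : AffineCone (quotLattice Λ L.1))
    (hline : ¬ ContainsLine a.1) [Fintype (Face a.1)]
    (IH : ∀ M : RationalSubspace Λ, L.1 < M.1 → ∀ b, EulerMaclaurin Q μ M b) :
    ∃ φ ∈ rationalGerms (quotLattice Λ L.1),
      expSum (quotLattice Λ L.1) a.1 =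
        ∑ f : Face a.1, algebraMap _ (MeromorphicGerm (StrongDual ℝ (V ⧸ L.1)))
          (if vectorSpan ℝ f.1 = ⊥ then φ else extendedLocal Q μ L.1 (transverse L a f)) *
            expIntegral (quotLattice Λ L.1) f.1 := by
  have := discreteTopology_quotLattice Λ L.2
  obtain ⟨s₀, f₀, hs₀, hf₀, hvert⟩ := exists_vertex a hline
  obtain ⟨ψ, hψ, hS⟩ := exists_regular_part_expSum Q μ L a hline IH
  have hs₀' : IsRationalPoint (quotLattice Λ L.1) (-s₀) := by
    obtain ⟨q, hq, hqs⟩ := hs₀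
    exact ⟨q, hq, by rw [smul_neg]; exact Submodule.neg_mem _ hqs⟩
  -- the factor `e^⟨ξ,-s₀⟩` compensates `I({s₀}) = e^⟨ξ,s₀⟩`
  refine ⟨ψ * expGerm (-s₀), Subring.mul_mem _ hψ (expGerm_mem_rationalGerms hs₀'), ?_⟩
  rw [hS, ← Finset.sum_filter_add_sum_filter_not Finset.univ
    (fun f : Face a.1 => vectorSpan ℝ f.1 ≠ ⊥)]
  congr 1
  · refine Finset.sum_congr rfl fun f hf => ?_
    rw [if_neg (Finset.mem_filter.1 hf).2]
  · have h1 : (Finset.univ.filter fun f : Face a.1 => ¬ vectorSpan ℝ f.1 ≠ ⊥) = {f₀} := by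
      ext f
      simp [hvert]
    rw [h1, Finset.sum_singleton, if_pos ((hvert f₀).2 rfl), hf₀, expIntegral_singleton _ hs₀,
      ← map_mul, mul_assoc, ← expGerm_add]
    simp [expGerm_zero]

end EulerMaclaurin

/-! ### Construction and uniqueness of the local germs -/

section LocalGerms

variable {V : Type*} [NormedAddCommGroup V] [NormedSpace ℝ V] [FiniteDimensional ℝ V]
  {Λ : Submodule ℤ V} (Q : RationalScalarProduct Λ)

open Classical in
/-- `φ` is a possible value at `a` of a family of germs with the given values `rec` on the cones in
proper quotients of `V ⧸ L`: it makes the Euler–Maclaurin formula hold for `a`, and it vanishes if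
`a` contains a line. -/
def IsLocalGerm (L : RationalSubspace Λ)
    (rec : ∀ M : RationalSubspace Λ, L.1 < M.1 →
      AffineCone (quotLattice Λ M.1) → RationalAnalyticGerm (quotLattice Λ M.1))
    (a : AffineCone (quotLattice Λ L.1)) (φ : RationalAnalyticGerm (quotLattice Λ L.1)) : Prop :=
  (ContainsLine a.1 → φ.1 = 0) ∧ ∃ _ : Fintype (Face a.1),
    expSum (quotLattice Λ L.1) a.1 =
      ∑ f : Face a.1, algebraMap _ (MeromorphicGerm (StrongDual ℝ (V ⧸ L.1)))
        (if h : L.1 < (faceSubspace L a f).1 then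
          extendGerm Q L.1 (faceSubspace L a f).1
            (rec (faceSubspace L a f) h (transverseCone L a f)).1
        else φ.1) * expIntegral (quotLattice Λ L.1) f.1

/-- Strict inclusion of rational subspaces is well-founded in the direction of proper quotients. -/
theorem wellFounded_properQuotient (Λ : Submodule ℤ V) :
    WellFounded fun M L : RationalSubspace Λ => L.1 < M.1 :=
  InvImage.wf Subtype.val (wellFounded_gt (α := Submodule ℝ V))

open Classical in
/-- The family of germs `μ`, constructed by recursion over the quotients of `V`. The value `0` in the
second case is never taken, by `exists_isLocalGerm`. -/
noncomputable def localGerm : ∀ L : RationalSubspace Λ,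
    AffineCone (quotLattice Λ L.1) → RationalAnalyticGerm (quotLattice Λ L.1) :=
  (wellFounded_properQuotient Λ).fix fun L rec a =>
    if h : ∃ φ, IsLocalGerm Q L rec a φ then h.choose
    else ⟨0, rationalGerms_prop (Subring.zero_mem _)⟩

theorem isLocalGerm_localGerm (L : RationalSubspace Λ) (a : AffineCone (quotLattice Λ L.1))
    (h : ∃ φ, IsLocalGerm Q L (fun M _ => localGerm Q M) a φ) :
    IsLocalGerm Q L (fun M _ => localGerm Q M) a (localGerm Q L a) := by
  have h1 : localGerm Q L a = h.choose :=
    (congrFun ((wellFounded_properQuotient Λ).fix_eq _ L) a).trans (dif_pos h)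
  rw [h1]
  exact h.choose_spec

variable (μ : ∀ L : RationalSubspace Λ,
  AffineCone (quotLattice Λ L.1) → RationalAnalyticGerm (quotLattice Λ L.1))

theorem lt_faceSubspace_iff (L : RationalSubspace Λ) (a : AffineCone (quotLattice Λ L.1))
    (f : Face a.1) : L.1 < (faceSubspace L a f).1 ↔ vectorSpan ℝ f.1 ≠ ⊥ := by
  rw [ne_eq, ← faceSubspace_eq_iff L a f]
  exact ⟨fun h h' => h.ne h'.symm, fun h => lt_of_le_of_ne (le_faceSubspace L a f) (Ne.symm h)⟩

theorem extendedLocal_transverse_of_eq_bot (L : RationalSubspace Λ)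
    (a : AffineCone (quotLattice Λ L.1)) (f : Face a.1) (hf : vectorSpan ℝ f.1 = ⊥) :
    extendedLocal Q μ L.1 (transverse L a f) = (μ L a).1 := by
  rw [transverse_eq_self L a f ((faceSubspace_eq_iff L a f).2 hf)]
  exact extendGerm_self Q L.1 _

theorem EulerMaclaurin.of_isLocalGerm {L : RationalSubspace Λ} {a : AffineCone (quotLattice Λ L.1)}
    (h : IsLocalGerm Q L (fun M _ => μ M) a (μ L a)) : EulerMaclaurin Q μ L a := by
  obtain ⟨-, hfin, h⟩ := h
  refine ⟨hfin, h.trans (Finset.sum_congr rfl fun f _ => ?_)⟩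
  congr 2
  split_ifs with hf
  · rfl
  · rw [lt_faceSubspace_iff, not_not] at hf
    exact (extendedLocal_transverse_of_eq_bot Q μ L a f hf).symm

variable {Q μ}

theorem expIntegral_face_eq_zero {W : Type*} [NormedAddCommGroup W] [NormedSpace ℝ W]
    [FiniteDimensional ℝ W] {Λ : Submodule ℤ W} (a : AffineCone Λ) (ha : ContainsLine a.1)
    (f : Face a.1) : expIntegral Λ f.1 = 0 := by
  revert ha f
  obtain ⟨a, s, _, -, ⟨k, v, -, rfl⟩, rfl⟩ := a
  intro ha f
  exact expIntegral_eq_zero (containsLine_face ha f)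

variable [DiscreteTopology Λ] [IsZLattice ℝ Λ]

set_option maxHeartbeats 1000000 in
theorem exists_isLocalGerm (L : RationalSubspace Λ) (a : AffineCone (quotLattice Λ L.1))
    (IH : ∀ M : RationalSubspace Λ, L.1 < M.1 → ∀ b, EulerMaclaurin Q μ M b) :
    ∃ φ, IsLocalGerm Q L (fun M _ => μ M) a φ := by
  classical
  have hfinite := finite_face a
  have hfin := Fintype.ofFinite (Face a.1)
  by_cases ha : ContainsLine a.1
  · refine ⟨⟨0, rationalGerms_prop (Subring.zero_mem _)⟩, fun _ => rfl, hfin, ?_⟩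
    rw [expSum_eq_zero ha, Finset.sum_eq_zero fun f _ => by
      rw [expIntegral_face_eq_zero a ha f, mul_zero]]
  · obtain ⟨φ, hφ, h⟩ := exists_vertex_germ Q μ L a ha IH
    refine ⟨⟨φ, rationalGerms_prop hφ⟩, fun h => absurd h ha, hfin,
      h.trans (Finset.sum_congr rfl fun f _ => ?_)⟩
    congr 2
    by_cases hf : vectorSpan ℝ f.1 = ⊥
    · rw [if_pos hf, dif_neg]
      rw [lt_faceSubspace_iff, not_not]
      exact hf
    · rw [if_neg hf, dif_pos ((lt_faceSubspace_iff L a f).2 hf)]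
      rfl

theorem isLocalGerm_localGerm_self (L : RationalSubspace Λ) (a : AffineCone (quotLattice Λ L.1)) :
    IsLocalGerm Q L (fun M _ => localGerm Q M) a (localGerm Q L a) := by
  induction L using (wellFounded_properQuotient Λ).induction with
  | _ L IH =>
    exact isLocalGerm_localGerm Q L a (exists_isLocalGerm L a fun M hM b =>
      EulerMaclaurin.of_isLocalGerm Q _ (IH M hM b))

set_option maxHeartbeats 1000000 in
/-- The Euler–Maclaurin formula for a pointed cone determines the germ of the cone, given the germs
of its transverse cones along positive-dimensional faces. -/
theorem EulerMaclaurin.eq_of_pointed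
    {ν : ∀ L : RationalSubspace Λ,
      AffineCone (quotLattice Λ L.1) → RationalAnalyticGerm (quotLattice Λ L.1)}
    {L : RationalSubspace Λ} {a : AffineCone (quotLattice Λ L.1)} (ha : ¬ ContainsLine a.1)
    (hμ : EulerMaclaurin Q μ L a) (hν : EulerMaclaurin Q ν L a)
    (IH : ∀ M : RationalSubspace Λ, L.1 < M.1 → ∀ b, μ M b = ν M b) : μ L a = ν L a := by
  classical
  have hdisc := discreteTopology_quotLattice Λ L.2
  obtain ⟨s, f₀, hs, hf₀, hvert⟩ := exists_vertex a ha
  obtain ⟨hfin, hμ⟩ := hμ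
  obtain ⟨hfin', hν⟩ := hν
  obtain rfl : hfin = hfin' := Subsingleton.elim _ _
  have h := hμ.symm.trans hν
  have hb := (hvert f₀).2 rfl
  rw [← Finset.add_sum_erase _ _ (Finset.mem_univ f₀),
    ← Finset.add_sum_erase _ _ (Finset.mem_univ f₀)] at h
  have h1 : ∀ f ∈ Finset.univ.erase f₀, extendedLocal Q μ L.1 (transverse L a f) =
      extendedLocal Q ν L.1 (transverse L a f) := by
    intro f hf
    have hlt := (lt_faceSubspace_iff L a f).2 fun h0 => Finset.ne_of_mem_erase hf ((hvert f).1 h0)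
    rw [extendedLocal, extendedLocal]
    exact congrArg (fun φ : RationalAnalyticGerm _ => extendGerm Q L.1 _ φ.1) (IH _ hlt _)
  rw [Finset.sum_congr rfl fun f hf => by rw [h1 f hf]] at h
  have h2 := add_right_cancel h
  rw [extendedLocal_transverse_of_eq_bot Q μ L a f₀ hb,
    extendedLocal_transverse_of_eq_bot Q ν L a f₀ hb, hf₀, expIntegral_singleton _ hs,
    ← map_mul, ← map_mul] at h2
  exact Subtype.ext (mul_right_cancel₀ (expGerm_ne_zero s) (IsFractionRing.injective _ _ h2))

set_option maxHeartbeats 1000000 in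
/-- For the cone `{0}` the formula reads `1 = μ({0}) * 1`. -/
theorem EulerMaclaurin.eq_one {L : RationalSubspace Λ} {a : AffineCone (quotLattice Λ L.1)}
    (hμ : EulerMaclaurin Q μ L a) (ha : a.1 = {0}) : (μ L a).1 = 1 := by
  obtain ⟨hfin, hμ⟩ := hμ
  have hface : ∀ f : Face a.1, f.1 = {0} := fun f => by
    have h1 : f.1 ⊆ {0} := f.2.2.subset.trans ha.subset
    exact (Set.subset_singleton_iff_eq.1 h1).resolve_left f.2.1.ne_empty
  have hself : IsExposed ℝ a.1 a.1 := fun _ => ⟨0, by simp⟩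
  let f₀ : Face a.1 := ⟨a.1, by rw [ha]; exact Set.singleton_nonempty _, hself⟩
  have huniv : (Finset.univ : Finset (Face a.1)) = {f₀} := by
    ext f
    simp only [Finset.mem_univ, Finset.mem_singleton, true_iff]
    exact Subtype.ext ((hface f).trans ha.symm)
  have hb : vectorSpan ℝ f₀.1 = ⊥ := by rw [hface, vectorSpan_singleton]
  have h0 : IsRationalPoint (quotLattice Λ L.1) 0 := ⟨1, one_ne_zero, by simp⟩
  have hdisc := discreteTopology_quotLattice Λ L.2
  rw [huniv, Finset.sum_singleton, extendedLocal_transverse_of_eq_bot Q μ L a f₀ hb, hface,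
    expIntegral_singleton _ h0, expGerm_zero, map_one, mul_one, ha, expSum_zero, ← map_one
      (algebraMap (AnalyticGerm (StrongDual ℝ (V ⧸ L.1))) _)] at hμ
  exact (IsFractionRing.injective _ _ hμ).symm

end LocalGerms

end RatCone

theorem theorem19 {V : Type*} [NormedAddCommGroup V] [NormedSpace ℝ V] [FiniteDimensional ℝ V]
    (Λ : Submodule ℤ V) [DiscreteTopology Λ] [IsZLattice ℝ Λ]
    (Q : RatCone.RationalScalarProduct Λ) :
    -- the meromorphic functions `S(a)` and `I(a)` are well defined
    (∀ (L : RatCone.RationalSubspace Λ) (a : RatCone.AffineCone (RatCone.quotLattice Λ L.1)),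
      (∃! m, RatCone.IsExpSum (RatCone.quotLattice Λ L.1) a.1 m) ∧
      (∃! m, RatCone.IsExpIntegral (RatCone.quotLattice Λ L.1) a.1 m)) ∧
    ∃! μ : (∀ L : RatCone.RationalSubspace Λ,
        RatCone.AffineCone (RatCone.quotLattice Λ L.1) →
          RatCone.RationalAnalyticGerm (RatCone.quotLattice Λ L.1)),
      (∀ (L : RatCone.RationalSubspace Λ) (a : RatCone.AffineCone (RatCone.quotLattice Λ L.1)),
        L.1 = ⊤ → a.1 = {0} → (μ L a).1 = 1) ∧
      (∀ (L : RatCone.RationalSubspace Λ) (a : RatCone.AffineCone (RatCone.quotLattice Λ L.1)),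
        RatCone.ContainsLine a.1 → (μ L a).1 = 0) ∧
      (∀ (L : RatCone.RationalSubspace Λ) (a : RatCone.AffineCone (RatCone.quotLattice Λ L.1)),
        ∃ _ : Fintype (RatCone.Face a.1),
          RatCone.expSum (RatCone.quotLattice Λ L.1) a.1 =
            ∑ f : RatCone.Face a.1,
              algebraMap _ (RatCone.MeromorphicGerm (StrongDual ℝ (V ⧸ L.1)))
                (RatCone.extendGerm Q L.1 (RatCone.faceSubspace L a f).1
                  (μ (RatCone.faceSubspace L a f) (RatCone.transverseCone L a f)).1) *
              RatCone.expIntegral (RatCone.quotLattice Λ L.1) f.1) := by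
  refine ⟨fun L a => ?_, RatCone.localGerm Q, ⟨fun L a _ ha => ?_, fun L a ha => ?_, fun L a => ?_⟩,
    fun ν ⟨_, hν0, hν⟩ => ?_⟩
  · have := RatCone.discreteTopology_quotLattice Λ L.2
    exact ⟨RatCone.existsUnique_isExpSum a.2, RatCone.existsUnique_isExpIntegral a.2⟩
  · exact (RatCone.EulerMaclaurin.of_isLocalGerm Q _
      (RatCone.isLocalGerm_localGerm_self L a)).eq_one ha
  · exact (RatCone.isLocalGerm_localGerm_self L a).1 ha
  · exact RatCone.EulerMaclaurin.of_isLocalGerm Q _ (RatCone.isLocalGerm_localGerm_self L a)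
  · funext L a
    induction L using (RatCone.wellFounded_properQuotient Λ).induction with
    | _ L IH =>
      have hL := RatCone.isLocalGerm_localGerm_self (Q := Q) L a
      by_cases ha : RatCone.ContainsLine a.1
      · exact Subtype.ext ((hν0 L a ha).trans (hL.1 ha).symm)
      · exact RatCone.EulerMaclaurin.eq_of_pointed ha (hν L a)
          (RatCone.EulerMaclaurin.of_isLocalGerm Q _ hL) IH
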